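/- A two-terminal undirected multigraph is series-parallel if it is a single edge joining two distinct vertices $a,b$ (its terminals), or is obtained from series-parallel graphs $G_1$ (terminals $a_1,b_1$) and $G_2$ (terminals $a_2,b_2$) by identifying $b_1$ with $a_2$ (terminals $a_1,b_2$; series composition), or by identifying $a_1$ with $a_2$ and $b_1$ with $b_2$ (terminals $a_1,b_1$; parallel composition). A network is an undirected multigraph $G=(V,E)$ with $m=|E|$ edges, a cost $c_e\ge 0$ (a nonnegative real number) and a nonnegative integer capacity $u_e$ for each edge $e$, and two distinct vertices $s$ and $t$. An $s$-$t$ flow gives each edge a direction and a value between $0$ and $u_e$ such that flow is conserved at each vertex other than $s,t$; its value is the net flow out of $s$. For $S\subseteq E$ let $c(S)=\sum_{e\in S}c_e$ and let $\mathrm{maxflow}(S)$ be the maximum value of an $s$-$t$ flow in $(V,S)$. Let $F=\mathrm{maxflow}(E)$. Budget-Constrained Max Flow Problem (BCMFP): given a network and a budget $B\ge 0$, find $S\subseteq E$ with $c(S)\le B$ that maximizes $\mathrm{maxflow}(S)$. Single-pair Capacitated Network Design Problem (CapNDP): given a network and an integer demand $D\ge 0$, find $S\subseteq E$ with $\mathrm{maxflow}(S)\ge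 D$ that minimizes $c(S)$, or report that there is no $S$ with $\mathrm{maxflow}(S)\ge D$. Theorem. There are an algorithm that solves the BCMFP and an algorithm that solves the single-pair CapNDP on all networks whose underlying undirected multigraph is series-parallel for some choice of terminals. The terminals need not coincide with $s$ and $t$, and neither the terminals nor a series-parallel decomposition is part of the input. Both algorithms run in pseudopolynomial time, namely in $O(m(F+1)^4)$ operations, that is, $O(mF^4)$ operations when $F\ge 1$, with an absolute implied constant. Here the model of computation is a random access machine with arrays whose operations are, at unit cost, reading and writing array entries, addition, truncated subtraction and comparison of natural numbers, and addition and comparison of costs (there is no multiplication). -/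

import Mathlib

open scoped NNReal

namespace SPNet

/-! ## Undirected capacitated multigraphs, flows and the two problems -/

/-- An undirected multigraph on the vertices `0, …, n-1` with edges `0, …, m-1` (parallel edges
allowed), with nonnegative costs, nonnegative integral capacities, and a source and a sink.
The two endpoints of an edge `e` are `src e` and `tgt e`; the order in which they are listed is
arbitrary and only serves as a reference orientation for the sign of a flow on `e`. -/
structure Network (n m : ℕ) where
  src : Fin m → Fin n
  tgt : Fin m → Fin n
  cap : Fin m → ℕ
  cost : Fin m → ℝ≥0
  s : Fin n
  t : Fin n
  s_ne_t : s ≠ t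

namespace Network

/-- `G.IsSP V' E' a b`: the subgraph of `G` with vertex set `V'` and edge set `E'` is
series-parallel with terminals `a` and `b`. -/
inductive IsSP {n m : ℕ} (G : Network n m) :
    Finset (Fin n) → Finset (Fin m) → Fin n → Fin n → Prop
  | edge (e : Fin m) (a b : Fin n) (hab : a ≠ b) (he : s(G.src e, G.tgt e) = s(a, b)) :
      IsSP G {a, b} {e} a b
  | series (V₁ V₂ : Finset (Fin n)) (E₁ E₂ : Finset (Fin m)) (a c b : Fin n)
      (h₁ : IsSP G V₁ E₁ a c) (h₂ : IsSP G V₂ E₂ c b)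
      (hV : V₁ ∩ V₂ = {c}) (hE : Disjoint E₁ E₂) :
      IsSP G (V₁ ∪ V₂) (E₁ ∪ E₂) a b
  | parallel (V₁ V₂ : Finset (Fin n)) (E₁ E₂ : Finset (Fin m)) (a b : Fin n)
      (h₁ : IsSP G V₁ E₁ a b) (h₂ : IsSP G V₂ E₂ a b)
      (hV : V₁ ∩ V₂ = {a, b}) (hE : Disjoint E₁ E₂) :
      IsSP G (V₁ ∪ V₂) (E₁ ∪ E₂) a b

/-- The whole graph is series-parallel, for some pair of terminals (which need not be related to
the source and the sink). -/
def IsSeriesParallel {n m : ℕ} (G : Network n m) : Prop :=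
  ∃ a b : Fin n, G.IsSP Finset.univ Finset.univ a b

/-- Net amount of `f` leaving the vertex `v`. A positive value `f e` is a flow of `f e` from `src e`
to `tgt e`, a negative one a flow of `-f e` from `tgt e` to `src e`. -/
def netOut {n m : ℕ} (G : Network n m) (f : Fin m → ℝ) (v : Fin n) : ℝ :=
  (∑ e with G.src e = v, f e) - ∑ e with G.tgt e = v, f e

/-- `f` is an `s`-`t` flow in the subgraph with all the vertices and the edge set `S`. -/
structure IsFlow {n m : ℕ} (G : Network n m) (S : Finset (Fin m)) (f : Fin m → ℝ) : Prop where
  capacity : ∀ e, |f e| ≤ G.cap e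
  support : ∀ e, e ∉ S → f e = 0
  conservation : ∀ v, v ≠ G.s → v ≠ G.t → G.netOut f v = 0

/-- The set of values of `s`-`t` flows in the subgraph with edge set `S`. -/
def flowValues {n m : ℕ} (G : Network n m) (S : Finset (Fin m)) : Set ℝ :=
  {x | ∃ f : Fin m → ℝ, G.IsFlow S f ∧ G.netOut f G.s = x}

/-- The value of a maximum `s`-`t` flow in the subgraph with edge set `S`. -/
noncomputable def maxFlow {n m : ℕ} (G : Network n m) (S : Finset (Fin m)) : ℝ :=
  sSup (G.flowValues S)

theorem flowValues_nonempty {n m : ℕ} (G : Network n m) (S : Finset (Fin m)) :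
    (G.flowValues S).Nonempty :=
  ⟨0, fun _ => 0, ⟨fun e => by simp, fun _ _ => rfl, fun _ _ _ => by simp [netOut]⟩,
    by simp [netOut]⟩

/-- The supremum defining `maxFlow` is attained. -/
theorem maxFlow_isGreatest {n m : ℕ} (G : Network n m) (S : Finset (Fin m)) :
    IsGreatest (G.flowValues S) (G.maxFlow S) := by
  have hcont : ∀ v, Continuous fun f : Fin m → ℝ => G.netOut f v := fun v => by
    unfold netOut; fun_prop
  have hset : {f : Fin m → ℝ | G.IsFlow S f} =
      (⋂ e, {f : Fin m → ℝ | |f e| ≤ (G.cap e : ℝ)}) ∩ ((⋂ e, ⋂ (_ : e ∉ S), {f : Fin m → ℝ | f e = 0}) ∩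
        ⋂ v, ⋂ (_ : v ≠ G.s), ⋂ (_ : v ≠ G.t), {f : Fin m → ℝ | G.netOut f v = 0}) := by
    ext f
    simp only [Set.mem_ofPred_eq, Set.mem_inter_iff, Set.mem_iInter]
    exact ⟨fun h => ⟨h.1, h.2, h.3⟩, fun h => ⟨h.1, h.2.1, h.2.2⟩⟩
  have hclosed : IsClosed {f : Fin m → ℝ | G.IsFlow S f} := by
    rw [hset]
    refine IsClosed.inter (isClosed_iInter fun e => ?_) (IsClosed.inter
      (isClosed_iInter fun e => isClosed_iInter fun _ => ?_)
      (isClosed_iInter fun v => isClosed_iInter fun _ => isClosed_iInter fun _ => ?_))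
    · exact isClosed_le (by fun_prop) continuous_const
    · exact isClosed_eq (by fun_prop) continuous_const
    · exact isClosed_eq (hcont v) continuous_const
  have hcomp : IsCompact {f : Fin m → ℝ | G.IsFlow S f} := by
    refine (isCompact_univ_pi (s := fun e => Set.Icc (-(G.cap e : ℝ)) (G.cap e))
      fun e => isCompact_Icc).of_isClosed_subset hclosed fun f hf e _ => ?_
    exact abs_le.mp (hf.capacity e)
  have himg : G.flowValues S = (fun f => G.netOut f G.s) '' {f | G.IsFlow S f} := rfl
  have hc := hcomp.image (hcont G.s)
  rw [← himg] at hc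
  exact hc.isGreatest_sSup (G.flowValues_nonempty S)

/-- The cost of buying the edges of `S`. -/
def totalCost {n m : ℕ} (G : Network n m) (S : Finset (Fin m)) : ℝ≥0 :=
  ∑ e ∈ S, G.cost e

/-- `S` is an optimal solution of the budget-constrained max flow problem with budget `B`. -/
def IsBCMFPSolution {n m : ℕ} (G : Network n m) (B : ℝ≥0) (S : Finset (Fin m)) : Prop :=
  G.totalCost S ≤ B ∧
    ∀ S' : Finset (Fin m), G.totalCost S' ≤ B → G.maxFlow S' ≤ G.maxFlow S

/-- `S` meets the demand `D`. -/
def MeetsDemand {n m : ℕ} (G : Network n m) (D : ℕ) (S : Finset (Fin m)) : Prop :=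
  (D : ℝ) ≤ G.maxFlow S

/-- `S` is an optimal solution of the single-pair capacitated network design problem with
demand `D`. -/
def IsCapNDPSolution {n m : ℕ} (G : Network n m) (D : ℕ) (S : Finset (Fin m)) : Prop :=
  G.MeetsDemand D S ∧
    ∀ S' : Finset (Fin m), G.MeetsDemand D S' → G.totalCost S ≤ G.totalCost S'

end Network

/-! ## The machine model

A random access machine whose memory consists of arrays `0, 1, 2, …` of natural numbers and of
arrays `0, 1, 2, …` of costs. A program names its arrays by constants, so it uses finitely many of
them; indices into an array are computed. Numbers are added, subtracted and compared, and costs are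
added and compared, at unit cost. There is no multiplication. -/

/-- Memory contents: `nat a i` and `cst a i` are the entries with index `i` of the `a`-th array of
natural numbers and of the `a`-th array of costs. -/
@[ext]
structure State where
  nat : ℕ → ℕ → ℕ
  cst : ℕ → ℕ → ℝ≥0

/-- Store the number `k` in the `a`-th array of natural numbers at index `i`. -/
def State.storeN (σ : State) (a i k : ℕ) : State where
  nat := Function.update σ.nat a (Function.update (σ.nat a) i k)
  cst := σ.cst

/-- Store the cost `c` in the `a`-th array of costs at index `i`. -/
def State.storeC (σ : State) (a i : ℕ) (c : ℝ≥0) : State where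
  nat := σ.nat
  cst := Function.update σ.cst a (Function.update (σ.cst a) i c)

/-- Expressions for natural numbers; `monus` is truncated subtraction. -/
inductive NExpr
  | lit (k : ℕ)
  | get (a : ℕ) (i : NExpr)
  | add (x y : NExpr)
  | monus (x y : NExpr)

namespace NExpr

def eval (σ : State) : NExpr → ℕ
  | lit k => k
  | get a i => σ.nat a (i.eval σ)
  | add x y => x.eval σ + y.eval σ
  | monus x y => x.eval σ - y.eval σ

/-- The number of operations needed to evaluate the expression. -/
def time : NExpr → ℕ
  | lit _ => 1
  | get _ i => i.time + 1
  | add x y => x.time + y.time + 1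
  | monus x y => x.time + y.time + 1

end NExpr

/-- Expressions for costs. -/
inductive CExpr
  | zero
  | get (a : ℕ) (i : NExpr)
  | add (x y : CExpr)

namespace CExpr

noncomputable def eval (σ : State) : CExpr → ℝ≥0
  | zero => 0
  | get a i => σ.cst a (i.eval σ)
  | add x y => x.eval σ + y.eval σ

/-- The number of operations needed to evaluate the expression. -/
def time : CExpr → ℕ
  | zero => 1
  | get _ i => i.time + 1
  | add x y => x.time + y.time + 1

end CExpr

/-- Tests. -/
inductive Test
  | eq (x y : NExpr)
  | lt (x y : NExpr)
  | costLe (x y : CExpr)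
  | not (p : Test)
  | and (p q : Test)

namespace Test

def Holds (σ : State) : Test → Prop
  | eq x y => x.eval σ = y.eval σ
  | lt x y => x.eval σ < y.eval σ
  | costLe x y => x.eval σ ≤ y.eval σ
  | not p => ¬ p.Holds σ
  | and p q => p.Holds σ ∧ q.Holds σ

/-- The number of operations needed to evaluate the test. -/
def time : Test → ℕ
  | eq x y => x.time + y.time + 1
  | lt x y => x.time + y.time + 1
  | costLe x y => x.time + y.time + 1
  | not p => p.time + 1
  | and p q => p.time + q.time + 1

end Test

/-- Programs: `setN a i x` stores `x` in the `a`-th array of natural numbers at index `i`, and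
`setC a i x` does the same for costs; `loop p body` runs `body` as long as `p` holds. -/
inductive Prog
  | skip
  | setN (a : ℕ) (i x : NExpr)
  | setC (a : ℕ) (i : NExpr) (x : CExpr)
  | seq (P Q : Prog)
  | ite (p : Test) (P Q : Prog)
  | loop (p : Test) (body : Prog)

/-- `Exec P σ T τ`: started in the state `σ`, the program `P` halts after exactly `T` operations,
in the state `τ`. -/
inductive Exec : Prog → State → ℕ → State → Prop
  | skip (σ : State) : Exec .skip σ 1 σ
  | setN (σ : State) (a : ℕ) (i x : NExpr) :
      Exec (.setN a i x) σ (i.time + x.time + 1)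
        (σ.storeN a (i.eval σ) (x.eval σ))
  | setC (σ : State) (a : ℕ) (i : NExpr) (x : CExpr) :
      Exec (.setC a i x) σ (i.time + x.time + 1)
        (σ.storeC a (i.eval σ) (x.eval σ))
  | seq (P Q : Prog) (σ τ ρ : State) (T₁ T₂ : ℕ) (h₁ : Exec P σ T₁ τ) (h₂ : Exec Q τ T₂ ρ) :
      Exec (.seq P Q) σ (T₁ + T₂) ρ
  | iteTrue (p : Test) (P Q : Prog) (σ τ : State) (T : ℕ) (hp : p.Holds σ) (h : Exec P σ T τ) :
      Exec (.ite p P Q) σ (p.time + 1 + T) τ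
  | iteFalse (p : Test) (P Q : Prog) (σ τ : State) (T : ℕ) (hp : ¬ p.Holds σ)
      (h : Exec Q σ T τ) :
      Exec (.ite p P Q) σ (p.time + 1 + T) τ
  | loopFalse (p : Test) (P : Prog) (σ : State) (hp : ¬ p.Holds σ) :
      Exec (.loop p P) σ (p.time + 1) σ
  | loopTrue (p : Test) (P : Prog) (σ τ ρ : State) (T₁ T₂ : ℕ) (hp : p.Holds σ)
      (h₁ : Exec P σ T₁ τ) (h₂ : Exec (.loop p P) τ T₂ ρ) :
      Exec (.loop p P) σ (p.time + 1 + T₁ + T₂) ρ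

/-- The machine is deterministic: the running time and the result are unique. -/
theorem Exec.deterministic {P : Prog} {σ τ τ' : State} {T T' : ℕ}
    (h : Exec P σ T τ) (h' : Exec P σ T' τ') : T = T' ∧ τ = τ' := by
  induction h generalizing T' τ' with
  | skip => cases h'; exact ⟨rfl, rfl⟩
  | setN => cases h'; exact ⟨rfl, rfl⟩
  | setC => cases h'; exact ⟨rfl, rfl⟩
  | seq P Q σ τ ρ T₁ T₂ h₁ h₂ ih₁ ih₂ =>
    cases h' with
    | seq _ _ _ τ₂ _ S₁ S₂ k₁ k₂ =>
      obtain ⟨rfl, rfl⟩ := ih₁ k₁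
      obtain ⟨rfl, rfl⟩ := ih₂ k₂
      exact ⟨rfl, rfl⟩
  | iteTrue p P Q σ τ T hp h ih =>
    cases h' with
    | iteTrue _ _ _ _ _ _ _ k => obtain ⟨rfl, rfl⟩ := ih k; exact ⟨rfl, rfl⟩
    | iteFalse _ _ _ _ _ _ hn _ => exact absurd hp hn
  | iteFalse p P Q σ τ T hp h ih =>
    cases h' with
    | iteTrue _ _ _ _ _ _ hn _ => exact absurd hn hp
    | iteFalse _ _ _ _ _ _ _ k => obtain ⟨rfl, rfl⟩ := ih k; exact ⟨rfl, rfl⟩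
  | loopFalse p P σ hp =>
    cases h' with
    | loopFalse => exact ⟨rfl, rfl⟩
    | loopTrue _ _ _ _ _ _ _ hn _ _ => exact absurd hn hp
  | loopTrue p P σ τ ρ T₁ T₂ hp h₁ h₂ ih₁ ih₂ =>
    cases h' with
    | loopFalse _ _ _ hn => exact absurd hp hn
    | loopTrue _ _ _ τ₂ _ S₁ S₂ _ k₁ k₂ =>
      obtain ⟨rfl, rfl⟩ := ih₁ k₁
      obtain ⟨rfl, rfl⟩ := ih₂ k₂
      exact ⟨rfl, rfl⟩

/-! ## Input and output -/

/-- The array with the entries of `g`, followed by zeros. -/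
def arrayOf {α : Type*} [Zero α] {m : ℕ} (g : Fin m → α) (i : ℕ) : α :=
  if h : i < m then g ⟨i, h⟩ else 0

/-- The memory that holds the network `G` and the additional parameters `D` and `B`:
the number array `0` is `n, m, s, t, D, 0, 0, …`, the number arrays `1`, `2`, `3` list the two
endpoints and the capacities of the edges, the cost array `0` lists the costs of the edges and the
cost array `1` is `B, 0, 0, …`. All other entries are `0`. No terminals and no series-parallel
decomposition are given. -/
def input {n m : ℕ} (G : Network n m) (D : ℕ) (B : ℝ≥0) : State where
  nat a := match a with
    | 0 => arrayOf ![n, m, (G.s : ℕ), (G.t : ℕ), D]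
    | 1 => arrayOf fun e => (G.src e : ℕ)
    | 2 => arrayOf fun e => (G.tgt e : ℕ)
    | 3 => arrayOf G.cap
    | _ => fun _ => 0
  cst a := match a with
    | 0 => arrayOf G.cost
    | 1 => arrayOf ![B]
    | _ => fun _ => 0

/-- The input of the budget-constrained max flow problem. -/
def inputBCMFP {n m : ℕ} (G : Network n m) (B : ℝ≥0) : State := input G 0 B

/-- The input of the capacitated network design problem. -/
def inputCapNDP {n m : ℕ} (G : Network n m) (D : ℕ) : State := input G D 0

/-- The edge set that is returned: the edges with a nonzero entry in the number array `4`. -/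
def State.outputEdges (τ : State) (m : ℕ) : Finset (Fin m) :=
  {e : Fin m | τ.nat 4 e ≠ 0}

/-- The answer "there is a feasible solution": the number array `5` has a nonzero entry at
index `0`. -/
def State.AnswersFeasible (τ : State) : Prop := τ.nat 5 0 ≠ 0

end SPNet

/-!
The network is decomposed into pieces, which are attached to the rest at one or two vertices, by
eliminating one vertex after another. As long as at least two vertices are left, a series-parallel
graph, or any connected graph of tree-width two, has a vertex with one or two neighbours
(`SPNet.Sparse.exists_low`). Eliminating it, by a series composition of the pieces on its two sides
or by attaching a pendant piece to its only neighbour, and combining parallel pieces leads to a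
smaller graph of the same kind (`SPNet.Sparse.eliminate`). The vertices `s` and `t` are eliminated
like all others: a vertex that disappears inside a piece contributes its supply, which is `v` for
`s` and `-v` for `t`, to the balance of the piece. In the end a single vertex is left, and the piece
attached to it is the whole network (`SPNet.Red.final`). So the terminals of a series-parallel
decomposition play no role.

For each piece and each amount `x` with `-v ≤ x ≤ v` that enters it at its first end, the minimum
cost of a selection of edges that allows this is computed from the parts of the piece
(`SPNet.Tree.val`); the amount that leaves at the second end is determined by `x` and the supply.
The computed cost of the root is the minimum cost of an edge set that carries a flow of value `v`:

* It is at most the cost of any such set (`SPNet.Tree.val_le_totalCost`). An acyclic flow of value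
  `v` never sends more than `v` through a piece (`SPNet.Network.exists_isTame`), and the amounts
  that can enter a piece form an interval with integral ends (`SPNet.Tree.feas_iff_Icc`), so that
  only integral amounts have to be considered.
* It is attained by the set that is found by backtracking (`SPNet.Tree.Sel.cost_le`,
  `SPNet.Tree.Sel.le_maxFlow`).

The algorithms do this for `v = 0, 1, 2, …`, until the cost exceeds the budget or is infinite, or
until the demand is met. As maximum flows are integers (`SPNet.Network.exists_nat_maxFlow`), the
last selection is optimal. There are at most `F + 2` rounds, and the computation for `v` takes time
`O(m (v + 1) ^ 2)`, which is well below the bound.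

For the reduction in time `O(m)`, the pieces are stored in a matrix indexed by pairs of vertices,
and for each vertex only the number, the sum and the sum of the squares of its neighbours are
maintained. These are easy to update, and they determine the neighbours if there are at most two
(`SPNet.cutTwo_spec`). Tables of squares, of square roots, of halves and of multiples of `n` replace
multiplication and division.
-/

open scoped NNReal

namespace SPNet
namespace Network

variable {n m : ℕ}

/-! ### Flows -/

/-- The incidence number of the edge `e` and the vertex `y`: `1` if `e` leaves `y`, `-1` if it
enters `y`, and `0` otherwise (also if `e` is a loop at `y`). -/
def inc (G : Network n m) (e : Fin m) (y : Fin n) : ℝ :=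
  (if G.src e = y then 1 else 0) - (if G.tgt e = y then 1 else 0)

/-- The net amount of `f` that leaves `y` along the edges of `E`. -/
def outOn (G : Network n m) (f : Fin m → ℝ) (E : Finset (Fin m)) (y : Fin n) : ℝ :=
  ∑ e ∈ E, f e * G.inc e y

/-- The supply of a vertex in a flow of value one. -/
def st (G : Network n m) (y : Fin n) : ℤ :=
  (if y = G.s then 1 else 0) - (if y = G.t then 1 else 0)

/-- The total supply of a set of vertices in a flow of value one. -/
def supply (G : Network n m) (X : Finset (Fin n)) : ℤ := ∑ y ∈ X, G.st y

theorem netOut_eq (G : Network n m) (f : Fin m → ℝ) (y : Fin n) :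
    G.netOut f y = ∑ e, f e * G.inc e y := by
  simp [netOut, inc, mul_sub, Finset.sum_sub_distrib, Finset.sum_filter]

theorem netOut_add (G : Network n m) (f g : Fin m → ℝ) (y : Fin n) :
    G.netOut (fun e => f e + g e) y = G.netOut f y + G.netOut g y := by
  simp [netOut_eq, add_mul, Finset.sum_add_distrib]

theorem netOut_smul (G : Network n m) (c : ℝ) (f : Fin m → ℝ) (y : Fin n) :
    G.netOut (fun e => c * f e) y = c * G.netOut f y := by
  simp [netOut_eq, Finset.mul_sum, mul_assoc]

theorem netOut_single (G : Network n m) (e : Fin m) (c : ℝ) (y : Fin n) :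
    G.netOut (fun e' => if e' = e then c else 0) y = c * G.inc e y := by
  simp [netOut_eq]

theorem sum_netOut (G : Network n m) (f : Fin m → ℝ) (U : Finset (Fin n)) :
    ∑ y ∈ U, G.netOut f y =
      ∑ e, f e * ((if G.src e ∈ U then 1 else 0) - (if G.tgt e ∈ U then 1 else 0)) := by
  simp only [netOut_eq]
  rw [Finset.sum_comm]
  simp [inc, ← Finset.mul_sum, Finset.sum_sub_distrib]

theorem sum_netOut_univ (G : Network n m) (f : Fin m → ℝ) : ∑ y, G.netOut f y = 0 := by
  rw [sum_netOut]; simp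

theorem supply_le (G : Network n m) (X : Finset (Fin n)) :
    G.supply X = (if G.s ∈ X then 1 else 0) - (if G.t ∈ X then 1 else 0) := by
  simp [supply, st, Finset.sum_sub_distrib]

theorem supply_bounds (G : Network n m) (X : Finset (Fin n)) :
    -1 ≤ G.supply X ∧ G.supply X ≤ 1 := by
  rw [supply_le]; split_ifs <;> simp

theorem IsFlow.netOut_t {G : Network n m} {S : Finset (Fin m)} {f : Fin m → ℝ}
    (hf : G.IsFlow S f) : G.netOut f G.t = - G.netOut f G.s := by
  have h := G.sum_netOut_univ f
  rw [← Finset.add_sum_erase _ _ (Finset.mem_univ G.s),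
    ← Finset.add_sum_erase _ _ (Finset.mem_erase.2 ⟨G.s_ne_t.symm, Finset.mem_univ G.t⟩),
    Finset.sum_eq_zero (s := (Finset.univ.erase G.s).erase G.t)] at h
  · linarith
  · intro y hy
    simp only [Finset.mem_erase] at hy
    exact hf.conservation y hy.2.1 hy.1

theorem IsFlow.netOut_eq_st {G : Network n m} {S : Finset (Fin m)} {f : Fin m → ℝ}
    (hf : G.IsFlow S f) (y : Fin n) : G.netOut f y = G.netOut f G.s * G.st y := by
  by_cases h1 : y = G.s
  · subst h1; simp [st, G.s_ne_t]
  by_cases h2 : y = G.t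
  · subst h2; simp [st, G.s_ne_t.symm, hf.netOut_t]
  · simp [st, h1, h2, hf.conservation y h1 h2]

theorem isFlow_of_netOut {G : Network n m} {S : Finset (Fin m)} {f : Fin m → ℝ} {v : ℝ}
    (hc : ∀ e, |f e| ≤ G.cap e) (hs : ∀ e, e ∉ S → f e = 0)
    (hn : ∀ y, G.netOut f y = v * G.st y) : G.IsFlow S f ∧ G.netOut f G.s = v := by
  refine ⟨⟨hc, hs, fun y h1 h2 => by rw [hn]; simp [st, h1, h2]⟩, ?_⟩
  rw [hn]; simp [st, G.s_ne_t]

theorem le_maxFlow {G : Network n m} {S : Finset (Fin m)} {f : Fin m → ℝ}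
    (hf : G.IsFlow S f) : G.netOut f G.s ≤ G.maxFlow S :=
  (G.maxFlow_isGreatest S).2 ⟨f, hf, rfl⟩

theorem maxFlow_nonneg (G : Network n m) (S : Finset (Fin m)) : 0 ≤ G.maxFlow S :=
  (G.maxFlow_isGreatest S).2 ⟨fun _ => 0, ⟨fun e => by simp, fun _ _ => rfl,
    fun _ _ _ => by simp [netOut]⟩, by simp [netOut]⟩

theorem maxFlow_mono (G : Network n m) {S S' : Finset (Fin m)} (h : S ⊆ S') :
    G.maxFlow S ≤ G.maxFlow S' := by
  obtain ⟨f, hf, hv⟩ := (G.maxFlow_isGreatest S).1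
  rw [← hv]
  exact le_maxFlow ⟨hf.1, fun e he => hf.2 e fun h' => he (h h'), hf.3⟩

/-- A flow value `x` stays within the capacity `c` when it is changed by a small multiple of a
direction `h` that leads away from each bound that is attained. -/
theorem eventually_abs_add_le {x h c : ℝ} (hx : |x| ≤ c) (h1 : 0 < h → x < c)
    (h2 : h < 0 → -c < x) : ∀ᶠ ε in nhdsWithin (0 : ℝ) (Set.Ioi 0), |x + ε * h| ≤ c := by
  rw [abs_le] at hx
  rcases lt_trichotomy h 0 with hh | rfl | hh
  · filter_upwards [Ioo_mem_nhdsGT (show 0 < (x + c) / -h from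
      div_pos (by linarith [h2 hh]) (by linarith))] with ε hε
    have h3 := (lt_div_iff₀ (by linarith)).1 hε.2
    have h4 := mul_neg_of_pos_of_neg hε.1 hh
    exact abs_le.2 ⟨by linarith, by linarith⟩
  · simpa [abs_le] using hx
  · filter_upwards [Ioo_mem_nhdsGT (show 0 < (c - x) / h from
      div_pos (by linarith [h1 hh]) hh)] with ε hε
    have h3 := (lt_div_iff₀ hh).1 hε.2
    have h4 := mul_pos hε.1 hh
    exact abs_le.2 ⟨by linarith, by linarith⟩

/-- The absolute value of `x` decreases when a small multiple of a direction `h` of the same sign is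
subtracted. -/
theorem eventually_abs_sub_eq {x h : ℝ} (h1 : 0 ≤ h * x) (h2 : x = 0 → h = 0) :
    ∀ᶠ ε in nhdsWithin (0 : ℝ) (Set.Ioi 0), |x - ε * h| = |x| - ε * |h| := by
  rcases eq_or_ne h 0 with rfl | hh
  · simp
  have hx : x ≠ 0 := fun hx => hh (h2 hx)
  filter_upwards [Ioo_mem_nhdsGT (show 0 < |x| / |h| by positivity)] with ε hε
  have h3 := (lt_div_iff₀ (abs_pos.2 hh)).1 hε.2
  rcases lt_or_gt_of_ne hx with hx | hx
  · have hh' : h < 0 := lt_of_le_of_ne (by nlinarith) hh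
    rw [abs_of_neg hx, abs_of_neg hh'] at *
    rw [abs_of_nonpos (by linarith)]; ring
  · have hh' : 0 < h := lt_of_le_of_ne (by nlinarith) hh.symm
    rw [abs_of_pos hx, abs_of_pos hh'] at *
    rw [abs_of_nonneg (by linarith)]

/-- Extending a flow direction from a vertex `z` to its neighbour `w` along the edge `e`, where
`c = 1` if `e` is traversed forwards and `c = -1` if it is traversed backwards. -/
theorem netOut_extend (G : Network n m) {h : Fin m → ℝ} {a z w : Fin n} {e : Fin m} {c : ℝ}
    (h1 : ∀ y, G.netOut h y = (if a = y then 1 else 0) - (if z = y then 1 else 0))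
    (hc : (c = 1 ∧ G.src e = z ∧ G.tgt e = w) ∨ (c = -1 ∧ G.src e = w ∧ G.tgt e = z)) (y : Fin n) :
    G.netOut (fun e' => h e' + (if e' = e then c else 0)) y =
      (if a = y then 1 else 0) - (if w = y then 1 else 0) := by
  rw [netOut_add, netOut_single, h1, inc]
  rcases hc with ⟨rfl, rfl, rfl⟩ | ⟨rfl, rfl, rfl⟩ <;> ring

/-- The value of a maximum flow is an integer. The cut that shows this consists of the vertices that
can be reached from the source in the residual network; reachability is expressed by a flow
direction `h` instead of a path. -/
theorem exists_nat_maxFlow (G : Network n m) (S : Finset (Fin m)) :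
    ∃ N : ℕ, G.maxFlow S = N := by
  classical
  obtain ⟨f, hf, hv⟩ := (G.maxFlow_isGreatest S).1
  let Res : Fin m → ℝ → Prop := fun e c =>
    (0 < c → e ∈ S ∧ f e < G.cap e) ∧ (c < 0 → e ∈ S ∧ -G.cap e < f e)
  let Reach : Fin n → Prop := fun z => ∃ h : Fin m → ℝ,
    (∀ y, G.netOut h y = (if G.s = y then 1 else 0) - (if z = y then 1 else 0)) ∧
    ∀ e, Res e (h e)
  have hs : Reach G.s := ⟨fun _ => 0, fun y => by simp [netOut], fun e => by simp [Res]⟩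
  have step : ∀ z, Reach z → ∀ (e : Fin m) (c : ℝ) (w : Fin n),
      ((c = 1 ∧ G.src e = z ∧ G.tgt e = w) ∨ (c = -1 ∧ G.src e = w ∧ G.tgt e = z)) →
      Res e c → Reach w := by
    rintro z ⟨h, h1, h2⟩ e c w hw hc
    refine ⟨fun e' => h e' + (if e' = e then c else 0), G.netOut_extend h1 hw, fun e' => ?_⟩
    by_cases he : e' = e
    · subst he
      simp only [if_true]
      constructor <;> intro h3
      · by_cases h4 : 0 < c
        · exact hc.1 h4
        · exact (h2 e').1 (by linarith)
      · by_cases h4 : c < 0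
        · exact hc.2 h4
        · exact (h2 e').2 (by linarith)
    · simpa [he] using h2 e'
  have ht : ¬ Reach G.t := by
    rintro ⟨h, h1, h2⟩
    obtain ⟨ε, h3, hε⟩ := ((Filter.eventually_all.2 fun e => eventually_abs_add_le (hf.capacity e)
      (fun hh => ((h2 e).1 hh).2) (fun hh => ((h2 e).2 hh).2)).and self_mem_nhdsWithin).exists
    replace hε : 0 < ε := hε
    have hst : ∀ y, G.netOut h y = G.st y := fun y => by
      rw [h1]; simp [st, eq_comm]
    have hn : ∀ y, G.netOut (fun e => f e + ε * h e) y = (G.maxFlow S + ε) * G.st y := fun y => by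
      rw [netOut_add, netOut_smul, hst, hf.netOut_eq_st, hv]; ring
    obtain ⟨h4, h5⟩ := isFlow_of_netOut h3 (fun e he => by
      have h6 : h e = 0 := by
        by_contra h0
        rcases lt_or_gt_of_ne h0 with h0 | h0
        · exact he ((h2 e).2 h0).1
        · exact he ((h2 e).1 h0).1
      simp [hf.support e he, h6]) hn
    have := le_maxFlow h4
    rw [h5] at this
    linarith
  let R : Finset (Fin n) := Finset.univ.filter Reach
  have hR : ∀ z, z ∈ R ↔ Reach z := by simp [R]
  have hval : G.maxFlow S = ∑ y ∈ R, G.netOut f y := by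
    rw [Finset.sum_congr rfl fun y _ => hf.netOut_eq_st y, ← Finset.mul_sum, ← Int.cast_sum]
    change _ = _ * ((G.supply R : ℤ) : ℝ)
    rw [supply_le, if_pos ((hR _).2 hs), if_neg (fun h => ht ((hR _).1 h)), hv]
    simp
  refine ⟨∑ e ∈ S with ¬ (G.src e ∈ R ↔ G.tgt e ∈ R), G.cap e, ?_⟩
  rw [hval, sum_netOut, Nat.cast_sum, Finset.sum_filter]
  refine (Finset.sum_subset (Finset.subset_univ S)
    (f := fun e => f e * ((if G.src e ∈ R then 1 else 0) - (if G.tgt e ∈ R then 1 else 0)))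
    (fun e _ he => by simp [hf.support e he])).symm.trans ?_
  refine Finset.sum_congr rfl fun e he => ?_
  have hb := abs_le.1 (hf.capacity e)
  by_cases h1 : G.src e ∈ R <;> by_cases h2 : G.tgt e ∈ R <;> simp only [h1, h2] <;> norm_num
  · by_contra h3
    refine h2 ((hR _).2 (step _ ((hR _).1 h1) e 1 _ (Or.inl ⟨rfl, rfl, rfl⟩) ⟨fun _ =>
      ⟨he, lt_of_le_of_ne hb.2 h3⟩, fun h => by norm_num at h⟩))
  · by_contra h3
    refine h1 ((hR _).2 (step _ ((hR _).1 h2) e (-1) _ (Or.inr ⟨rfl, rfl, rfl⟩) ⟨fun h => by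
      norm_num at h, fun _ => ⟨he, lt_of_le_of_ne hb.1 fun h => h3 (by linarith)⟩⟩))

/-- A flow of value `v` in the edge set `S` for which the net amount that leaves any vertex along
any set of edges is at most `v` in absolute value. -/
structure IsTame (G : Network n m) (S : Finset (Fin m)) (v : ℕ) (f : Fin m → ℝ) : Prop where
  capacity : ∀ e, |f e| ≤ G.cap e
  support : ∀ e, e ∉ S → f e = 0
  netOut : ∀ y, G.netOut f y = v * G.st y
  bound : ∀ E y, |G.outOn f E y| ≤ v

/-- A flow of value `v` that minimizes `∑ e, |f e|` has no directed cycles: the flow `h` would be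
one, or a sum of several. -/
theorem exists_acyclic (G : Network n m) (S : Finset (Fin m)) (v : ℕ)
    (hv : (v : ℝ) ≤ G.maxFlow S) : ∃ f : Fin m → ℝ, (∀ e, |f e| ≤ G.cap e) ∧
      (∀ e, e ∉ S → f e = 0) ∧ (∀ y, G.netOut f y = v * G.st y) ∧
      ∀ h : Fin m → ℝ, (∀ y, G.netOut h y = 0) → (∀ e, 0 ≤ h e * f e) →
        (∀ e, f e = 0 → h e = 0) → ∀ e, h e = 0 := by
  let K : Set (Fin m → ℝ) := {f | (∀ e, |f e| ≤ G.cap e) ∧ (∀ e, e ∉ S → f e = 0) ∧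
    ∀ y, G.netOut f y = v * G.st y}
  have hne : K.Nonempty := by
    obtain ⟨f, hf, hF⟩ := (G.maxFlow_isGreatest S).1
    have h0 : (v : ℝ) / G.maxFlow S ≤ 1 := div_le_one_of_le₀ hv (G.maxFlow_nonneg S)
    have h1 : 0 ≤ (v : ℝ) / G.maxFlow S := div_nonneg (Nat.cast_nonneg _) (G.maxFlow_nonneg S)
    refine ⟨fun e => (v / G.maxFlow S) * f e, fun e => ?_, fun e he => by simp [hf.support e he],
      fun y => ?_⟩
    · rw [abs_mul, abs_of_nonneg h1]
      exact (mul_le_of_le_one_left (abs_nonneg _) h0).trans (hf.capacity e)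
    · rw [netOut_smul, hf.netOut_eq_st, hF, ← mul_assoc]
      rcases (G.maxFlow_nonneg S).eq_or_lt with h2 | h2
      · have : (v : ℝ) = 0 := le_antisymm (by rwa [h2]) (Nat.cast_nonneg _)
        simp [this]
      · rw [div_mul_cancel₀ _ h2.ne']
  have hcont : ∀ y, Continuous fun f : Fin m → ℝ => G.netOut f y := fun y => by
    unfold Network.netOut; fun_prop
  have hclosed : IsClosed K := by
    have : K = (⋂ e, {f : Fin m → ℝ | |f e| ≤ (G.cap e : ℝ)}) ∩
        ((⋂ e, ⋂ (_ : e ∉ S), {f : Fin m → ℝ | f e = 0}) ∩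
        ⋂ y, {f : Fin m → ℝ | G.netOut f y = v * G.st y}) := by
      ext f
      simp [K]
    rw [this]
    refine IsClosed.inter (isClosed_iInter fun e => ?_) (IsClosed.inter
      (isClosed_iInter fun e => isClosed_iInter fun _ => ?_) (isClosed_iInter fun y => ?_))
    · exact isClosed_le (by fun_prop) continuous_const
    · exact isClosed_eq (by fun_prop) continuous_const
    · exact isClosed_eq (hcont y) continuous_const
  have hcomp : IsCompact K :=
    (isCompact_univ_pi (s := fun e => Set.Icc (-(G.cap e : ℝ)) (G.cap e))
      fun e => isCompact_Icc).of_isClosed_subset hclosed fun f hf e _ => abs_le.mp (hf.1 e)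
  obtain ⟨f, hf, hmin⟩ := hcomp.exists_isMinOn hne
    (f := fun f => ∑ e, |f e|) (by fun_prop)
  refine ⟨f, hf.1, hf.2.1, hf.2.2, fun h h1 h2 h3 => ?_⟩
  obtain ⟨ε, h4, hε⟩ := ((Filter.eventually_all.2 fun e =>
    eventually_abs_sub_eq (h2 e) (h3 e)).and self_mem_nhdsWithin).exists
  replace hε : 0 < ε := hε
  have h5 : (fun e => f e - ε * h e) ∈ K := by
    refine ⟨fun e => ?_, fun e he => by simp [hf.2.1 e he, h3 e (hf.2.1 e he)], fun y => ?_⟩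
    · rw [h4]
      have := hf.1 e
      have := mul_nonneg hε.le (abs_nonneg (h e))
      linarith
    · have : (fun e => f e - ε * h e) = fun e => f e + (-ε) * h e := by ext; ring
      rw [this, netOut_add, netOut_smul, h1, hf.2.2]; ring
  have h6 : ∑ e, |f e| ≤ ∑ e, |f e - ε * h e| := hmin h5
  simp only [h4, Finset.sum_sub_distrib, ← Finset.mul_sum] at h6
  have h7 : ∑ e, |h e| = 0 := by
    have : 0 ≤ ∑ e, |h e| := Finset.sum_nonneg fun e _ => abs_nonneg _
    nlinarith
  intro e
  exact abs_eq_zero.1 ((Finset.sum_eq_zero_iff_of_nonneg fun e _ => abs_nonneg _).1 h7 e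
    (Finset.mem_univ e))

/-- Every value up to the maximum is attained by a flow that sends at most `v` through each vertex.
Given a vertex `a`, the cut around the set `U` of the vertices that are reached from `a` along the
flow is entered by at most `v`, and all the flow into `a` enters `U`, as there are no cycles. -/
theorem exists_isTame (G : Network n m) (S : Finset (Fin m)) (v : ℕ)
    (hv : (v : ℝ) ≤ G.maxFlow S) : ∃ f, G.IsTame S v f := by
  classical
  obtain ⟨f, hc, hs, hn, hac⟩ := G.exists_acyclic S v hv
  refine ⟨f, hc, hs, hn, fun E a => ?_⟩
  let Reach : Fin n → Prop := fun z => ∃ h : Fin m → ℝ,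
    (∀ y, G.netOut h y = (if a = y then 1 else 0) - (if z = y then 1 else 0)) ∧
    (∀ e, 0 ≤ h e * f e) ∧ (∀ e, f e = 0 → h e = 0)
  have ha : Reach a := ⟨fun _ => 0, fun y => by simp [Network.netOut], by simp, by simp⟩
  have ext : ∀ (h : Fin m → ℝ) (e : Fin m) (c : ℝ), (∀ e, 0 ≤ h e * f e) →
      (∀ e, f e = 0 → h e = 0) → 0 < c * f e →
      (∀ e', 0 ≤ (h e' + (if e' = e then c else 0)) * f e') ∧
      (∀ e', f e' = 0 → (h e' + (if e' = e then c else 0)) = 0) := by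
    intro h e c h2 h3 hc
    refine ⟨fun e' => ?_, fun e' h0 => ?_⟩
    · by_cases he : e' = e
      · subst he; simp only [if_true, add_mul]; linarith [h2 e']
      · simpa [he] using h2 e'
    · have he : e' ≠ e := by rintro rfl; simp [h0] at hc
      simpa [he] using h3 e' h0
  have step : ∀ z, Reach z → ∀ (e : Fin m) (c : ℝ) (w : Fin n),
      ((c = 1 ∧ G.src e = z ∧ G.tgt e = w) ∨ (c = -1 ∧ G.src e = w ∧ G.tgt e = z)) →
      0 < c * f e → Reach w := by
    rintro z ⟨h, h1, h2, h3⟩ e c w hw hc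
    exact ⟨_, G.netOut_extend h1 hw, (ext h e c h2 h3 hc).1, (ext h e c h2 h3 hc).2⟩
  -- flow into `a` does not come from a vertex that is reached from `a`
  have enter : ∀ z, Reach z → ∀ (e : Fin m) (c : ℝ),
      ((c = 1 ∧ G.src e = z ∧ G.tgt e = a) ∨ (c = -1 ∧ G.src e = a ∧ G.tgt e = z)) →
      ¬ 0 < c * f e := by
    rintro z ⟨h, h1, h2, h3⟩ e c hw hc
    have h4 := hac _ (fun y => by rw [G.netOut_extend h1 hw]; simp) (ext h e c h2 h3 hc).1
      (ext h e c h2 h3 hc).2 e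
    simp only [if_true] at h4
    have := h2 e
    have h5 : h e = -c := by linarith
    rw [h5] at this
    linarith
  let U : Finset (Fin n) := Finset.univ.filter Reach
  have hU : ∀ z, z ∈ U ↔ Reach z := by simp [U]
  have haU : a ∈ U := (hU a).2 ha
  -- the flow that enters and the flow that leaves `a` along `e`
  let i : Fin m → ℝ := fun e => (if G.tgt e = a then max (f e) 0 else 0) +
    (if G.src e = a then max (-f e) 0 else 0)
  let o : Fin m → ℝ := fun e => (if G.src e = a then max (f e) 0 else 0) +
    (if G.tgt e = a then max (-f e) 0 else 0)
  have hio : ∀ e, f e * G.inc e a = o e - i e := by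
    intro e
    simp only [inc, o, i]
    rcases le_total (f e) 0 with h | h
    · rw [max_eq_right h, max_eq_left (neg_nonneg.2 h)]
      split_ifs <;> ring
    · rw [max_eq_left h, max_eq_right (neg_nonpos.2 h)]
      split_ifs <;> ring
  have hi0 : ∀ e, 0 ≤ i e := fun e => by simp only [i]; split_ifs <;> simp
  have ho0 : ∀ e, 0 ≤ o e := fun e => by simp only [o]; split_ifs <;> simp
  have hcut : ∀ e, i e ≤
      - (f e * ((if G.src e ∈ U then 1 else 0) - (if G.tgt e ∈ U then 1 else 0))) := by
    intro e
    have k1 : G.src e ∈ U → G.tgt e ∉ U → f e ≤ 0 := fun h1 h2 => by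
      by_contra h3
      exact h2 ((hU _).2 (step _ ((hU _).1 h1) e 1 _ (Or.inl ⟨rfl, rfl, rfl⟩) (by linarith)))
    have k2 : G.src e ∉ U → G.tgt e ∈ U → 0 ≤ f e := fun h1 h2 => by
      by_contra h3
      exact h1 ((hU _).2 (step _ ((hU _).1 h2) e (-1) _ (Or.inr ⟨rfl, rfl, rfl⟩) (by linarith)))
    have k3 : G.tgt e = a → G.src e ∈ U → f e ≤ 0 := fun h1 h2 => by
      by_contra h3
      exact enter _ ((hU _).1 h2) e 1 (Or.inl ⟨rfl, rfl, h1⟩) (by linarith)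
    have k4 : G.src e = a → G.tgt e ∈ U → 0 ≤ f e := fun h1 h2 => by
      by_contra h3
      exact enter _ ((hU _).1 h2) e (-1) (Or.inr ⟨rfl, h1, rfl⟩) (by linarith)
    have k5 : G.tgt e ∉ U → G.tgt e ≠ a := fun h1 h2 => h1 (h2 ▸ haU)
    have k6 : G.src e ∉ U → G.src e ≠ a := fun h1 h2 => h1 (h2 ▸ haU)
    simp only [i]
    by_cases h3 : G.tgt e ∈ U <;> by_cases h4 : G.src e ∈ U
    · rw [if_pos h3, if_pos h4, sub_self, mul_zero, neg_zero]
      have h5 : (if G.tgt e = a then max (f e) 0 else 0) = 0 := by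
        split_ifs with h
        · exact max_eq_right (k3 h h4)
        · rfl
      have h6 : (if G.src e = a then max (-f e) 0 else 0) = 0 := by
        split_ifs with h
        · exact max_eq_right (neg_nonpos.2 (k4 h h3))
        · rfl
      rw [h5, h6, add_zero]
    · rw [if_pos h3, if_neg h4, if_neg (k6 h4), max_eq_left (k2 h4 h3)]
      have := k2 h4 h3
      split_ifs <;> linarith
    · rw [if_neg h3, if_pos h4, if_neg (k5 h3), max_eq_left (neg_nonneg.2 (k1 h4 h3))]
      have := k1 h4 h3
      split_ifs <;> linarith
    · simp [if_neg h3, if_neg h4, if_neg (k5 h3), if_neg (k6 h4)]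
  have hsum : ∑ e, i e ≤ - (v * G.supply U) := by
    refine (Finset.sum_le_sum fun e _ => hcut e).trans (le_of_eq ?_)
    rw [Finset.sum_neg_distrib, ← sum_netOut, Finset.sum_congr rfl fun y _ => hn y,
      ← Finset.mul_sum, ← Int.cast_sum]
    rfl
  have hbal : ∑ e, o e - ∑ e, i e = v * G.st a := by
    rw [← hn, netOut_eq, ← Finset.sum_sub_distrib]
    exact Finset.sum_congr rfl fun e _ => (hio e).symm
  have hE : G.outOn f E a = ∑ e ∈ E, o e - ∑ e ∈ E, i e := by
    rw [outOn, ← Finset.sum_sub_distrib]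
    exact Finset.sum_congr rfl fun e _ => hio e
  have hE1 : ∑ e ∈ E, o e ≤ ∑ e, o e :=
    Finset.sum_le_sum_of_subset_of_nonneg (Finset.subset_univ E) fun e _ _ => ho0 e
  have hE2 : ∑ e ∈ E, i e ≤ ∑ e, i e :=
    Finset.sum_le_sum_of_subset_of_nonneg (Finset.subset_univ E) fun e _ _ => hi0 e
  have hE3 : 0 ≤ ∑ e ∈ E, o e := Finset.sum_nonneg fun e _ => ho0 e
  have hE4 : 0 ≤ ∑ e ∈ E, i e := Finset.sum_nonneg fun e _ => hi0 e
  have hv0 : (0 : ℝ) ≤ v := Nat.cast_nonneg v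
  have hin : ∑ e, i e ≤ v ∧ ∑ e, o e ≤ v := by
    rw [supply_le] at hsum
    unfold st at hbal
    have hst := G.s_ne_t
    by_cases h1 : a = G.s
    · subst h1
      simp only [haU, if_true, if_neg hst] at hsum hbal
      split_ifs at hsum <;> push_cast at hsum hbal <;> constructor <;> linarith
    · by_cases h2 : a = G.t
      · subst h2
        simp only [haU, if_true, if_neg h1] at hsum hbal
        split_ifs at hsum <;> push_cast at hsum hbal <;> constructor <;> linarith
      · simp only [if_neg h1, if_neg h2] at hbal
        split_ifs at hsum <;> push_cast at hsum hbal <;> constructor <;> linarith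
  rw [hE, abs_le]
  constructor <;> linarith [hin.1, hin.2]

end Network
end SPNet

namespace SPNet

/-! ### Decomposition trees -/

/-- Expressions for pieces of a network that are attached to the rest at two vertices, or at one.
`nil u` is the vertex `u` without edges, `rev` exchanges the two ends, and `close T` regards `T` as
attached at its first end only. The series composition `ser T L` with a piece `L` that is attached
at a single vertex, the second end of `T`, absorbs `L` into `T`. -/
inductive Tree (n m : ℕ)
  | nil (u : Fin n)
  | edge (e : Fin m)
  | rev (T : Tree n m)
  | ser (T₁ T₂ : Tree n m)
  | par (T₁ T₂ : Tree n m)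
  | close (T : Tree n m)

namespace Tree

variable {n m : ℕ}

/-- The vertices that belong to the piece, which need not include its ends. -/
def verts : Tree n m → Finset (Fin n)
  | nil u => {u}
  | edge _ => ∅
  | rev T => T.verts
  | ser T₁ T₂ => T₁.verts ∪ T₂.verts
  | par T₁ T₂ => T₁.verts ∪ T₂.verts
  | close T => T.verts

/-- The edges of the piece. -/
def edges : Tree n m → Finset (Fin m)
  | nil _ => ∅
  | edge e => {e}
  | rev T => T.edges
  | ser T₁ T₂ => T₁.edges ∪ T₂.edges
  | par T₁ T₂ => T₁.edges ∪ T₂.edges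
  | close T => T.edges

/-- The number of nodes. -/
def size : Tree n m → ℕ
  | nil _ => 1
  | edge _ => 1
  | rev T => T.size + 1
  | ser T₁ T₂ => T₁.size + T₂.size + 1
  | par T₁ T₂ => T₁.size + T₂.size + 1
  | close T => T.size + 1

/-- `WF G T a b`: the tree `T` describes a piece of `G` with the ends `a` and `b`. The vertices that
disappear inside a piece are incident to edges of the piece only. -/
inductive WF (G : Network n m) : Tree n m → Fin n → Fin n → Prop
  | nil (u : Fin n) : WF G (nil u) u u
  | edge (e : Fin m) (he : G.src e ≠ G.tgt e) : WF G (edge e) (G.src e) (G.tgt e)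
  | rev (T : Tree n m) (a b : Fin n) (h : WF G T a b) (hab : a ≠ b)
      (ha : a ∉ T.verts) (hb : b ∉ T.verts) : WF G (rev T) b a
  | absorb (T L : Tree n m) (a u : Fin n) (h : WF G T a u) (hL : WF G L u u) (hau : a ≠ u)
      (ha : a ∉ T.verts) (ha' : a ∉ L.verts) (hu : u ∉ T.verts)
      (hV : Disjoint T.verts L.verts) (hE : Disjoint T.edges L.edges) : WF G (ser T L) a u
  | ser (T₁ T₂ : Tree n m) (a u b : Fin n) (h₁ : WF G T₁ a u) (h₂ : WF G T₂ u b)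
      (hau : a ≠ u) (hub : u ≠ b) (hab : a ≠ b) (ha₁ : a ∉ T₁.verts) (ha₂ : a ∉ T₂.verts)
      (hu₁ : u ∈ T₁.verts) (hu₂ : u ∉ T₂.verts)
      (hu : ∀ e, G.src e = u ∨ G.tgt e = u → e ∈ T₁.edges ∪ T₂.edges)
      (hV : Disjoint T₁.verts T₂.verts) (hE : Disjoint T₁.edges T₂.edges) : WF G (ser T₁ T₂) a b
  | par (T₁ T₂ : Tree n m) (a b : Fin n) (h₁ : WF G T₁ a b) (h₂ : WF G T₂ a b)
      (hab : a ≠ b → a ∉ T₁.verts ∧ a ∉ T₂.verts)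
      (hV : Disjoint T₁.verts T₂.verts) (hE : Disjoint T₁.edges T₂.edges) : WF G (par T₁ T₂) a b
  | close (T : Tree n m) (a u : Fin n) (h : WF G T a u) (hau : a ≠ u) (ha : a ∉ T.verts)
      (hu : u ∈ T.verts) (hu' : ∀ e, G.src e = u ∨ G.tgt e = u → e ∈ T.edges) :
      WF G (close T) a a

/-- The supply of the vertices of `X`, and `0` outside of `X`. -/
def _root_.SPNet.Network.stOn (G : Network n m) (X : Finset (Fin n)) (y : Fin n) : ℝ :=
  if y ∈ X then G.st y else 0

open Network (stOn)

/-- The net amount that leaves a vertex `y` in a piece with the ends `a` and `b`, when `x` enters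
the piece at `a` and the vertices of the piece have `v` times their supply. -/
def bal (G : Network n m) (v : ℕ) (T : Tree n m) (a b : Fin n) (x : ℝ) (y : Fin n) : ℝ :=
  x * ((if a = y then 1 else 0) - (if b = y then 1 else 0))
    - v * G.supply T.verts * (if b = y then 1 else 0) + v * G.stOn T.verts y

/-- The minimum cost of a selection of edges of a piece such that `x - v` can enter it at its first
end, computed by minimizing over all candidates. Flow values are shifted by `v` so that they are in
`0, …, 2 * v`. -/
noncomputable def val (G : Network n m) (v : ℕ) : Tree n m → ℕ → ENNReal
  | nil _, _ => 0
  | edge e, x => (Finset.range (2 * v + 1)).inf fun x₁ =>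
      if x₁ = x then if x = v then 0 else
        if x ≤ v + G.cap e ∧ v ≤ x + G.cap e then (G.cost e : ENNReal) else ⊤
      else ⊤
  | rev T, x => (Finset.range (2 * v + 1)).inf fun x₁ =>
      if (x₁ : ℤ) + x + v * (G.supply T.verts + 1) = 3 * v then val G v T x₁ else ⊤
  | ser T₁ T₂, x => (Finset.range (2 * v + 1)).inf fun x₁ =>
      if (x₁ : ℤ) + v = x + v * (G.supply T₁.verts + 1) then
        val G v T₁ x + val G v T₂ x₁ else ⊤
  | par T₁ T₂, x => (Finset.range (2 * v + 1)).inf fun x₁ =>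
      if x₁ ≤ x + v ∧ x + v ≤ x₁ + 2 * v then
        val G v T₁ x₁ + val G v T₂ (x + v - x₁) else ⊤
  | close T, _ => (Finset.range (2 * v + 1)).inf fun x₁ =>
      if (x₁ : ℤ) + v * (G.supply T.verts + 1) = 2 * v then val G v T x₁ else ⊤

/-- The candidate number `x₁` in the minimum that defines `val`. -/
noncomputable def cand (G : Network n m) (v : ℕ) : Tree n m → ℕ → ℕ → ENNReal
  | nil _, _, _ => 0
  | edge e, x, x₁ =>
      if x₁ = x then if x = v then 0 else
        if x ≤ v + G.cap e ∧ v ≤ x + G.cap e then (G.cost e : ENNReal) else ⊤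
      else ⊤
  | rev T, x, x₁ =>
      if (x₁ : ℤ) + x + v * (G.supply T.verts + 1) = 3 * v then val G v T x₁ else ⊤
  | ser T₁ T₂, x, x₁ =>
      if (x₁ : ℤ) + v = x + v * (G.supply T₁.verts + 1) then val G v T₁ x + val G v T₂ x₁ else ⊤
  | par T₁ T₂, x, x₁ =>
      if x₁ ≤ x + v ∧ x + v ≤ x₁ + 2 * v then val G v T₁ x₁ + val G v T₂ (x + v - x₁) else ⊤
  | close T, _, x₁ =>
      if (x₁ : ℤ) + v * (G.supply T.verts + 1) = 2 * v then val G v T x₁ else ⊤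

theorem val_eq (G : Network n m) (v : ℕ) (T : Tree n m) (x : ℕ) :
    val G v T x = (Finset.range (2 * v + 1)).inf (cand G v T x) := by
  cases T <;> simp only [val]
  · exact (Finset.inf_const ⟨0, by simp⟩ _).symm
  all_goals rfl

theorem val_le_cand (G : Network n m) (v : ℕ) (T : Tree n m) (x x₁ : ℕ) (h : x₁ ≤ 2 * v) :
    val G v T x ≤ cand G v T x x₁ := by
  rw [val_eq]; exact Finset.inf_le (by simp; omega)

/-! ### Every selection of edges is at least as expensive as the computed minimum -/

/-- `x` can enter the piece at its first end when the edges of `S` are selected and the flow has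
value `v`, where the amounts that enter the parts of the piece are at most `v`. -/
def Feas (G : Network n m) (S : Finset (Fin m)) (v : ℕ) : Tree n m → ℝ → Prop
  | nil _, x => |x| ≤ v
  | edge e, x => |x| ≤ v ∧ |x| ≤ G.cap e ∧ (e ∉ S → x = 0)
  | rev T, x => |x| ≤ v ∧ Feas G S v T (-x - v * G.supply T.verts)
  | ser T₁ T₂, x => |x| ≤ v ∧ Feas G S v T₁ x ∧ Feas G S v T₂ (x + v * G.supply T₁.verts)
  | par T₁ T₂, x => |x| ≤ v ∧ ∃ x₁, Feas G S v T₁ x₁ ∧ Feas G S v T₂ (x - x₁)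
  | close T, x => |x| ≤ v ∧ Feas G S v T (-(v * G.supply T.verts))

theorem Feas.abs_le {G : Network n m} {S : Finset (Fin m)} {v : ℕ} {T : Tree n m} {x : ℝ}
    (h : Feas G S v T x) : |x| ≤ v := by
  cases T <;> simp only [Feas] at h
  · exact h
  all_goals exact h.1

/-- The feasible amounts form an interval with integral ends. -/
theorem feas_iff_Icc (G : Network n m) (S : Finset (Fin m)) (v : ℕ) (T : Tree n m) :
    ∃ l u : ℤ, ∀ x : ℝ, Feas G S v T x ↔ (l : ℝ) ≤ x ∧ x ≤ u := by
  have inter : ∀ l u : ℤ, ∃ l' u' : ℤ, ∀ x : ℝ, (|x| ≤ v ∧ ((l : ℝ) ≤ x ∧ x ≤ u)) ↔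
      (l' : ℝ) ≤ x ∧ x ≤ u' := by
    intro l u
    refine ⟨max l (-v), min u v, fun x => ?_⟩
    rw [_root_.abs_le]
    push_cast
    rw [max_le_iff, le_min_iff]
    tauto
  induction T with
  | nil u =>
    refine ⟨-v, v, fun x => ?_⟩
    simp [Feas, _root_.abs_le]
  | edge e =>
    obtain ⟨l, u, h⟩ := inter (if e ∈ S then -G.cap e else 0) (if e ∈ S then G.cap e else 0)
    refine ⟨l, u, fun x => ?_⟩
    rw [← h, Feas]
    refine and_congr_right fun _ => ?_
    split_ifs with he
    · simp [he, _root_.abs_le]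
    · simp only [he, not_false_eq_true, true_imp_iff, Int.cast_zero]
      constructor
      · rintro ⟨_, rfl⟩; simp
      · rintro ⟨h1, h2⟩
        have : x = 0 := le_antisymm h2 h1
        subst this; simp
  | rev T ih =>
    obtain ⟨l, u, h⟩ := ih
    obtain ⟨l', u', h'⟩ := inter (-u - v * G.supply T.verts) (-l - v * G.supply T.verts)
    refine ⟨l', u', fun x => ?_⟩
    rw [← h', Feas, h]
    push_cast
    refine and_congr_right fun _ => ⟨fun h => ⟨?_, ?_⟩, fun h => ⟨?_, ?_⟩⟩ <;> linarith [h.1, h.2]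
  | ser T₁ T₂ ih₁ ih₂ =>
    obtain ⟨l₁, u₁, h₁⟩ := ih₁
    obtain ⟨l₂, u₂, h₂⟩ := ih₂
    obtain ⟨l', u', h'⟩ := inter (max l₁ (l₂ - v * G.supply T₁.verts))
      (min u₁ (u₂ - v * G.supply T₁.verts))
    refine ⟨l', u', fun x => ?_⟩
    rw [← h', Feas, h₁, h₂]
    push_cast
    rw [max_le_iff, le_min_iff]
    refine and_congr_right fun _ => ⟨fun h => ⟨⟨?_, ?_⟩, ?_, ?_⟩, fun h => ⟨⟨?_, ?_⟩, ?_, ?_⟩⟩ <;>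
      linarith [h.1.1, h.1.2, h.2.1, h.2.2]
  | par T₁ T₂ ih₁ ih₂ =>
    obtain ⟨l₁, u₁, h₁⟩ := ih₁
    obtain ⟨l₂, u₂, h₂⟩ := ih₂
    by_cases hne : l₁ ≤ u₁ ∧ l₂ ≤ u₂
    · obtain ⟨l', u', h'⟩ := inter (l₁ + l₂) (u₁ + u₂)
      refine ⟨l', u', fun x => ?_⟩
      rw [← h', Feas]
      refine and_congr_right fun _ => ⟨?_, fun h => ?_⟩
      · rintro ⟨x₁, k₁, k₂⟩
        rw [h₁] at k₁
        rw [h₂] at k₂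
        push_cast
        constructor <;> linarith [k₁.1, k₁.2, k₂.1, k₂.2]
      · push_cast at h
        have e1 : (l₁ : ℝ) ≤ u₁ := by exact_mod_cast hne.1
        have e2 : (l₂ : ℝ) ≤ u₂ := by exact_mod_cast hne.2
        refine ⟨max l₁ (x - u₂), (h₁ _).2 ⟨le_max_left _ _, max_le e1 (by linarith)⟩,
          (h₂ _).2 ⟨?_, ?_⟩⟩
        · have := max_le (a := (l₁ : ℝ)) (b := x - u₂) (c := x - l₂) (by linarith) (by linarith)
          linarith
        · have := le_max_right (l₁ : ℝ) (x - u₂)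
          linarith
    · refine ⟨1, 0, fun x => ?_⟩
      rw [Feas]
      constructor
      · rintro ⟨_, x₁, k₁, k₂⟩
        rw [h₁] at k₁
        rw [h₂] at k₂
        exact absurd ⟨by exact_mod_cast k₁.1.trans k₁.2, by exact_mod_cast k₂.1.trans k₂.2⟩ hne
      · rintro ⟨h1, h2⟩
        push_cast at h1 h2
        linarith
  | close T ih =>
    by_cases hT : Feas G S v T (-(v * G.supply T.verts))
    · refine ⟨-v, v, fun x => ?_⟩
      simp [Feas, hT, _root_.abs_le]
    · refine ⟨1, 0, fun x => ?_⟩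
      rw [Feas]
      constructor
      · rintro ⟨_, h⟩
        exact absurd h hT
      · rintro ⟨h1, h2⟩
        push_cast at h1 h2
        linarith

/-- An integral amount that can enter the piece when `S` is selected costs at most as much as the
edges of `S` in the piece. The amounts that the two parts of a parallel composition take can be
chosen integral by `feas_iff_Icc`. -/
theorem val_le_of_feas {G : Network n m} {S : Finset (Fin m)} {v : ℕ} {T : Tree n m}
    {a b : Fin n} (hT : WF G T a b) : ∀ (z : ℤ) (x : ℕ), (x : ℤ) = z + v → Feas G S v T z →
      val G v T x ≤ ∑ e ∈ T.edges with e ∈ S, (G.cost e : ENNReal) := by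
  have hx : ∀ {T : Tree n m} {z : ℤ}, Feas G S v T z → -(v : ℤ) ≤ z ∧ z ≤ v := by
    intro T z h
    have := _root_.abs_le.1 h.abs_le
    exact ⟨by exact_mod_cast this.1, by exact_mod_cast this.2⟩
  have hsum : ∀ {T₁ T₂ : Tree n m}, Disjoint T₁.edges T₂.edges →
      ∑ e ∈ T₁.edges ∪ T₂.edges with e ∈ S, (G.cost e : ENNReal) =
      (∑ e ∈ T₁.edges with e ∈ S, (G.cost e : ENNReal)) +
        ∑ e ∈ T₂.edges with e ∈ S, (G.cost e : ENNReal) := by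
    intro T₁ T₂ hE
    rw [Finset.filter_union, Finset.sum_union (Finset.disjoint_filter_filter hE)]
  have hser : ∀ {T₁ T₂ : Tree n m}, Disjoint T₁.edges T₂.edges →
      (∀ (z : ℤ) (x : ℕ), (x : ℤ) = z + v → Feas G S v T₁ z →
        val G v T₁ x ≤ ∑ e ∈ T₁.edges with e ∈ S, (G.cost e : ENNReal)) →
      (∀ (z : ℤ) (x : ℕ), (x : ℤ) = z + v → Feas G S v T₂ z →
        val G v T₂ x ≤ ∑ e ∈ T₂.edges with e ∈ S, (G.cost e : ENNReal)) →
      ∀ (z : ℤ) (x : ℕ), (x : ℤ) = z + v → Feas G S v (Tree.ser T₁ T₂) z →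
        val G v (Tree.ser T₁ T₂) x ≤
          ∑ e ∈ (Tree.ser T₁ T₂).edges with e ∈ S, (G.cost e : ENNReal) := by
    intro T₁ T₂ hE ih₁ ih₂ z x hzx h
    rw [Feas] at h
    have h2 : Feas G S v T₂ ((z + v * G.supply T₁.verts : ℤ) : ℝ) := by push_cast; exact h.2.2
    have hb := hx h2
    obtain ⟨x₁, hx₁⟩ : ∃ x₁ : ℕ, (x₁ : ℤ) = z + v * G.supply T₁.verts + v :=
      ⟨(z + v * G.supply T₁.verts + v).toNat, Int.toNat_of_nonneg (by omega)⟩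
    refine (val_le_cand G v _ x x₁ (by omega)).trans ?_
    rw [cand, if_pos (by rw [hx₁, hzx]; ring), edges, hsum hE]
    exact add_le_add (ih₁ z x hzx h.2.1) (ih₂ _ x₁ hx₁ h2)
  induction hT with
  | nil u => intro z x _ _; simp [val]
  | edge e he =>
    intro z x hzx h
    have hb := hx h
    refine (val_le_cand G v _ x x (by omega)).trans ?_
    rw [cand, if_pos rfl]
    split_ifs with h1 h2
    · exact zero_le
    · rw [Feas] at h
      have : e ∈ S := by
        by_contra h3
        have := h.2.2 h3
        have : z = 0 := by exact_mod_cast this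
        omega
      simp [edges, Finset.filter_singleton, this]
    · rw [Feas] at h
      have h3 := _root_.abs_le.1 h.2.1
      have h4 : -(G.cap e : ℤ) ≤ z := by exact_mod_cast h3.1
      have h5 : z ≤ G.cap e := by exact_mod_cast h3.2
      exact absurd ⟨by omega, by omega⟩ h2
  | rev T a b hT hab ha hb ih =>
    intro z x hzx h
    rw [Feas] at h
    have h2 : Feas G S v T ((-z - v * G.supply T.verts : ℤ) : ℝ) := by push_cast; exact h.2
    have hb := hx h2
    obtain ⟨x₁, hx₁⟩ : ∃ x₁ : ℕ, (x₁ : ℤ) = (-z - v * G.supply T.verts) + v :=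
      ⟨((-z - v * G.supply T.verts) + v).toNat, Int.toNat_of_nonneg (by omega)⟩
    refine (val_le_cand G v _ x x₁ (by omega)).trans ?_
    rw [cand, if_pos (by rw [hx₁, hzx]; ring), edges]
    exact ih _ x₁ hx₁ h2
  | absorb T L a u hT hL hau ha ha' hu hV hE ih₁ ih₂ => exact hser hE ih₁ ih₂
  | ser T₁ T₂ a u b h₁ h₂ hau hub hab ha₁ ha₂ hu₁ hu₂ hu hV hE ih₁ ih₂ => exact hser hE ih₁ ih₂
  | par T₁ T₂ a b h₁ h₂ hab hV hE ih₁ ih₂ =>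
    intro z x hzx h
    have hb := hx h
    rw [Feas] at h
    obtain ⟨_, y, k₁, k₂⟩ := h
    obtain ⟨l₁, u₁, e₁⟩ := feas_iff_Icc G S v T₁
    obtain ⟨l₂, u₂, e₂⟩ := feas_iff_Icc G S v T₂
    -- the parts of an integral amount can be chosen to be integral
    have hz : ∃ z₁ : ℤ, Feas G S v T₁ z₁ ∧ Feas G S v T₂ ((z - z₁ : ℤ) : ℝ) := by
      rw [e₁] at k₁
      rw [e₂] at k₂
      have i1 : l₁ ≤ u₁ := by exact_mod_cast k₁.1.trans k₁.2
      have i2 : l₂ ≤ u₂ := by exact_mod_cast k₂.1.trans k₂.2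
      have i3 : (l₁ : ℝ) + l₂ ≤ z := by linarith [k₁.1, k₂.1]
      have i4 : (z : ℝ) ≤ u₁ + u₂ := by linarith [k₁.2, k₂.2]
      have i3' : l₁ + l₂ ≤ z := by exact_mod_cast i3
      have i4' : z ≤ u₁ + u₂ := by exact_mod_cast i4
      refine ⟨max l₁ (z - u₂), (e₁ _).2 ?_, (e₂ _).2 ?_⟩
      · constructor
        · exact_mod_cast (by omega : l₁ ≤ max l₁ (z - u₂))
        · exact_mod_cast (by omega : max l₁ (z - u₂) ≤ u₁)
      · constructor
        · exact_mod_cast (by omega : l₂ ≤ z - max l₁ (z - u₂))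
        · exact_mod_cast (by omega : z - max l₁ (z - u₂) ≤ u₂)
    obtain ⟨z₁, k₁, k₂⟩ := hz
    have hb₁ := hx k₁
    have hb₂ := hx k₂
    obtain ⟨x₁, hx₁⟩ : ∃ x₁ : ℕ, (x₁ : ℤ) = z₁ + v :=
      ⟨(z₁ + v).toNat, Int.toNat_of_nonneg (by omega)⟩
    refine (val_le_cand G v _ x x₁ (by omega)).trans ?_
    rw [cand, if_pos (by constructor <;> omega), edges, hsum hE]
    exact add_le_add (ih₁ z₁ x₁ hx₁ k₁) (ih₂ (z - z₁) _ (by omega) k₂)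
  | close T a u hT hau ha hu hu' ih =>
    intro z x hzx h
    rw [Feas] at h
    have h2 : Feas G S v T ((-(v * G.supply T.verts) : ℤ) : ℝ) := by push_cast; exact h.2
    have hb := hx h2
    obtain ⟨x₁, hx₁⟩ : ∃ x₁ : ℕ, (x₁ : ℤ) = -(v * G.supply T.verts) + v :=
      ⟨(-(v * G.supply T.verts) + v).toNat, Int.toNat_of_nonneg (by omega)⟩
    refine (val_le_cand G v _ x x₁ (by omega)).trans ?_
    rw [cand, if_pos (by rw [hx₁]; ring), edges]
    exact ih _ x₁ hx₁ h2

theorem supply_union {G : Network n m} {X Y : Finset (Fin n)} (h : Disjoint X Y) :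
    G.supply (X ∪ Y) = G.supply X + G.supply Y := Finset.sum_union h

theorem outOn_union (G : Network n m) (f : Fin m → ℝ) {E E' : Finset (Fin m)} (h : Disjoint E E')
    (y : Fin n) : G.outOn f (E ∪ E') y = G.outOn f E y + G.outOn f E' y := Finset.sum_union h

theorem outOn_eq_netOut (G : Network n m) (f : Fin m → ℝ) {E : Finset (Fin m)} {u : Fin n}
    (h : ∀ e, G.src e = u ∨ G.tgt e = u → e ∈ E) : G.outOn f E u = G.netOut f u := by
  rw [Network.netOut_eq, Network.outOn]
  refine Finset.sum_subset (Finset.subset_univ E) fun e _ he => ?_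
  have : ¬ (G.src e = u ∨ G.tgt e = u) := fun h' => he (h e h')
  push Not at this
  simp [Network.inc, this.1, this.2]

/-- For a piece that is attached at a single vertex, the amount that enters does not matter. -/
theorem bal_loop (G : Network n m) (v : ℕ) (T : Tree n m) (a : Fin n) (x x' : ℝ) (y : Fin n) :
    bal G v T a a x y = bal G v T a a x' y := by simp [bal]

theorem stOn_union (G : Network n m) {X Y : Finset (Fin n)} (h : Disjoint X Y) (y : Fin n) :
    G.stOn (X ∪ Y) y = G.stOn X y + G.stOn Y y := by
  have : y ∈ X → y ∉ Y := fun h1 => Finset.disjoint_left.1 h h1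
  by_cases h1 : y ∈ X <;> by_cases h2 : y ∈ Y <;> simp_all [stOn]

theorem bal_ser (G : Network n m) (v : ℕ) {T₁ T₂ : Tree n m} (hV : Disjoint T₁.verts T₂.verts)
    (a u b : Fin n) (x : ℝ) (y : Fin n) : bal G v (ser T₁ T₂) a b x y =
      bal G v T₁ a u x y + bal G v T₂ u b (x + v * G.supply T₁.verts) y := by
  simp only [bal, verts, supply_union hV, stOn_union G hV]
  push_cast
  ring

theorem bal_par (G : Network n m) (v : ℕ) {T₁ T₂ : Tree n m} (hV : Disjoint T₁.verts T₂.verts)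
    (a b : Fin n) (x x' : ℝ) (y : Fin n) : bal G v (par T₁ T₂) a b (x + x') y =
      bal G v T₁ a b x y + bal G v T₂ a b x' y := by
  simp only [bal, verts, supply_union hV, stOn_union G hV]
  push_cast
  ring

theorem bal_rev (G : Network n m) (v : ℕ) (T : Tree n m) (a b : Fin n) (x : ℝ) (y : Fin n) :
    bal G v (rev T) b a x y = bal G v T a b (-x - v * G.supply T.verts) y := by
  simp only [bal, verts]
  ring

/-- A tame flow is feasible for every piece. -/
theorem feas_of_isTame {G : Network n m} {S : Finset (Fin m)} {v : ℕ} {f : Fin m → ℝ}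
    (hf : G.IsTame S v f) {T : Tree n m} {a b : Fin n} (hT : WF G T a b) :
    (∃ x : ℝ, |x| ≤ v ∧ ∀ y, G.outOn f T.edges y = bal G v T a b x y) ∧
    ∀ x : ℝ, |x| ≤ v → (∀ y, G.outOn f T.edges y = bal G v T a b x y) → Feas G S v T x := by
  induction hT with
  | nil u =>
    exact ⟨⟨0, by simp, fun y => by by_cases h : u = y <;> simp_all [Network.outOn, edges, bal,
      stOn,
      verts, Network.supply, eq_comm]⟩, fun x hx _ => hx⟩
  | edge e he =>
    have h0 : ∀ y, G.outOn f (edge e : Tree n m).edges y =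
        bal G v (edge e : Tree n m) (G.src e) (G.tgt e) (f e) y := fun y => by
      simp [Network.outOn, edges, bal, stOn, verts, Network.supply, Network.inc]
    have hb : |f e| ≤ v := by
      have := hf.bound {e} (G.src e)
      simpa [Network.outOn, Network.inc, he.symm] using this
    refine ⟨⟨f e, hb, h0⟩, fun x hx h => ?_⟩
    have : x = f e := by
      have := (h (G.src e)).symm.trans (h0 (G.src e))
      simpa [bal, stOn, verts, he.symm] using this
    subst this
    exact ⟨hb, hf.capacity e, hf.support e⟩
  | rev T a b hT hab ha hb ih =>
    obtain ⟨⟨x₀, hx₀, h₀⟩, ih⟩ := ih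
    have hval : ∀ x, (∀ y, G.outOn f T.edges y = bal G v (rev T) b a x y) → |x| ≤ v ∧
        |-x - v * G.supply T.verts| ≤ v := by
      intro x hx
      have h1 := hf.bound T.edges b
      have h2 := hf.bound T.edges a
      have e1 := hx b
      have e2 := hx a
      simp only [bal, stOn, verts, hb, ha, hab, hab.symm, if_true, if_false] at e1 e2
      rw [e1] at h1
      rw [e2] at h2
      constructor
      · convert h1 using 2; ring
      · convert h2 using 2; ring
    have h1 : ∀ y, G.outOn f T.edges y =
        bal G v (rev T) b a (-x₀ - v * G.supply T.verts) y := fun y => by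
      rw [h₀, bal_rev]; congr 1; ring
    refine ⟨⟨_, (hval _ h1).1, h1⟩, fun x hx h => ⟨hx, ih _ (hval x h).2 fun y => ?_⟩⟩
    rw [← bal_rev]; exact h y
  | absorb T L a u hT hL hau ha ha' hu hV hE ih₁ ih₂ =>
    obtain ⟨⟨x₁, hx₁, h₁⟩, ih₁⟩ := ih₁
    obtain ⟨⟨x₂, hx₂, h₂⟩, ih₂⟩ := ih₂
    refine ⟨⟨x₁, hx₁, fun y => ?_⟩, fun x hx h => ?_⟩
    · rw [edges, outOn_union G f hE, h₁, h₂, bal_ser G v hV a u]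
      congr 1
      exact bal_loop ..
    · have hx' : x = x₁ := by
        have := h a
        rw [edges, outOn_union G f hE, h₁, h₂, bal_ser G v hV a u] at this
        simpa [bal, stOn, ha, ha', hau.symm] using this.symm
      subst hx'
      refine ⟨hx, ih₁ x hx h₁, ih₂ _ ?_ fun y => ?_⟩
      · have h3 := hf.bound T.edges u
        rw [h₁] at h3
        simp only [bal, stOn, hu, hau, if_true, if_false] at h3
        rw [← abs_neg]
        convert h3 using 2; ring
      · rw [h₂]; exact bal_loop ..
  | ser T₁ T₂ a u b k₁ k₂ hau hub hab ha₁ ha₂ hu₁ hu₂ hu hV hE ih₁ ih₂ =>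
    obtain ⟨⟨x₁, hx₁, h₁⟩, ih₁⟩ := ih₁
    obtain ⟨⟨x₂, hx₂, h₂⟩, ih₂⟩ := ih₂
    -- conservation at the vertex `u`
    have hx₂' : x₂ = x₁ + v * G.supply T₁.verts := by
      have h3 := outOn_eq_netOut G f hu
      rw [outOn_union G f hE, h₁, h₂, hf.netOut] at h3
      simp only [bal, stOn, hau, hub.symm, hu₁, hu₂, if_true, if_false] at h3
      linarith
    subst hx₂'
    refine ⟨⟨x₁, hx₁, fun y => ?_⟩, fun x hx h => ?_⟩
    · rw [edges, outOn_union G f hE, h₁, h₂, bal_ser G v hV a u b]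
    · have hx' : x = x₁ := by
        have := h a
        rw [edges, outOn_union G f hE, h₁, h₂, bal_ser G v hV a u b] at this
        simpa [bal, stOn, ha₁, ha₂, hau.symm, hab.symm] using this.symm
      subst hx'
      exact ⟨hx, ih₁ x hx h₁, ih₂ _ hx₂ h₂⟩
  | par T₁ T₂ a b k₁ k₂ hab hV hE ih₁ ih₂ =>
    obtain ⟨⟨x₁, hx₁, h₁⟩, ih₁⟩ := ih₁
    obtain ⟨⟨x₂, hx₂, h₂⟩, ih₂⟩ := ih₂
    have hsum : ∀ y, G.outOn f (par T₁ T₂).edges y = bal G v (par T₁ T₂) a b (x₁ + x₂) y :=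
      fun y => by rw [edges, outOn_union G f hE, h₁, h₂, bal_par G v hV]
    by_cases h : a = b
    · subst h
      refine ⟨⟨0, by simp, fun y => (hsum y).trans (bal_loop ..)⟩, fun x hx _ => ⟨hx, x, ?_, ?_⟩⟩
      · exact ih₁ x hx fun y => (h₁ y).trans (bal_loop ..)
      · exact ih₂ _ (by simp) fun y => (h₂ y).trans (bal_loop ..)
    · obtain ⟨ha₁, ha₂⟩ := hab h
      refine ⟨⟨x₁ + x₂, ?_, hsum⟩, fun x hx h' => ⟨hx, x₁, ih₁ x₁ hx₁ h₁, ?_⟩⟩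
      · have h3 := hf.bound (par T₁ T₂).edges a
        rw [hsum, bal_par G v hV] at h3
        simpa [bal, stOn, ha₁, ha₂, Ne.symm h] using h3
      · have : x = x₁ + x₂ := by
          have := (h' a).symm.trans (hsum a)
          simpa [bal, stOn, verts, ha₁, ha₂, Ne.symm h] using this
        subst this
        rw [add_sub_cancel_left]
        exact ih₂ x₂ hx₂ h₂
  | close T a u hT hau ha hu hu' ih =>
    obtain ⟨⟨x₁, hx₁, h₁⟩, ih⟩ := ih
    -- conservation at the vertex `u`
    have hx : x₁ = -(v * G.supply T.verts) := by
      have h3 := outOn_eq_netOut G f hu'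
      rw [h₁, hf.netOut] at h3
      simp only [bal, stOn, hau, hu, if_true, if_false] at h3
      linarith
    subst hx
    refine ⟨⟨0, by simp, fun y => ?_⟩, fun x hx _ => ⟨hx, ih _ hx₁ h₁⟩⟩
    rw [edges, h₁]
    simp only [bal, verts]
    ring

/-- If the tree describes the whole network, attached to nothing at a single vertex, the computed
minimum is a lower bound for the cost of every edge set with a flow of value `v`. -/
theorem val_le_totalCost {G : Network n m} {S : Finset (Fin m)} {v : ℕ} {T : Tree n m} {a : Fin n}
    (hT : WF G T a a) (hS : (v : ℝ) ≤ G.maxFlow S) (x : ℕ) (hx : x ≤ 2 * v) :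
    val G v T x ≤ G.totalCost S := by
  obtain ⟨f, hf⟩ := G.exists_isTame S v hS
  obtain ⟨⟨x₀, hx₀, h₀⟩, h⟩ := feas_of_isTame hf hT
  have := val_le_of_feas hT (x - v : ℤ) x (by ring) (h _ (by
    push_cast
    have : (x : ℝ) ≤ 2 * v := by exact_mod_cast hx
    have : (0 : ℝ) ≤ x := Nat.cast_nonneg x
    rw [_root_.abs_le]; constructor <;> linarith) fun y => (h₀ y).trans (bal_loop ..))
  refine this.trans ?_
  rw [Network.totalCost, ENNReal.ofNNReal_finsetSum]
  refine Finset.sum_le_sum_of_subset fun e he => (Finset.mem_filter.1 he).2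

/-! ### The computed minimum is attained by a selection of edges that carries a flow -/

/-- `Sel G v T x S`: the edges of `S` are selected when the candidates that attain the minimum are
followed through the tree, starting at the index `x`. -/
inductive Sel (G : Network n m) (v : ℕ) : Tree n m → ℕ → Finset (Fin m) → Prop
  | nil (u : Fin n) (x : ℕ) : Sel G v (nil u) x ∅
  | edgeZero (e : Fin m) : Sel G v (edge e) v ∅
  | edge (e : Fin m) (x : ℕ) (hx : x ≠ v) : Sel G v (edge e) x {e}
  | rev (T : Tree n m) (x x₁ : ℕ) (S : Finset (Fin m))
      (h : cand G v (rev T) x x₁ = val G v (rev T) x) (h₁ : Sel G v T x₁ S) : Sel G v (rev T) x S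
  | ser (T₁ T₂ : Tree n m) (x x₁ : ℕ) (S₁ S₂ : Finset (Fin m))
      (h : cand G v (ser T₁ T₂) x x₁ = val G v (ser T₁ T₂) x)
      (h₁ : Sel G v T₁ x S₁) (h₂ : Sel G v T₂ x₁ S₂) : Sel G v (ser T₁ T₂) x (S₁ ∪ S₂)
  | par (T₁ T₂ : Tree n m) (x x₁ : ℕ) (S₁ S₂ : Finset (Fin m))
      (h : cand G v (par T₁ T₂) x x₁ = val G v (par T₁ T₂) x)
      (h₁ : Sel G v T₁ x₁ S₁) (h₂ : Sel G v T₂ (x + v - x₁) S₂) : Sel G v (par T₁ T₂) x (S₁ ∪ S₂)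
  | close (T : Tree n m) (x x₁ : ℕ) (S : Finset (Fin m))
      (h : cand G v (close T) x x₁ = val G v (close T) x) (h₁ : Sel G v T x₁ S) :
      Sel G v (close T) x S

theorem val_edge {G : Network n m} {v x : ℕ} {e : Fin m} (h : val G v (edge e : Tree n m) x ≠ ⊤)
    (hx : x ≠ v) : x ≤ v + G.cap e ∧ v ≤ x + G.cap e ∧
      val G v (edge e : Tree n m) x = G.cost e := by
  obtain ⟨x₁, -, h₁⟩ := Finset.exists_mem_eq_inf (Finset.range (2 * v + 1)) (by simp)
    (cand G v (edge e : Tree n m) x)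
  rw [← val_eq] at h₁
  rw [h₁] at h ⊢
  simp only [cand, hx, if_false] at h ⊢
  split_ifs at h ⊢ with h2 h3
  · exact ⟨h3.1, h3.2, rfl⟩
  · exact absurd rfl h
  · exact absurd rfl h

theorem cost_union_le (G : Network n m) (S₁ S₂ : Finset (Fin m)) :
    (∑ e ∈ S₁ ∪ S₂, (G.cost e : ENNReal)) ≤
      (∑ e ∈ S₁, (G.cost e : ENNReal)) + ∑ e ∈ S₂, (G.cost e : ENNReal) := by
  rw [← Finset.sum_union_inter]
  exact le_self_add

/-- A selection costs at most the minimum that it attains. -/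
theorem Sel.cost_le {G : Network n m} {v : ℕ} {T : Tree n m} {x : ℕ} {S : Finset (Fin m)}
    (h : Sel G v T x S) (hfin : val G v T x ≠ ⊤) :
    ∑ e ∈ S, (G.cost e : ENNReal) ≤ val G v T x := by
  induction h with
  | nil u x => simp
  | edgeZero e => simp
  | edge e x hx => rw [(val_edge hfin hx).2.2]; simp
  | rev T x x₁ S h h₁ ih =>
    rw [← h] at hfin ⊢
    simp only [cand] at hfin ⊢
    split_ifs at hfin ⊢ with h2
    · exact ih hfin
    · exact absurd rfl hfin
  | ser T₁ T₂ x x₁ S₁ S₂ h h₁ h₂ ih₁ ih₂ =>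
    rw [← h] at hfin ⊢
    simp only [cand] at hfin ⊢
    split_ifs at hfin ⊢ with h3
    · rw [ne_eq, ENNReal.add_eq_top, not_or] at hfin
      exact (cost_union_le G S₁ S₂).trans (add_le_add (ih₁ hfin.1) (ih₂ hfin.2))
    · exact absurd rfl hfin
  | par T₁ T₂ x x₁ S₁ S₂ h h₁ h₂ ih₁ ih₂ =>
    rw [← h] at hfin ⊢
    simp only [cand] at hfin ⊢
    split_ifs at hfin ⊢ with h3
    · rw [ne_eq, ENNReal.add_eq_top, not_or] at hfin
      exact (cost_union_le G S₁ S₂).trans (add_le_add (ih₁ hfin.1) (ih₂ hfin.2))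
    · exact absurd rfl hfin
  | close T x x₁ S h h₁ ih =>
    rw [← h] at hfin ⊢
    simp only [cand] at hfin ⊢
    split_ifs at hfin ⊢ with h2
    · exact ih hfin
    · exact absurd rfl hfin

/-- `f` is a flow in the piece `T` along selected edges, where `x - v` enters at `a`. -/
structure IsPieceFlow (G : Network n m) (v : ℕ) (T : Tree n m) (a b : Fin n) (x : ℕ)
    (S : Finset (Fin m)) (f : Fin m → ℝ) : Prop where
  capacity : ∀ e, |f e| ≤ G.cap e
  support : ∀ e, e ∉ S → f e = 0
  edges : ∀ e, e ∉ T.edges → f e = 0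
  netOut : ∀ y, G.netOut f y = bal G v T a b (x - v) y

/-- Flows in the two parts of a piece, which have no edge in common, add up to a flow. -/
theorem IsPieceFlow.add {G : Network n m} {v : ℕ} {T₁ T₂ : Tree n m} {a₁ b₁ a₂ b₂ : Fin n}
    {x₁ x₂ : ℕ} {S₁ S₂ : Finset (Fin m)} {f₁ f₂ : Fin m → ℝ}
    (h₁ : IsPieceFlow G v T₁ a₁ b₁ x₁ S₁ f₁) (h₂ : IsPieceFlow G v T₂ a₂ b₂ x₂ S₂ f₂)
    (hE : Disjoint T₁.edges T₂.edges) {T : Tree n m} {a b : Fin n} {x : ℕ}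
    (hT : T.edges = T₁.edges ∪ T₂.edges)
    (hb : ∀ y, bal G v T a b (x - v) y =
      bal G v T₁ a₁ b₁ (x₁ - v) y + bal G v T₂ a₂ b₂ (x₂ - v) y) :
    IsPieceFlow G v T a b x (S₁ ∪ S₂) fun e => f₁ e + f₂ e := by
  refine ⟨fun e => ?_, fun e he => ?_, fun e he => ?_, fun y => ?_⟩
  · by_cases h : e ∈ T₁.edges
    · rw [h₂.edges e (Finset.disjoint_left.1 hE h), add_zero]; exact h₁.capacity e
    · rw [h₁.edges e h, zero_add]; exact h₂.capacity e
  · rw [Finset.mem_union, not_or] at he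
    simp [h₁.support e he.1, h₂.support e he.2]
  · rw [hT, Finset.mem_union, not_or] at he
    simp [h₁.edges e he.1, h₂.edges e he.2]
  · rw [Network.netOut_add, h₁.netOut, h₂.netOut, hb]

/-- The selected edges carry a flow in the piece: the flows in the parts have the amounts that the
chosen candidates prescribe. -/
theorem Sel.exists_flow {G : Network n m} {v : ℕ} {T : Tree n m} {a b : Fin n} (hT : WF G T a b) :
    ∀ {x : ℕ} {S : Finset (Fin m)}, Sel G v T x S → val G v T x ≠ ⊤ →
      ∃ f, IsPieceFlow G v T a b x S f := by
  have hser : ∀ {T₁ T₂ : Tree n m} {a u b : Fin n}, Disjoint T₁.verts T₂.verts →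
      Disjoint T₁.edges T₂.edges →
      (∀ {x : ℕ} {S : Finset (Fin m)}, Sel G v T₁ x S → val G v T₁ x ≠ ⊤ →
        ∃ f, IsPieceFlow G v T₁ a u x S f) →
      (∀ {x : ℕ} {S : Finset (Fin m)}, Sel G v T₂ x S → val G v T₂ x ≠ ⊤ →
        ∃ f, IsPieceFlow G v T₂ u b x S f) →
      ∀ {x : ℕ} {S : Finset (Fin m)}, Sel G v (Tree.ser T₁ T₂) x S →
        val G v (Tree.ser T₁ T₂) x ≠ ⊤ → ∃ f, IsPieceFlow G v (Tree.ser T₁ T₂) a b x S f := by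
    intro T₁ T₂ a u b hV hE ih₁ ih₂ x S hS hfin
    cases hS with
    | ser _ _ _ x₁ S₁ S₂ h h₁ h₂ =>
      rw [← h, cand] at hfin
      split_ifs at hfin with h3
      · rw [ne_eq, ENNReal.add_eq_top, not_or] at hfin
        obtain ⟨f₁, k₁⟩ := ih₁ h₁ hfin.1
        obtain ⟨f₂, k₂⟩ := ih₂ h₂ hfin.2
        refine ⟨_, k₁.add k₂ hE rfl fun y => ?_⟩
        rw [bal_ser G v hV a u b]
        congr 2
        have h3' : (x₁ : ℝ) + v = x + v * (G.supply T₁.verts + 1) := by exact_mod_cast h3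
        linarith
      · exact absurd rfl hfin
  induction hT with
  | nil u =>
    intro x S hS hfin
    cases hS
    refine ⟨fun _ => 0, fun e => by simp, fun _ _ => rfl, fun _ _ => rfl, fun y => ?_⟩
    by_cases h : u = y <;> simp_all [Network.netOut, bal, stOn, verts, Network.supply, eq_comm]
  | edge e he =>
    intro x S hS hfin
    have hnet : ∀ (c : ℝ) y, G.netOut (fun e' => if e' = e then c else 0) y =
        bal G v (.edge e : Tree n m) (G.src e) (G.tgt e) c y := fun c y => by
      rw [Network.netOut_single]; simp [bal, stOn, verts, Network.supply, Network.inc]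
    cases hS with
    | edgeZero =>
      refine ⟨fun e' => if e' = e then v - v else 0, fun e => by simp, by simp, by simp,
        hnet (v - v)⟩
    | edge _ _ hx =>
      obtain ⟨h1, h2, -⟩ := val_edge hfin hx
      refine ⟨fun e' => if e' = e then x - v else 0, fun e' => ?_, fun e' he' => ?_,
        fun e' he' => ?_, hnet (x - v)⟩
      · split_ifs with h
        · subst h
          have h1' : (x : ℝ) ≤ v + G.cap e' := by exact_mod_cast h1
          have h2' : (v : ℝ) ≤ x + G.cap e' := by exact_mod_cast h2
          rw [_root_.abs_le]; constructor <;> linarith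
        · simp
      · simp at he'; simp [he']
      · simp [edges] at he'; simp [he']
  | rev T a b hT hab ha hb ih =>
    intro x S hS hfin
    cases hS with
    | rev _ _ x₁ _ h h₁ =>
      rw [← h, cand] at hfin
      split_ifs at hfin with h3
      · obtain ⟨f, k⟩ := ih h₁ hfin
        refine ⟨f, k.1, k.2, k.3, fun y => ?_⟩
        rw [k.netOut, bal_rev]
        congr 1
        have h3' : (x₁ : ℝ) + x + v * (G.supply T.verts + 1) = 3 * v := by exact_mod_cast h3
        linarith
      · exact absurd rfl hfin
  | absorb T L a u hT hL hau ha ha' hu hV hE ih₁ ih₂ => exact hser hV hE ih₁ ih₂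
  | ser T₁ T₂ a u b h₁ h₂ hau hub hab ha₁ ha₂ hu₁ hu₂ hu hV hE ih₁ ih₂ => exact hser hV hE ih₁ ih₂
  | par T₁ T₂ a b k₁ k₂ hab hV hE ih₁ ih₂ =>
    intro x S hS hfin
    cases hS with
    | par _ _ _ x₁ S₁ S₂ h h₁ h₂ =>
      rw [← h, cand] at hfin
      split_ifs at hfin with h3
      · rw [ne_eq, ENNReal.add_eq_top, not_or] at hfin
        obtain ⟨f₁, k₁⟩ := ih₁ h₁ hfin.1
        obtain ⟨f₂, k₂⟩ := ih₂ h₂ hfin.2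
        refine ⟨_, k₁.add k₂ hE rfl fun y => ?_⟩
        rw [← bal_par G v hV]
        congr 1
        rw [Nat.cast_sub h3.1]; push_cast; ring
      · exact absurd rfl hfin
  | close T a u hT hau ha hu hu' ih =>
    intro x S hS hfin
    cases hS with
    | close _ _ x₁ _ h h₁ =>
      rw [← h, cand] at hfin
      split_ifs at hfin with h3
      · obtain ⟨f, k⟩ := ih h₁ hfin
        refine ⟨f, k.1, k.2, k.3, fun y => ?_⟩
        have h3' : (x₁ : ℝ) + v * (G.supply T.verts + 1) = 2 * v := by exact_mod_cast h3
        have : (x₁ : ℝ) - v = -(v * G.supply T.verts) := by linarith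
        rw [k.netOut, this]
        simp only [bal, verts]
        ring
      · exact absurd rfl hfin

theorem supply_univ (G : Network n m) : G.supply Finset.univ = 0 := by
  rw [Network.supply_le]; simp

/-- If the tree describes the whole network, attached to nothing at a single vertex, the selected
edges carry a flow of value `v`. -/
theorem Sel.le_maxFlow {G : Network n m} {S : Finset (Fin m)} {v : ℕ} {T : Tree n m} {a : Fin n}
    (hT : WF G T a a) (hV : T.verts = Finset.univ) {x : ℕ} (hS : Sel G v T x S)
    (hfin : val G v T x ≠ ⊤) : (v : ℝ) ≤ G.maxFlow S := by
  obtain ⟨f, hf⟩ := hS.exists_flow hT hfin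
  obtain ⟨h1, h2⟩ := Network.isFlow_of_netOut (v := v) hf.capacity hf.support fun y => by
    rw [hf.netOut]; simp [bal, stOn, hV, supply_univ]
  rw [← h2]
  exact Network.le_maxFlow h1

end Tree
end SPNet

namespace SPNet

/-! ### Graphs of tree-width two -/

/-- `TW V A a b`: the graph with vertex set `V` and adjacency relation `A` is put together in the
way of a series-parallel graph with the terminals `a` and `b`, except that terminals may coincide.
In contrast to series-parallel graphs, these graphs are closed under contractions. -/
inductive TW {α : Type*} : Set α → (α → α → Prop) → α → α → Prop
  | leaf (a b : α) : TW {a, b} (fun x y => (x = a ∨ x = b) ∧ (y = a ∨ y = b)) a b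
  | series (V₁ V₂ : Set α) (A₁ A₂ : α → α → Prop) (a c b : α) (h₁ : TW V₁ A₁ a c)
      (h₂ : TW V₂ A₂ c b) (hV : ∀ y ∈ V₁, y ∈ V₂ → y = a ∨ y = c ∨ y = b)
      (hb : b ∈ V₁ → b = a ∨ b = c) (ha : a ∈ V₂ → a = c ∨ a = b) :
      TW (V₁ ∪ V₂) (fun x y => A₁ x y ∨ A₂ x y) a b
  | parallel (V₁ V₂ : Set α) (A₁ A₂ : α → α → Prop) (a b : α) (h₁ : TW V₁ A₁ a b)
      (h₂ : TW V₂ A₂ a b) (hV : ∀ y ∈ V₁, y ∈ V₂ → y = a ∨ y = b) :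
      TW (V₁ ∪ V₂) (fun x y => A₁ x y ∨ A₂ x y) a b

namespace TW

variable {α : Type*}

theorem terminals {V : Set α} {A : α → α → Prop} {a b : α} (h : TW V A a b) : a ∈ V ∧ b ∈ V := by
  induction h with
  | leaf a b => simp
  | series V₁ V₂ A₁ A₂ a c b h₁ h₂ hV hb ha ih₁ ih₂ => exact ⟨Or.inl ih₁.1, Or.inr ih₂.2⟩
  | parallel V₁ V₂ A₁ A₂ a b h₁ h₂ hV ih₁ ih₂ => exact ⟨Or.inl ih₁.1, Or.inl ih₁.2⟩

theorem mem_of_adj {V : Set α} {A : α → α → Prop} {a b : α} (h : TW V A a b) :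
    ∀ {x y}, A x y → x ∈ V ∧ y ∈ V := by
  induction h with
  | leaf a b => simp
  | series V₁ V₂ A₁ A₂ a c b h₁ h₂ hV hb ha ih₁ ih₂ =>
    rintro x y (h | h)
    · exact ⟨Or.inl (ih₁ h).1, Or.inl (ih₁ h).2⟩
    · exact ⟨Or.inr (ih₂ h).1, Or.inr (ih₂ h).2⟩
  | parallel V₁ V₂ A₁ A₂ a b h₁ h₂ hV ih₁ ih₂ =>
    rintro x y (h | h)
    · exact ⟨Or.inl (ih₁ h).1, Or.inl (ih₁ h).2⟩
    · exact ⟨Or.inr (ih₂ h).1, Or.inr (ih₂ h).2⟩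

/-- In the subgraph induced by `W`, some vertex that is not a terminal has at most two neighbours,
if there is a vertex that is not a terminal. -/
theorem exists_low {V : Set α} {A : α → α → Prop} {a b : α} (h : TW V A a b) (W : Set α) :
    (∀ w ∈ W, w ∈ V → w = a ∨ w = b) ∨
    ∃ w ∈ W, w ∈ V ∧ w ≠ a ∧ w ≠ b ∧ ∃ p q, ∀ y ∈ W, y ≠ w → A w y → y = p ∨ y = q := by
  induction h with
  | leaf a b => left; intro w _ hw; simpa using hw
  | series V₁ V₂ A₁ A₂ a c b h₁ h₂ hV hb ha ih₁ ih₂ =>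
    rcases ih₁ with ih₁ | ⟨w, hw, hwV, hwa, hwc, p, q, hpq⟩
    · rcases ih₂ with ih₂ | ⟨w, hw, hwV, hwc, hwb, p, q, hpq⟩
      · by_cases hc : c ∈ W ∧ c ≠ a ∧ c ≠ b
        · refine Or.inr ⟨c, hc.1, Or.inl h₁.terminals.2, hc.2.1, hc.2.2, a, b, ?_⟩
          rintro y hy hyc (h | h)
          · rcases ih₁ y hy (h₁.mem_of_adj h).2 with rfl | rfl
            · exact Or.inl rfl
            · exact absurd rfl hyc
          · rcases ih₂ y hy (h₂.mem_of_adj h).2 with rfl | rfl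
            · exact absurd rfl hyc
            · exact Or.inr rfl
        · left
          rintro w hw (h | h)
          · rcases ih₁ w hw h with rfl | rfl
            · exact Or.inl rfl
            · by_contra h'
              push Not at h'
              exact hc ⟨hw, h'⟩
          · rcases ih₂ w hw h with rfl | rfl
            · by_contra h'
              push Not at h'
              exact hc ⟨hw, h'⟩
            · exact Or.inr rfl
      · have hw₁ : w ∉ V₁ := fun h => by
          rcases hV w h hwV with rfl | rfl | rfl
          · exact (ha hwV).elim hwc hwb
          · exact hwc rfl
          · exact hwb rfl
        refine Or.inr ⟨w, hw, Or.inr hwV, ?_, hwb, p, q, ?_⟩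
        · rintro rfl
          exact hw₁ h₁.terminals.1
        · rintro y hy hyw (h | h)
          · exact absurd (h₁.mem_of_adj h).1 hw₁
          · exact hpq y hy hyw h
    · have hw₂ : w ∉ V₂ := fun h => by
        rcases hV w hwV h with rfl | rfl | rfl
        · exact hwa rfl
        · exact hwc rfl
        · exact (hb hwV).elim hwa hwc
      refine Or.inr ⟨w, hw, Or.inl hwV, hwa, ?_, p, q, ?_⟩
      · rintro rfl
        exact hw₂ h₂.terminals.2
      · rintro y hy hyw (h | h)
        · exact hpq y hy hyw h
        · exact absurd (h₂.mem_of_adj h).1 hw₂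
  | parallel V₁ V₂ A₁ A₂ a b h₁ h₂ hV ih₁ ih₂ =>
    rcases ih₁ with ih₁ | ⟨w, hw, hwV, hwa, hwb, p, q, hpq⟩
    · rcases ih₂ with ih₂ | ⟨w, hw, hwV, hwa, hwb, p, q, hpq⟩
      · left
        rintro w hw (h | h)
        · exact ih₁ w hw h
        · exact ih₂ w hw h
      · have hw₁ : w ∉ V₁ := fun h => (hV w h hwV).elim hwa hwb
        refine Or.inr ⟨w, hw, Or.inr hwV, hwa, hwb, p, q, ?_⟩
        rintro y hy hyw (h | h)
        · exact absurd (h₁.mem_of_adj h).1 hw₁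
        · exact hpq y hy hyw h
    · have hw₂ : w ∉ V₂ := fun h => (hV w hwV h).elim hwa hwb
      refine Or.inr ⟨w, hw, Or.inl hwV, hwa, hwb, p, q, ?_⟩
      rintro y hy hyw (h | h)
      · exact hpq y hy hyw h
      · exact absurd (h₂.mem_of_adj h).1 hw₂

/-- Contraction of the edge `u w`, or identification of the two vertices `u` and `w`, if they are
not vertices of the graph other than terminals. -/
theorem contract [DecidableEq α] {V : Set α} {A : α → α → Prop} {a b : α} (h : TW V A a b)
    (u w : α) : A u w ∨ ((u ∈ V → u = a ∨ u = b) ∧ (w ∈ V → w = a ∨ w = b)) →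
    ∃ A' : α → α → Prop, TW ((fun x => if x = u then w else x) '' V) A'
      (if a = u then w else a) (if b = u then w else b) ∧
      ∀ x y, A x y → A' (if x = u then w else x) (if y = u then w else y) := by
  generalize hφ : (fun x => if x = u then w else x) = φ
  have hφ' : ∀ x, (if x = u then w else x) = φ x := fun x => by rw [← hφ]
  simp only [hφ']
  have hinj : ∀ x y, φ x = φ y → x = y ∨ (x = u ∧ y = w) ∨ (x = w ∧ y = u) := by
    intro x y h
    rw [← hφ] at h
    simp only at h
    split_ifs at h with h1 h2 h2
    · exact Or.inl (h1.trans h2.symm)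
    · exact Or.inr (Or.inl ⟨h1, h.symm⟩)
    · exact Or.inr (Or.inr ⟨h, h2⟩)
    · exact Or.inl h
  clear hφ'
  induction h with
  | leaf a b =>
    intro _
    refine ⟨fun x y => (x = φ a ∨ x = φ b) ∧ (y = φ a ∨ y = φ b), ?_, ?_⟩
    · rw [Set.image_pair]; exact TW.leaf _ _
    · rintro x y ⟨rfl | rfl, rfl | rfl⟩ <;> simp
  | series V₁ V₂ A₁ A₂ a c b h₁ h₂ hV hb ha ih₁ ih₂ =>
    intro h
    have m₁ : A₁ u w → u ∈ V₁ ∧ w ∈ V₁ := h₁.mem_of_adj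
    have m₂ : A₂ u w → u ∈ V₂ ∧ w ∈ V₂ := h₂.mem_of_adj
    have t₁ := h₁.terminals
    have t₂ := h₂.terminals
    simp only [Set.mem_union] at h
    obtain ⟨A₁', k₁, l₁⟩ := ih₁ (by grind)
    obtain ⟨A₂', k₂, l₂⟩ := ih₂ (by grind)
    refine ⟨fun x y => A₁' x y ∨ A₂' x y, ?_, ?_⟩
    · rw [Set.image_union]
      refine TW.series _ _ A₁' A₂' _ (φ c) _ k₁ k₂ ?_ ?_ ?_
      · rintro y ⟨v₁, hv₁, rfl⟩ ⟨v₂, hv₂, hv⟩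
        have := hinj _ _ hv
        grind
      · rintro ⟨v₁, hv₁, hv⟩
        have := hinj _ _ hv
        grind
      · rintro ⟨v₁, hv₁, hv⟩
        have := hinj _ _ hv
        grind
    · rintro x y (h | h)
      · exact Or.inl (l₁ _ _ h)
      · exact Or.inr (l₂ _ _ h)
  | parallel V₁ V₂ A₁ A₂ a b h₁ h₂ hV ih₁ ih₂ =>
    intro h
    have m₁ : A₁ u w → u ∈ V₁ ∧ w ∈ V₁ := h₁.mem_of_adj
    have m₂ : A₂ u w → u ∈ V₂ ∧ w ∈ V₂ := h₂.mem_of_adj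
    have t₁ := h₁.terminals
    have t₂ := h₂.terminals
    simp only [Set.mem_union] at h
    obtain ⟨A₁', k₁, l₁⟩ := ih₁ (by grind)
    obtain ⟨A₂', k₂, l₂⟩ := ih₂ (by grind)
    refine ⟨fun x y => A₁' x y ∨ A₂' x y, ?_, ?_⟩
    · rw [Set.image_union]
      refine TW.parallel _ _ A₁' A₂' _ _ k₁ k₂ ?_
      rintro y ⟨v₁, hv₁, rfl⟩ ⟨v₂, hv₂, hv⟩
      have := hinj _ _ hv
      grind
    · rintro x y (h | h)
      · exact Or.inl (l₁ _ _ h)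
      · exact Or.inr (l₂ _ _ h)

end TW

/-- The graph on `W` with the adjacency relation `P` is connected, and it is a subgraph of a graph
in the class `TW`. -/
structure Sparse {α : Type*} (W : Finset α) (P : α → α → Prop) : Prop where
  tw : ∃ V A a b, TW V A a b ∧ (∀ w ∈ W, w ∈ V) ∧ ∀ x ∈ W, ∀ y ∈ W, x ≠ y → P x y → A x y
  conn : ∀ X ⊆ W, X.Nonempty → X ≠ W → ∃ x ∈ X, ∃ y ∈ W, y ∉ X ∧ P x y

/-- If there are at least two vertices, some vertex has one or two neighbours. -/
theorem Sparse.exists_low {α : Type*} [DecidableEq α] {W : Finset α} {P : α → α → Prop}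
    (h : Sparse W P) (h2 : 2 ≤ W.card) [DecidableRel P] :
    ∃ w ∈ W, 1 ≤ {y ∈ W | y ≠ w ∧ P w y}.card ∧ {y ∈ W | y ≠ w ∧ P w y}.card ≤ 2 := by
  obtain ⟨V, A, a, b, hT, hW, hA⟩ := h.tw
  have key : ∃ w ∈ W, ∃ p q, ∀ y ∈ W, y ≠ w → P w y → y = p ∨ y = q := by
    rcases hT.exists_low (W : Set α) with h1 | ⟨w, hw, -, -, -, p, q, hpq⟩
    · obtain ⟨w, hw⟩ : W.Nonempty := Finset.card_pos.1 (by omega)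
      exact ⟨w, hw, a, b, fun y hy _ _ => h1 y hy (hW y hy)⟩
    · exact ⟨w, hw, p, q, fun y hy hyw hP => hpq y hy hyw (hA w hw y hy hyw.symm hP)⟩
  obtain ⟨w, hw, p, q, hpq⟩ := key
  refine ⟨w, hw, ?_, ?_⟩
  · obtain ⟨x, hx, y, hy, hyx, hP⟩ := h.conn {w} (by simpa using hw) (by simp) (by
      rintro rfl; simp at h2)
    rw [Finset.mem_singleton] at hx hyx
    subst hx
    exact Finset.card_pos.2 ⟨y, by simp [hy, hyx, hP]⟩
  · refine (Finset.card_le_card (t := {p, q}) fun y hy => ?_).trans Finset.card_le_two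
    rw [Finset.mem_filter] at hy
    simpa using hpq y hy.1 hy.2.1 hy.2.2

/-- Elimination of a vertex `u` whose neighbours are `a` and `b`, which may be equal. -/
theorem Sparse.eliminate {α : Type*} [DecidableEq α] {W : Finset α} {P P' : α → α → Prop}
    (h : Sparse W P) {u a b : α} (ha : a ∈ W) (hau : a ≠ u) (hu : u ∈ W)
    (hua : P u a) (hbu : b ≠ u) (hub : P u b) (hb : b ∈ W)
    (hsymm : ∀ x y, P x y → P y x)
    (hP : ∀ y ∈ W, y ≠ u → P u y → y = a ∨ y = b)
    (hP' : ∀ x ∈ W.erase u, ∀ y ∈ W.erase u,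
      x ≠ y → (P' x y ↔ P x y ∨ (x = a ∧ y = b) ∨ (x = b ∧ y = a))) : Sparse (W.erase u) P' := by
  constructor
  · obtain ⟨V, A, c, d, hT, hW, hA⟩ := h.tw
    obtain ⟨A', hT', hA'⟩ := hT.contract u a (Or.inl (hA u hu a ha hau.symm hua))
    refine ⟨_, _, _, _, hT', fun w hw => ?_, fun x hx y hy hxy hxy' => ?_⟩
    · rw [Finset.mem_erase] at hw
      exact ⟨w, hW w hw.2, by simp [hw.1]⟩
    · have hx' := Finset.mem_erase.1 hx
      have hy' := Finset.mem_erase.1 hy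
      rcases (hP' x hx y hy hxy).1 hxy' with h1 | ⟨rfl, rfl⟩ | ⟨rfl, rfl⟩
      · simpa [hx'.1, hy'.1] using hA' x y (hA x hx'.2 y hy'.2 hxy h1)
      · simpa [hy'.1] using hA' u y (hA u hu y hb hy'.1.symm hub)
      · simpa [hx'.1] using hA' x u (hA x hb u hu hx'.1 (hsymm _ _ hub))
  · intro X hX hne hXW
    have hX' : ∀ x ∈ X, x ∈ W ∧ x ≠ u := fun x hx =>
      ⟨(Finset.mem_erase.1 (hX hx)).2, (Finset.mem_erase.1 (hX hx)).1⟩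
    have huX : u ∉ X := fun h => (hX' u h).2 rfl
    have good : ∀ x ∈ X, ∀ y ∈ W, y ≠ u → y ∉ X → P x y →
        ∃ x ∈ X, ∃ y ∈ W.erase u, y ∉ X ∧ P' x y := fun x hx y hy hyu hyX hP =>
      ⟨x, hx, y, Finset.mem_erase.2 ⟨hyu, hy⟩, hyX, (hP' x (hX hx) y (Finset.mem_erase.2 ⟨hyu, hy⟩)
        (fun h => hyX (h ▸ hx))).2 (Or.inl hP)⟩
    have hab : (a ∈ X ∧ b ∉ X) ∨ (b ∈ X ∧ a ∉ X) →
        ∃ x ∈ X, ∃ y ∈ W.erase u, y ∉ X ∧ P' x y := by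
      rintro (⟨h1, h2⟩ | ⟨h1, h2⟩)
      · exact ⟨a, h1, b, Finset.mem_erase.2 ⟨hbu, hb⟩, h2, (hP' a (hX h1) b
          (Finset.mem_erase.2 ⟨hbu, hb⟩) (fun h => h2 (h ▸ h1))).2 (Or.inr (Or.inl ⟨rfl, rfl⟩))⟩
      · exact ⟨b, h1, a, Finset.mem_erase.2 ⟨hau, ha⟩, h2, (hP' b (hX h1) a
          (Finset.mem_erase.2 ⟨hau, ha⟩) (fun h => h2 (h ▸ h1))).2 (Or.inr (Or.inr ⟨rfl, rfl⟩))⟩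
    obtain ⟨x, hx, y, hy, hyX, hxy⟩ := h.conn X (fun x hx => (hX' x hx).1) hne (by
      rintro rfl; exact huX hu)
    by_cases hyu : y = u
    · subst hyu
      have hxab := hP x (hX' x hx).1 (hX' x hx).2 (hsymm _ _ hxy)
      -- the edge crosses to `u`: look at the edges that leave `X ∪ {u}`
      obtain ⟨x', hx', y', hy', hyX', hxy'⟩ := h.conn (insert y X) (by
        intro z hz
        rcases Finset.mem_insert.1 hz with rfl | hz
        · exact hy
        · exact (hX' z hz).1) (by simp) (by
        rintro h'
        apply hXW
        rw [← h', Finset.erase_insert huX])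
      rw [Finset.mem_insert, not_or] at hyX'
      rcases Finset.mem_insert.1 hx' with rfl | hx'
      · have hyab := hP y' hy' hyX'.1 hxy'
        grind
      · exact good x' hx' y' hy' hyX'.1 hyX'.2 hxy'
    · exact good x hx y hy hyu hyX hxy

namespace Network

variable {n m : ℕ} {G : Network n m}

/-- A series-parallel graph belongs to the class `TW`. -/
theorem IsSP.exists_tw {V : Finset (Fin n)} {E : Finset (Fin m)} {a b : Fin n}
    (h : G.IsSP V E a b) : ∃ A, TW (V : Set (Fin n)) A a b ∧
      ∀ e ∈ E, A (G.src e) (G.tgt e) ∧ A (G.tgt e) (G.src e) := by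
  induction h with
  | edge e a b hab he =>
    refine ⟨_, by rw [Finset.coe_pair]; exact TW.leaf a b, ?_⟩
    intro e' he'
    rw [Finset.mem_singleton.1 he']
    rw [Sym2.eq_iff] at he
    tauto
  | series V₁ V₂ E₁ E₂ a c b h₁ h₂ hV hE ih₁ ih₂ =>
    obtain ⟨A₁, k₁, l₁⟩ := ih₁
    obtain ⟨A₂, k₂, l₂⟩ := ih₂
    have hc : ∀ y ∈ V₁, y ∈ V₂ → y = c := fun y h1 h2 => by
      have : y ∈ V₁ ∩ V₂ := Finset.mem_inter.2 ⟨h1, h2⟩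
      rw [hV] at this
      exact Finset.mem_singleton.1 this
    refine ⟨_, by
      rw [Finset.coe_union]
      exact TW.series _ _ A₁ A₂ a c b k₁ k₂ (fun y h1 h2 => Or.inr (Or.inl (hc y h1 h2)))
        (fun h => Or.inr (hc b h k₂.terminals.2)) (fun h => Or.inl (hc a k₁.terminals.1 h)), ?_⟩
    intro e he
    rcases Finset.mem_union.1 he with he | he
    · exact ⟨Or.inl (l₁ e he).1, Or.inl (l₁ e he).2⟩
    · exact ⟨Or.inr (l₂ e he).1, Or.inr (l₂ e he).2⟩
  | parallel V₁ V₂ E₁ E₂ a b h₁ h₂ hV hE ih₁ ih₂ =>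
    obtain ⟨A₁, k₁, l₁⟩ := ih₁
    obtain ⟨A₂, k₂, l₂⟩ := ih₂
    refine ⟨_, by
      rw [Finset.coe_union]
      exact TW.parallel _ _ A₁ A₂ a b k₁ k₂ fun y h1 h2 => by
        have : y ∈ V₁ ∩ V₂ := Finset.mem_inter.2 ⟨h1, h2⟩
        rw [hV] at this
        simpa using this, ?_⟩
    intro e he
    rcases Finset.mem_union.1 he with he | he
    · exact ⟨Or.inl (l₁ e he).1, Or.inl (l₁ e he).2⟩
    · exact ⟨Or.inr (l₂ e he).1, Or.inr (l₂ e he).2⟩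

/-- An edge of `E` joins `X` to a vertex outside of `X`. -/
def Crosses (G : Network n m) (E : Finset (Fin m)) (X : Finset (Fin n)) : Prop :=
  ∃ e ∈ E, (G.src e ∈ X ∧ G.tgt e ∉ X) ∨ (G.tgt e ∈ X ∧ G.src e ∉ X)

theorem Crosses.mono {E E' : Finset (Fin m)} {X : Finset (Fin n)} (h : G.Crosses E X)
    (hE : E ⊆ E') : G.Crosses E' X := by
  obtain ⟨e, he, h⟩ := h
  exact ⟨e, hE he, h⟩

/-- A series-parallel graph is connected. -/
theorem IsSP.crosses {V : Finset (Fin n)} {E : Finset (Fin m)} {a b : Fin n}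
    (h : G.IsSP V E a b) (X : Finset (Fin n)) :
    ∀ x ∈ V, x ∈ X → ∀ y ∈ V, y ∉ X → G.Crosses E X := by
  induction h with
  | edge e a b hab he =>
    intro x hx hxX y hy hyX
    refine ⟨e, by simp, ?_⟩
    simp only [Finset.mem_insert, Finset.mem_singleton] at hx hy
    rw [Sym2.eq_iff] at he
    grind
  | series V₁ V₂ E₁ E₂ a c b h₁ h₂ hV hE ih₁ ih₂ =>
    intro x hx hxX y hy hyX
    have hc : c ∈ V₁ ∩ V₂ := by rw [hV]; simp
    rw [Finset.mem_inter] at hc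
    have s₁ : E₁ ⊆ E₁ ∪ E₂ := Finset.subset_union_left
    have s₂ : E₂ ⊆ E₁ ∪ E₂ := Finset.subset_union_right
    by_cases hcX : c ∈ X
    · rcases Finset.mem_union.1 hy with hy | hy
      · exact (ih₁ c hc.1 hcX y hy hyX).mono s₁
      · exact (ih₂ c hc.2 hcX y hy hyX).mono s₂
    · rcases Finset.mem_union.1 hx with hx | hx
      · exact (ih₁ x hx hxX c hc.1 hcX).mono s₁
      · exact (ih₂ x hx hxX c hc.2 hcX).mono s₂
  | parallel V₁ V₂ E₁ E₂ a b h₁ h₂ hV hE ih₁ ih₂ =>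
    intro x hx hxX y hy hyX
    have hc : a ∈ V₁ ∩ V₂ := by rw [hV]; simp
    rw [Finset.mem_inter] at hc
    have s₁ : E₁ ⊆ E₁ ∪ E₂ := Finset.subset_union_left
    have s₂ : E₂ ⊆ E₁ ∪ E₂ := Finset.subset_union_right
    by_cases hcX : a ∈ X
    · rcases Finset.mem_union.1 hy with hy | hy
      · exact (ih₁ a hc.1 hcX y hy hyX).mono s₁
      · exact (ih₂ a hc.2 hcX y hy hyX).mono s₂
    · rcases Finset.mem_union.1 hx with hx | hx
      · exact (ih₁ x hx hxX a hc.1 hcX).mono s₁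
      · exact (ih₂ x hx hxX a hc.2 hcX).mono s₂

theorem IsSP.card_le {V : Finset (Fin n)} {E : Finset (Fin m)} {a b : Fin n}
    (h : G.IsSP V E a b) : V.card ≤ E.card + 1 ∧ 1 ≤ E.card ∧
      ∀ e ∈ E, G.src e ≠ G.tgt e := by
  induction h with
  | edge e a b hab he =>
    refine ⟨by rw [Finset.card_pair hab]; simp, by simp, fun e' he' => ?_⟩
    rw [Finset.mem_singleton.1 he']
    rw [Sym2.eq_iff] at he
    grind
  | series V₁ V₂ E₁ E₂ a c b h₁ h₂ hV hE ih₁ ih₂ =>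
    have h3 := Finset.card_union_add_card_inter V₁ V₂
    rw [hV, Finset.card_singleton] at h3
    rw [Finset.card_union_of_disjoint hE]
    refine ⟨by omega, by omega, fun e he => ?_⟩
    exact (Finset.mem_union.1 he).elim (ih₁.2.2 e) (ih₂.2.2 e)
  | parallel V₁ V₂ E₁ E₂ a b h₁ h₂ hV hE ih₁ ih₂ =>
    have h3 := Finset.card_union_add_card_inter V₁ V₂
    have h4 : 1 ≤ (V₁ ∩ V₂).card := by rw [hV]; exact Finset.card_pos.2 ⟨a, by simp⟩
    rw [Finset.card_union_of_disjoint hE]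
    refine ⟨by omega, by omega, fun e he => ?_⟩
    exact (Finset.mem_union.1 he).elim (ih₁.2.2 e) (ih₂.2.2 e)

theorem IsSeriesParallel.sparse (h : G.IsSeriesParallel) {P : Fin n → Fin n → Prop}
    (hP : ∀ x y, x ≠ y → (P x y ↔ ∃ e, s(G.src e, G.tgt e) = s(x, y))) :
    Sparse Finset.univ P := by
  obtain ⟨a, b, h⟩ := h
  constructor
  · obtain ⟨A, hT, hA⟩ := h.exists_tw
    refine ⟨_, A, a, b, hT, fun w _ => by simp, fun x _ y _ hxy hPxy => ?_⟩
    obtain ⟨e, he⟩ := (hP x y hxy).1 hPxy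
    rcases Sym2.eq_iff.1 he with ⟨rfl, rfl⟩ | ⟨rfl, rfl⟩
    · exact (hA e (Finset.mem_univ e)).1
    · exact (hA e (Finset.mem_univ e)).2
  · rintro X - ⟨x, hx⟩ hX
    obtain ⟨y, hy⟩ : ∃ y, y ∉ X := by
      by_contra h'
      push Not at h'
      exact hX (Finset.eq_univ_iff_forall.2 h')
    obtain ⟨e, -, ⟨h1, h2⟩ | ⟨h1, h2⟩⟩ :=
      h.crosses X x (Finset.mem_univ x) hx y (Finset.mem_univ y) hy
    · exact ⟨_, h1, _, Finset.mem_univ _, h2, (hP _ _ fun h' => h2 (by rwa [← h'])).2 ⟨e, rfl⟩⟩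
    · exact ⟨_, h1, _, Finset.mem_univ _, h2, (hP _ _ fun h' => h2 (by rwa [← h'])).2
        ⟨e, Sym2.eq_swap⟩⟩

theorem IsSeriesParallel.card_le (h : G.IsSeriesParallel) :
    n ≤ m + 1 ∧ 1 ≤ m ∧ ∀ e, G.src e ≠ G.tgt e := by
  obtain ⟨a, b, h⟩ := h
  simpa using h.card_le

end Network
end SPNet

namespace SPNet

/-! ### Reducing a network by eliminating vertices -/

open SPNet.Tree

/-- A state of the reduction of `G`, when the first `i` edges have been read. `W` is the set of the
vertices that are left, and a piece `t a b` with the ends `a` and `b` is present if `P a b` holds;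
the piece `t u u` is attached at `u` only and contains `u`. Each vertex `y` belongs to the piece
between the two members of the unordered pair `lv y`, and each edge `e` to the piece given by
`le e`, except that the vertices of `X` and the edges of `E` are still to be added to that piece. -/
structure Red {n m : ℕ} (G : Network n m) (i : ℕ) (W : Finset (Fin n)) (P : Fin n → Fin n → Prop)
    (t : Fin n → Fin n → Tree n m) (lv : Fin n → Sym2 (Fin n)) (le : Fin m → Sym2 (Fin n))
    (X : Finset (Fin n)) (E : Finset (Fin m)) : Prop where
  mem : ∀ a b, P a b → a ∈ W ∧ b ∈ W
  symm : ∀ a b, P a b → P b a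
  refl : ∀ u ∈ W, P u u
  wf : ∀ a b, P a b → WF G (t a b) a b
  verts : ∀ a b, P a b → ∀ y, y ∈ (t a b).verts ↔ lv y = s(a, b) ∧ y ∉ X
  edges : ∀ a b, P a b → ∀ e, e ∈ (t a b).edges ↔ (e : ℕ) < i ∧ le e = s(a, b) ∧ e ∉ E
  lvP : ∀ a b y, lv y = s(a, b) → y ∉ X → P a b
  leP : ∀ a b (e : Fin m), (e : ℕ) < i → le e = s(a, b) → e ∉ E → P a b
  left : ∀ y ∈ W, lv y = s(y, y) ∧ y ∉ X
  inc : ∀ (e : Fin m) u, (e : ℕ) < i → u ∈ W → G.src e = u ∨ G.tgt e = u → u ∈ le e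
  size : ∀ a b, P a b → (t a b).size + 2 ≤ 4 * ((t a b).verts.card + (t a b).edges.card)

namespace Red

variable {n m : ℕ} {G : Network n m} {i : ℕ} {W : Finset (Fin n)} {P : Fin n → Fin n → Prop}
  {t : Fin n → Fin n → Tree n m} {lv : Fin n → Sym2 (Fin n)} {le : Fin m → Sym2 (Fin n)}
  {X : Finset (Fin n)} {E : Finset (Fin m)}

/-- The start of the reduction: every vertex is a piece of its own, and no edge has been read. -/
theorem init (G : Network n m) : Red G 0 Finset.univ (fun a b => a = b) (fun a _ => .nil a)
    (fun y => s(y, y)) (fun e => s(G.src e, G.tgt e)) ∅ ∅ where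
  mem := by simp
  symm := fun a b h => h.symm
  refl := by simp
  wf := by rintro a _ rfl; exact WF.nil a
  verts := by rintro a _ rfl y; simp [Tree.verts]
  edges := by simp [Tree.edges]
  lvP := by
    intro a b y h _
    rw [Sym2.eq_iff] at h
    grind
  leP := by simp
  left := by simp
  inc := by simp
  size := by simp [Tree.size, Tree.verts, Tree.edges]

theorem disjoint_verts (h : Red G i W P t lv le X E) {a b c d : Fin n} (h₁ : P a b) (h₂ : P c d)
    (hne : s(a, b) ≠ s(c, d)) : Disjoint (t a b).verts (t c d).verts := by
  rw [Finset.disjoint_left]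
  intro y hy hy'
  rw [h.verts a b h₁] at hy
  rw [h.verts c d h₂] at hy'
  exact hne (hy.1.symm.trans hy'.1)

theorem disjoint_edges (h : Red G i W P t lv le X E) {a b c d : Fin n} (h₁ : P a b) (h₂ : P c d)
    (hne : s(a, b) ≠ s(c, d)) : Disjoint (t a b).edges (t c d).edges := by
  rw [Finset.disjoint_left]
  intro y hy hy'
  rw [h.edges a b h₁] at hy
  rw [h.edges c d h₂] at hy'
  exact hne (hy.2.1.symm.trans hy'.2.1)

theorem not_mem_verts (h : Red G i W P t lv le X E) {a b y : Fin n} (h₁ : P a b) (hy : y ∈ W)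
    (hab : a ≠ b) : y ∉ (t a b).verts := by
  rw [h.verts a b h₁, (h.left y hy).1]
  rintro ⟨h2, -⟩
  rw [Sym2.eq_iff] at h2
  grind

/-- Reading the edge `e`: it is assigned to the piece between its endpoints, but it is still to be
added to the tree of that piece. -/
theorem insert_edge (h : Red G i W P t lv le ∅ ∅) (e : Fin m) (he : (e : ℕ) = i)
    (hle : le e = s(G.src e, G.tgt e)) : Red G (i + 1) W P t lv le ∅ {e} where
  mem := h.mem
  symm := h.symm
  refl := h.refl
  wf := h.wf
  verts := h.verts
  edges := by
    intro a b hab e'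
    rw [h.edges a b hab]
    have : e' ∉ ({e} : Finset (Fin m)) ↔ (e' : ℕ) ≠ i := by
      rw [Finset.mem_singleton, ← he, Fin.val_inj.ne]
    rw [this]
    simp only [Finset.notMem_empty, not_false_eq_true, and_true]
    constructor
    · rintro ⟨h1, h2⟩; exact ⟨by omega, h2, by omega⟩
    · rintro ⟨h1, h2, h3⟩; exact ⟨by omega, h2⟩
  lvP := h.lvP
  leP := by
    intro a b e' h1 h2 h3
    rw [Finset.mem_singleton, ← Fin.val_inj, he] at h3
    exact h.leP a b e' (by omega) h2 (by simp)
  left := h.left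
  inc := by
    intro e' u h1 hu h2
    by_cases h3 : e' = e
    · subst h3
      rw [hle, Sym2.mem_iff]
      tauto
    · rw [← Fin.val_inj, he] at h3
      exact h.inc e' u (by omega) hu h2
  size := h.size

/-- Adding a new piece to a piece between two different vertices. -/
theorem merge (h : Red G i W P t lv le X E) {T N : Tree n m} {a b : Fin n} (ha : a ∈ W)
    (hb : b ∈ W) (hab : a ≠ b) (hT : WF G T a b) (hX : T.verts = X) (hE : T.edges = E)
    (hlv : ∀ y ∈ X, lv y = s(a, b)) (hle : ∀ e ∈ E, (e : ℕ) < i ∧ le e = s(a, b))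
    (hsize : T.size + 3 ≤ 4 * (T.verts.card + T.edges.card))
    (hN : (P a b ∧ N = par (t a b) T) ∨ (¬ P a b ∧ N = T))
    {P' : Fin n → Fin n → Prop} {t' : Fin n → Fin n → Tree n m}
    (hP' : ∀ x y, P' x y ↔ P x y ∨ s(x, y) = s(a, b))
    (hab' : t' a b = N) (hba' : t' b a = rev N)
    (ht' : ∀ x y, P x y → s(x, y) ≠ s(a, b) → t' x y = t x y) :
    Red G i W P' t' lv le ∅ ∅ := by
  have hdV : P a b → Disjoint (t a b).verts T.verts := fun hP => by
    rw [Finset.disjoint_left]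
    intro y hy
    rw [h.verts a b hP] at hy
    rw [hX]; exact hy.2
  have hdE : P a b → Disjoint (t a b).edges T.edges := fun hP => by
    rw [Finset.disjoint_left]
    intro y hy
    rw [h.edges a b hP] at hy
    rw [hE]; exact hy.2.2
  have haX : ∀ y ∈ W, y ∉ T.verts := fun y hy => by rw [hX]; exact (h.left y hy).2
  have hNwf : WF G N a b := by
    rcases hN with ⟨hP, rfl⟩ | ⟨-, rfl⟩
    · exact WF.par _ _ a b (h.wf a b hP) hT
        (fun hab => ⟨h.not_mem_verts hP ha hab, haX a ha⟩) (hdV hP) (hdE hP)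
    · exact hT
  have hNv : ∀ y, y ∈ N.verts ↔ lv y = s(a, b) := fun y => by
    rcases hN with ⟨hP, rfl⟩ | ⟨hP, rfl⟩
    · rw [Tree.verts, Finset.mem_union, h.verts a b hP, hX]
      have := hlv y
      tauto
    · rw [hX]
      refine ⟨hlv y, fun h1 => ?_⟩
      by_contra h2
      exact hP (h.lvP a b y h1 h2)
  have hNe : ∀ e, e ∈ N.edges ↔ (e : ℕ) < i ∧ le e = s(a, b) := fun e => by
    rcases hN with ⟨hP, rfl⟩ | ⟨hP, rfl⟩
    · rw [Tree.edges, Finset.mem_union, h.edges a b hP, hE]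
      have := hle e
      tauto
    · rw [hE]
      refine ⟨hle e, fun h1 => ?_⟩
      by_contra h2
      exact hP (h.leP a b e h1.1 h1.2 h2)
  have hNs : N.size + 3 ≤ 4 * (N.verts.card + N.edges.card) := by
    rcases hN with ⟨hP, rfl⟩ | ⟨hP, rfl⟩
    · rw [Tree.size, Tree.verts, Tree.edges, Finset.card_union_of_disjoint (hdV hP),
        Finset.card_union_of_disjoint (hdE hP)]
      have := h.size a b hP
      omega
    · exact hsize
  have hNmem : ∀ y ∈ W, y ∉ N.verts := fun y hy => by
    rw [hNv, (h.left y hy).1, Sym2.eq_iff]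
    grind
  -- a property of the new pieces holds if it holds for the old pieces and for the new tree
  have split : ∀ (Q : Fin n → Fin n → Tree n m → Prop), Q a b N → Q b a (rev N) →
      (∀ x y, P x y → s(x, y) ≠ s(a, b) → Q x y (t x y)) → ∀ x y, P' x y → Q x y (t' x y) := by
    intro Q h1 h2 h3 x y hxy
    by_cases hs : s(x, y) = s(a, b)
    · rcases Sym2.eq_iff.1 hs with ⟨rfl, rfl⟩ | ⟨rfl, rfl⟩
      · rwa [hab']
      · rwa [hba']
    · have hPxy := ((hP' x y).1 hxy).resolve_right hs
      rw [ht' x y hPxy hs]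
      exact h3 x y hPxy hs
  refine ⟨?_, ?_, ?_, ?_, ?_, ?_, ?_, ?_, ?_, ?_, ?_⟩
  · intro x y hxy
    rcases (hP' x y).1 hxy with h1 | h1
    · exact h.mem x y h1
    · rcases Sym2.eq_iff.1 h1 with ⟨rfl, rfl⟩ | ⟨rfl, rfl⟩
      · exact ⟨ha, hb⟩
      · exact ⟨hb, ha⟩
  · intro x y hxy
    rw [hP'] at hxy ⊢
    rw [Sym2.eq_swap]
    exact hxy.imp (h.symm x y) id
  · exact fun u hu => (hP' u u).2 (Or.inl (h.refl u hu))
  · exact split (fun x y T => WF G T x y) hNwf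
      (WF.rev N a b hNwf hab (hNmem a ha) (hNmem b hb)) (fun x y hP _ => h.wf x y hP)
  · refine split (fun x y T => ∀ z, z ∈ T.verts ↔ lv z = s(x, y) ∧ z ∉ (∅ : Finset (Fin n)))
      (by simpa using hNv) (by simpa [Tree.verts, Sym2.eq_swap (a := b)] using hNv) ?_
    intro x y hP hs z
    rw [h.verts x y hP]
    simp only [Finset.notMem_empty, not_false_eq_true, and_true, and_iff_left_iff_imp]
    intro h1 h2
    exact hs (h1.symm.trans (hlv z h2))
  · refine split (fun x y T => ∀ e, e ∈ T.edges ↔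
      (e : ℕ) < i ∧ le e = s(x, y) ∧ e ∉ (∅ : Finset (Fin m)))
      (by simpa using hNe) (by simpa [Tree.edges, Sym2.eq_swap (a := b)] using hNe) ?_
    intro x y hP hs e
    rw [h.edges x y hP]
    simp only [Finset.notMem_empty, not_false_eq_true, and_true, and_congr_right_iff,
      and_iff_left_iff_imp]
    intro _ h1 h2
    exact hs (h1.symm.trans (hle e h2).2)
  · intro x y z hz _
    rw [hP']
    by_cases hzX : z ∈ X
    · exact Or.inr (hz.symm.trans (hlv z hzX))
    · exact Or.inl (h.lvP x y z hz hzX)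
  · intro x y e he hz _
    rw [hP']
    by_cases heE : e ∈ E
    · exact Or.inr (hz.symm.trans (hle e heE).2)
    · exact Or.inl (h.leP x y e he hz heE)
  · exact fun y hy => ⟨(h.left y hy).1, by simp⟩
  · exact h.inc
  · refine split (fun x y T => T.size + 2 ≤ 4 * (T.verts.card + T.edges.card)) (by omega) ?_
      (fun x y hP _ => h.size x y hP)
    simp only [Tree.size, Tree.verts, Tree.edges]
    omega

/-- Adding a new piece to the piece that is attached at the single vertex `a`. -/
theorem merge_loop (h : Red G i W P t lv le X E) {T : Tree n m} {a : Fin n} (ha : a ∈ W)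
    (hT : WF G T a a) (hX : T.verts = X) (hE : T.edges = E)
    (hlv : ∀ y ∈ X, lv y = s(a, a)) (hle : ∀ e ∈ E, (e : ℕ) < i ∧ le e = s(a, a))
    (hsize : T.size + 2 ≤ 4 * (T.verts.card + T.edges.card)) {t' : Fin n → Fin n → Tree n m}
    (haa' : t' a a = par (t a a) T) (ht' : ∀ x y, P x y → s(x, y) ≠ s(a, a) → t' x y = t x y) :
    Red G i W P t' lv le ∅ ∅ := by
  have hP := h.refl a ha
  have hdV : Disjoint (t a a).verts T.verts := by
    rw [Finset.disjoint_left]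
    intro y hy
    rw [h.verts a a hP] at hy
    rw [hX]; exact hy.2
  have hdE : Disjoint (t a a).edges T.edges := by
    rw [Finset.disjoint_left]
    intro y hy
    rw [h.edges a a hP] at hy
    rw [hE]; exact hy.2.2
  have split : ∀ (Q : Fin n → Fin n → Tree n m → Prop), Q a a (par (t a a) T) →
      (∀ x y, P x y → s(x, y) ≠ s(a, a) → Q x y (t x y)) → ∀ x y, P x y → Q x y (t' x y) := by
    intro Q h1 h3 x y hxy
    by_cases hs : s(x, y) = s(a, a)
    · rcases Sym2.eq_iff.1 hs with ⟨rfl, rfl⟩ | ⟨rfl, rfl⟩ <;> rwa [haa']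
    · rw [ht' x y hxy hs]
      exact h3 x y hxy hs
  refine ⟨h.mem, h.symm, h.refl, ?_, ?_, ?_, ?_, ?_, ?_, h.inc, ?_⟩
  · exact split (fun x y T => WF G T x y)
      (WF.par _ _ a a (h.wf a a hP) hT (fun h => absurd rfl h) hdV hdE)
      (fun x y hP _ => h.wf x y hP)
  · refine split (fun x y T => ∀ z, z ∈ T.verts ↔ lv z = s(x, y) ∧ z ∉ (∅ : Finset (Fin n))) ?_ ?_
    · intro z
      rw [Tree.verts, Finset.mem_union, h.verts a a hP, hX]
      have := hlv z
      simp only [Finset.notMem_empty, not_false_eq_true, and_true]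
      tauto
    · intro x y hP hs z
      rw [h.verts x y hP]
      simp only [Finset.notMem_empty, not_false_eq_true, and_true, and_iff_left_iff_imp]
      intro h1 h2
      exact hs (h1.symm.trans (hlv z h2))
  · refine split (fun x y T => ∀ e, e ∈ T.edges ↔
      (e : ℕ) < i ∧ le e = s(x, y) ∧ e ∉ (∅ : Finset (Fin m))) ?_ ?_
    · intro e
      rw [Tree.edges, Finset.mem_union, h.edges a a hP, hE]
      have := hle e
      simp only [Finset.notMem_empty, not_false_eq_true, and_true]
      tauto
    · intro x y hP hs e
      rw [h.edges x y hP]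
      simp only [Finset.notMem_empty, not_false_eq_true, and_true, and_congr_right_iff,
        and_iff_left_iff_imp]
      intro _ h1 h2
      exact hs (h1.symm.trans (hle e h2).2)
  · intro x y z hz _
    by_cases hzX : z ∈ X
    · rcases Sym2.eq_iff.1 (hz.symm.trans (hlv z hzX)) with ⟨rfl, rfl⟩ | ⟨rfl, rfl⟩ <;> exact hP
    · exact h.lvP x y z hz hzX
  · intro x y e he hz _
    by_cases heE : e ∈ E
    · rcases Sym2.eq_iff.1 (hz.symm.trans (hle e heE).2) with ⟨rfl, rfl⟩ | ⟨rfl, rfl⟩ <;> exact hP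
    · exact h.leP x y e he hz heE
  · exact fun y hy => ⟨(h.left y hy).1, by simp⟩
  · refine split (fun x y T => T.size + 2 ≤ 4 * (T.verts.card + T.edges.card)) ?_
      (fun x y hP _ => h.size x y hP)
    rw [Tree.size, Tree.verts, Tree.edges, Finset.card_union_of_disjoint hdV,
      Finset.card_union_of_disjoint hdE]
    have := h.size a a hP
    omega

/-- Removal of a vertex `u` whose neighbours are `a` and `b`, which may be equal. The vertices and
the edges of the pieces at `u` are assigned to the piece between `a` and `b`. -/
theorem remove (h : Red G i W P t lv le ∅ ∅) {u a b : Fin n}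
    (hnb : ∀ y, P u y → y = u ∨ y = a ∨ y = b) :
    Red G i (W.erase u) (fun x y => P x y ∧ x ≠ u ∧ y ≠ u) t
      (fun y => if u ∈ lv y then s(a, b) else lv y) (fun e => if u ∈ le e then s(a, b) else le e)
      {y | u ∈ lv y} {e | (e : ℕ) < i ∧ u ∈ le e} where
  mem := fun x y hP => by
    have := h.mem x y hP.1
    simp [hP.2, this]
  symm := fun x y hP => ⟨h.symm x y hP.1, hP.2.2, hP.2.1⟩
  refl := fun x hx => by
    rw [Finset.mem_erase] at hx
    exact ⟨h.refl x hx.2, hx.1, hx.1⟩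
  wf := fun x y hP => h.wf x y hP.1
  verts := by
    intro x y hP z
    rw [h.verts x y hP.1]
    have hu : u ∉ s(x, y) := by
      rw [Sym2.mem_iff]; push Not; exact ⟨hP.2.1.symm, hP.2.2.symm⟩
    simp only [Finset.notMem_empty, not_false_eq_true, and_true, Finset.mem_filter,
      Finset.mem_univ, true_and]
    split_ifs with h1
    · simp only [h1, not_true_eq_false, and_false, iff_false]
      intro h2; rw [h2] at h1; exact hu h1
    · simp [h1]
  edges := by
    intro x y hP e
    rw [h.edges x y hP.1]
    have hu : u ∉ s(x, y) := by
      rw [Sym2.mem_iff]; push Not; exact ⟨hP.2.1.symm, hP.2.2.symm⟩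
    simp only [Finset.notMem_empty, not_false_eq_true, and_true, Finset.mem_filter,
      Finset.mem_univ, true_and]
    split_ifs with h1
    · simp only [h1, and_true]
      constructor
      · rintro ⟨-, h2⟩; rw [h2] at h1; exact absurd h1 hu
      · rintro ⟨h2, -, h3⟩; exact absurd h2 h3
    · simp [h1]
  lvP := by
    intro x y z hz hz'
    simp only [Finset.mem_filter, Finset.mem_univ, true_and] at hz'
    rw [if_neg hz'] at hz
    rw [hz, Sym2.mem_iff] at hz'
    push Not at hz'
    exact ⟨h.lvP x y z hz (by simp), hz'.1.symm, hz'.2.symm⟩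
  leP := by
    intro x y e he hz hz'
    simp only [Finset.mem_filter, Finset.mem_univ, true_and, not_and] at hz'
    rw [if_neg (hz' he)] at hz
    have := hz' he
    rw [hz, Sym2.mem_iff] at this
    push Not at this
    exact ⟨h.leP x y e he hz (by simp), this.1.symm, this.2.symm⟩
  left := by
    intro y hy
    rw [Finset.mem_erase] at hy
    have : u ∉ lv y := by
      rw [(h.left y hy.2).1, Sym2.mem_iff]; simpa using hy.1.symm
    rw [if_neg this, (h.left y hy.2).1]
    simp [hy.1.symm, (h.left y hy.2).1]
  inc := by
    intro e w he hw hew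
    rw [Finset.mem_erase] at hw
    have h1 := h.inc e w he hw.2 hew
    split_ifs with h2
    · have h3 : le e = s(u, w) := ((Sym2.mem_and_mem_iff hw.1.symm).1 ⟨h2, h1⟩)
      rw [Sym2.mem_iff]
      exact (hnb w (h.leP u w e he h3 (by simp))).resolve_left hw.1
    · exact h1
  size := fun x y hP => h.size x y hP.1

/-- Absorbing the piece that is attached at `u` into the piece between `a` and `u`. -/
theorem absorb_tree (h : Red G i W P t lv le ∅ ∅) {u a : Fin n} (hu : u ∈ W) (hau : a ≠ u)
    (ha : P a u) : WF G (ser (t a u) (t u u)) a u ∧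
      (∀ y, y ∈ (ser (t a u) (t u u)).verts ↔ lv y = s(a, u) ∨ lv y = s(u, u)) ∧
      (∀ e, e ∈ (ser (t a u) (t u u)).edges ↔ (e : ℕ) < i ∧ (le e = s(a, u) ∨ le e = s(u, u))) ∧
      (ser (t a u) (t u u)).size + 3 ≤ 4 * ((ser (t a u) (t u u)).verts.card +
        (ser (t a u) (t u u)).edges.card) ∧
      Disjoint (t a u).verts (t u u).verts := by
  have hl := h.refl u hu
  have hne : s(a, u) ≠ s(u, u) := by
    intro h'; rcases Sym2.eq_iff.1 h' with ⟨h', -⟩ | ⟨h', -⟩ <;> exact hau h'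
  have hdV := h.disjoint_verts ha hl hne
  have hdE := h.disjoint_edges ha hl hne
  have haW := (h.mem a u ha).1
  have hal : a ∉ (t u u).verts := by
    rw [h.verts u u hl, (h.left a haW).1]
    rintro ⟨h', -⟩
    rcases Sym2.eq_iff.1 h' with ⟨h', -⟩ | ⟨h', -⟩ <;> exact hau h'
  refine ⟨WF.absorb _ _ a u (h.wf a u ha) (h.wf u u hl) hau (h.not_mem_verts ha haW hau) hal
    (h.not_mem_verts ha hu hau) hdV hdE, fun y => ?_, fun e => ?_, ?_, hdV⟩
  · simp [Tree.verts, h.verts a u ha, h.verts u u hl]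
  · simp [Tree.edges, h.edges a u ha, h.edges u u hl, and_or_left]
  · rw [Tree.size, Tree.verts, Tree.edges, Finset.card_union_of_disjoint hdV,
      Finset.card_union_of_disjoint hdE]
    have := h.size a u ha
    have := h.size u u hl
    omega

/-- The tree that replaces the pieces at a vertex `u` with a single neighbour `a`. -/
theorem pendant_tree (h : Red G m W P t lv le ∅ ∅) {u a : Fin n} (hu : u ∈ W) (hau : a ≠ u)
    (ha : P a u) (hnb : ∀ y, P u y → y = u ∨ y = a) {T : Tree n m}
    (hT : T = close (ser (t a u) (t u u))) :
    WF G T a a ∧ T.verts = ({y | u ∈ lv y} : Finset (Fin n)) ∧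
      T.edges = ({e | (e : ℕ) < m ∧ u ∈ le e} : Finset (Fin m)) ∧
      T.size + 2 ≤ 4 * (T.verts.card + T.edges.card) := by
  obtain ⟨hwf, hV, hE, hs, -⟩ := h.absorb_tree hu hau ha
  have haW := (h.mem a u ha).1
  have hE' : T.edges = ({e | (e : ℕ) < m ∧ u ∈ le e} : Finset (Fin m)) := by
    ext e
    rw [hT, Tree.edges, hE]
    simp only [Finset.mem_filter, Finset.mem_univ, true_and, and_congr_right_iff]
    intro h1
    constructor
    · rintro (h' | h') <;> simp [h']
    · intro h'
      obtain ⟨z, hz⟩ := Sym2.mem_iff_exists.1 h'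
      rcases hnb z (h.leP u z e h1 hz (by simp)) with rfl | rfl
      · exact Or.inr hz
      · rw [hz]; exact Or.inl Sym2.eq_swap
  refine ⟨?_, ?_, hE', ?_⟩
  · rw [hT]
    refine WF.close _ a u hwf hau ?_ ?_ fun e he => ?_
    · rw [hV, (h.left a haW).1]
      simp [hau]
    · rw [hV]; exact Or.inr (h.left u hu).1
    · have h1 : e ∈ T.edges := by
        rw [hE']
        simpa using h.inc e u e.2 hu he
      rwa [hT] at h1
  · ext y
    rw [hT, Tree.verts, hV]
    simp only [Finset.mem_filter, Finset.mem_univ, true_and]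
    constructor
    · rintro (h' | h') <;> simp [h']
    · intro h'
      obtain ⟨z, hz⟩ := Sym2.mem_iff_exists.1 h'
      rcases hnb z (h.lvP u z y hz (by simp)) with rfl | rfl
      · exact Or.inr hz
      · rw [hz]; exact Or.inl Sym2.eq_swap
  · rw [hT]
    simp only [Tree.size, Tree.verts, Tree.edges] at hs ⊢
    omega

/-- The tree that replaces the pieces at a vertex `u` with two neighbours `a` and `b`. -/
theorem series_tree (h : Red G m W P t lv le ∅ ∅) {u a b : Fin n} (hu : u ∈ W) (hau : a ≠ u)
    (hbu : b ≠ u) (hab : a ≠ b) (ha : P a u) (hb : P u b)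
    (hnb : ∀ y, P u y → y = u ∨ y = a ∨ y = b) {T : Tree n m}
    (hT : T = ser (ser (t a u) (t u u)) (t u b)) :
    WF G T a b ∧ T.verts = ({y | u ∈ lv y} : Finset (Fin n)) ∧
      T.edges = ({e | (e : ℕ) < m ∧ u ∈ le e} : Finset (Fin m)) ∧
      T.size + 3 ≤ 4 * (T.verts.card + T.edges.card) ∧
      Disjoint (ser (t a u) (t u u)).verts (t u b).verts := by
  obtain ⟨hwf, hV, hE, hs, -⟩ := h.absorb_tree hu hau ha
  have haW := (h.mem a u ha).1
  have n1 : s(a, u) ≠ s(u, b) := by rw [ne_eq, Sym2.eq_iff]; grind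
  have n2 : s(u, u) ≠ s(u, b) := by rw [ne_eq, Sym2.eq_iff]; grind
  have hdV : Disjoint (ser (t a u) (t u u)).verts (t u b).verts := by
    rw [Finset.disjoint_left]
    intro y hy
    rw [hV] at hy
    rw [h.verts u b hb]
    rintro ⟨h1, -⟩
    rw [h1] at hy
    exact hy.elim n1.symm n2.symm
  have hdE : Disjoint (ser (t a u) (t u u)).edges (t u b).edges := by
    rw [Finset.disjoint_left]
    intro e he
    rw [hE] at he
    rw [h.edges u b hb]
    rintro ⟨-, h1, -⟩
    rw [h1] at he
    exact he.2.elim n1.symm n2.symm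
  have hE' : T.edges = ({e | (e : ℕ) < m ∧ u ∈ le e} : Finset (Fin m)) := by
    ext e
    rw [hT, Tree.edges, Finset.mem_union, hE, h.edges u b hb]
    simp only [Finset.mem_filter, Finset.mem_univ, true_and, e.2, Finset.notMem_empty,
      not_false_eq_true, and_true]
    constructor
    · rintro ((h' | h') | h') <;> simp [h']
    · intro h'
      obtain ⟨z, hz⟩ := Sym2.mem_iff_exists.1 h'
      rcases hnb z (h.leP u z e e.2 hz (by simp)) with rfl | rfl | rfl
      · exact Or.inl (Or.inr hz)
      · rw [hz]; exact Or.inl (Or.inl Sym2.eq_swap)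
      · exact Or.inr hz
  refine ⟨?_, ?_, hE', ?_, hdV⟩
  · rw [hT]
    refine WF.ser _ _ a u b hwf (h.wf u b hb) hau hbu.symm hab ?_ ?_ ?_ ?_ (fun e he => ?_) hdV hdE
    · rw [hV, (h.left a haW).1]
      simp [hau]
    · exact h.not_mem_verts hb haW hbu.symm
    · rw [hV]; exact Or.inr (h.left u hu).1
    · exact h.not_mem_verts hb hu hbu.symm
    · have h1 : e ∈ T.edges := by
        rw [hE']
        simpa using h.inc e u e.2 hu he
      rwa [hT] at h1
  · ext y
    rw [hT, Tree.verts, Finset.mem_union, hV, h.verts u b hb]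
    simp only [Finset.mem_filter, Finset.mem_univ, true_and, Finset.notMem_empty,
      not_false_eq_true, and_true]
    constructor
    · rintro ((h' | h') | h') <;> simp [h']
    · intro h'
      obtain ⟨z, hz⟩ := Sym2.mem_iff_exists.1 h'
      rcases hnb z (h.lvP u z y hz (by simp)) with rfl | rfl | rfl
      · exact Or.inl (Or.inr hz)
      · rw [hz]; exact Or.inl (Or.inl Sym2.eq_swap)
      · exact Or.inr hz
  · rw [hT, Tree.size, Tree.verts, Tree.edges, Finset.card_union_of_disjoint hdV,
      Finset.card_union_of_disjoint hdE]
    have := h.size u b hb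
    omega

/-- When a single vertex is left, the piece attached to it is the whole network. -/
theorem final (h : Red G m W P t lv le ∅ ∅) {w : Fin n} (hW : W = {w}) :
    WF G (t w w) w w ∧ (t w w).verts = Finset.univ ∧ (t w w).edges = Finset.univ := by
  subst hW
  have hl := h.refl w (by simp)
  refine ⟨h.wf w w hl, ?_, ?_⟩
  · ext y
    simp only [h.verts w w hl, Finset.notMem_empty, not_false_eq_true, and_true,
      Finset.mem_univ, iff_true]
    induction hy : lv y with
    | _ x z =>
      obtain ⟨h1, h2⟩ := h.mem x z (h.lvP x z y hy (by simp))
      rw [Finset.mem_singleton.1 h1, Finset.mem_singleton.1 h2]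
  · ext e
    simp only [h.edges w w hl, Finset.notMem_empty, not_false_eq_true, and_true,
      Finset.mem_univ, iff_true, e.2, true_and]
    induction hy : le e with
    | _ x z =>
      obtain ⟨h1, h2⟩ := h.mem x z (h.leP x z e e.2 hy (by simp))
      rw [Finset.mem_singleton.1 h1, Finset.mem_singleton.1 h2]

end Red
end SPNet

namespace SPNet

/-! ### Running programs -/

/-- Started in the state `σ`, the program `P` halts after at most `b` operations, in a state that
satisfies `Q`. -/
def Runs (P : Prog) (σ : State) (b : ℕ) (Q : State → Prop) : Prop :=
  ∃ T τ, Exec P σ T τ ∧ T ≤ b ∧ Q τ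

namespace Prog

/-- The arrays of numbers in which a program stores something. -/
def writesN : Prog → List ℕ
  | skip => []
  | setN a _ _ => [a]
  | setC _ _ _ => []
  | seq P Q => P.writesN ++ Q.writesN
  | ite _ P Q => P.writesN ++ Q.writesN
  | loop _ P => P.writesN

/-- The arrays of costs in which a program stores something. -/
def writesC : Prog → List ℕ
  | skip => []
  | setN _ _ _ => []
  | setC a _ _ => [a]
  | seq P Q => P.writesC ++ Q.writesC
  | ite _ P Q => P.writesC ++ Q.writesC
  | loop _ P => P.writesC

/-- Programs without loops. -/
def simple : Prog → Bool
  | skip => true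
  | setN _ _ _ => true
  | setC _ _ _ => true
  | seq P Q => P.simple && Q.simple
  | ite _ P Q => P.simple && Q.simple
  | loop _ _ => false

open Classical in
/-- The effect of a program without loops; loops are ignored. -/
noncomputable def sem : Prog → State → State
  | skip, σ => σ
  | setN a i x, σ => σ.storeN a (i.eval σ) (x.eval σ)
  | setC a i x, σ => σ.storeC a (i.eval σ) (x.eval σ)
  | seq P Q, σ => Q.sem (P.sem σ)
  | ite p P Q, σ => if p.Holds σ then P.sem σ else Q.sem σ
  | loop _ _, σ => σ

/-- An upper bound for the running time of a program without loops. -/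
def cost : Prog → ℕ
  | skip => 1
  | setN _ i x => i.time + x.time + 1
  | setC _ i x => i.time + x.time + 1
  | seq P Q => P.cost + Q.cost
  | ite p P Q => p.time + 1 + (P.cost + Q.cost)
  | loop _ _ => 0

/-- The programs of a list, one after the other. -/
def block : List Prog → Prog
  | [] => skip
  | P :: l => seq P (block l)

end Prog

theorem Exec.nat_eq {P : Prog} {σ τ : State} {T : ℕ} (h : Exec P σ T τ) :
    ∀ a, a ∉ P.writesN → τ.nat a = σ.nat a := by
  induction h with
  | skip => exact fun _ _ => rfl
  | setN σ b i x =>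
    intro a ha
    simp only [Prog.writesN, List.mem_singleton] at ha
    exact Function.update_of_ne ha _ _
  | setC => exact fun _ _ => rfl
  | seq P Q σ τ ρ T₁ T₂ h₁ h₂ ih₁ ih₂ =>
    intro a ha
    simp only [Prog.writesN, List.mem_append, not_or] at ha
    rw [ih₂ a ha.2, ih₁ a ha.1]
  | iteTrue p P Q σ τ T hp h ih =>
    intro a ha
    simp only [Prog.writesN, List.mem_append, not_or] at ha
    exact ih a ha.1
  | iteFalse p P Q σ τ T hp h ih =>
    intro a ha
    simp only [Prog.writesN, List.mem_append, not_or] at ha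
    exact ih a ha.2
  | loopFalse => exact fun _ _ => rfl
  | loopTrue p P σ τ ρ T₁ T₂ hp h₁ h₂ ih₁ ih₂ =>
    intro a ha
    rw [ih₂ a ha, ih₁ a ha]

theorem Exec.cst_eq {P : Prog} {σ τ : State} {T : ℕ} (h : Exec P σ T τ) :
    ∀ a, a ∉ P.writesC → τ.cst a = σ.cst a := by
  induction h with
  | skip => exact fun _ _ => rfl
  | setC σ b i x =>
    intro a ha
    simp only [Prog.writesC, List.mem_singleton] at ha
    exact Function.update_of_ne ha _ _
  | setN => exact fun _ _ => rfl
  | seq P Q σ τ ρ T₁ T₂ h₁ h₂ ih₁ ih₂ =>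
    intro a ha
    simp only [Prog.writesC, List.mem_append, not_or] at ha
    rw [ih₂ a ha.2, ih₁ a ha.1]
  | iteTrue p P Q σ τ T hp h ih =>
    intro a ha
    simp only [Prog.writesC, List.mem_append, not_or] at ha
    exact ih a ha.1
  | iteFalse p P Q σ τ T hp h ih =>
    intro a ha
    simp only [Prog.writesC, List.mem_append, not_or] at ha
    exact ih a ha.2
  | loopFalse => exact fun _ _ => rfl
  | loopTrue p P σ τ ρ T₁ T₂ hp h₁ h₂ ih₁ ih₂ =>
    intro a ha
    rw [ih₂ a ha, ih₁ a ha]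

/-- The states `σ` and `τ` differ at most in arrays in which `P` stores something. -/
structure Frame (P : Prog) (σ τ : State) : Prop where
  nat : ∀ a, a ∉ P.writesN → τ.nat a = σ.nat a
  cst : ∀ a, a ∉ P.writesC → τ.cst a = σ.cst a

namespace Runs

variable {P Q : Prog} {σ : State} {b b₁ b₂ : ℕ} {R R' : State → Prop}

/-- The arrays in which the program does not store anything are unchanged. -/
theorem frame (h : Runs P σ b R) : Runs P σ b fun τ => R τ ∧ Frame P σ τ := by
  obtain ⟨T, τ, h1, h2, h3⟩ := h
  exact ⟨T, τ, h1, h2, h3, h1.nat_eq, h1.cst_eq⟩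

theorem mono (h : Runs P σ b₁ R) (hb : b₁ ≤ b₂) (hR : ∀ τ, R τ → R' τ) : Runs P σ b₂ R' := by
  obtain ⟨T, τ, h1, h2, h3⟩ := h
  exact ⟨T, τ, h1, h2.trans hb, hR τ h3⟩

theorem seq (h : Runs P σ b₁ R) (h' : ∀ τ, R τ → Frame P σ τ → Runs Q τ b₂ R') :
    Runs (.seq P Q) σ (b₁ + b₂) R' := by
  obtain ⟨T, τ, h1, h2, h3, h4⟩ := h.frame
  obtain ⟨T', τ', h1', h2', h3'⟩ := h' τ h3 h4
  exact ⟨T + T', τ', .seq _ _ _ _ _ _ _ h1 h1', by omega, h3'⟩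

theorem ite (p : Test) (h₁ : p.Holds σ → Runs P σ b₁ R) (h₂ : ¬ p.Holds σ → Runs Q σ b₂ R) :
    Runs (.ite p P Q) σ (p.time + 1 + (b₁ + b₂)) R := by
  by_cases hp : p.Holds σ
  · obtain ⟨T, τ, h1, h2, h3⟩ := h₁ hp
    exact ⟨_, τ, .iteTrue _ _ _ _ _ _ hp h1, by omega, h3⟩
  · obtain ⟨T, τ, h1, h2, h3⟩ := h₂ hp
    exact ⟨_, τ, .iteFalse _ _ _ _ _ _ hp h1, by omega, h3⟩

/-- A program without loops runs within its cost and has the effect `sem`. -/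
theorem of_sem (hP : P.simple = true) : ∀ σ, Runs P σ P.cost (fun τ => τ = P.sem σ) := by
  induction P with
  | skip => exact fun σ => ⟨_, _, .skip σ, le_rfl, rfl⟩
  | setN a i x => exact fun σ => ⟨_, _, .setN σ a i x, le_rfl, rfl⟩
  | setC a i x => exact fun σ => ⟨_, _, .setC σ a i x, le_rfl, rfl⟩
  | seq P Q ih₁ ih₂ =>
    simp only [Prog.simple, Bool.and_eq_true] at hP
    intro σ
    refine (ih₁ hP.1 σ).seq fun τ hτ _ => ?_
    subst hτ
    exact ih₂ hP.2 _
  | ite p P Q ih₁ ih₂ =>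
    simp only [Prog.simple, Bool.and_eq_true] at hP
    intro σ
    refine Runs.ite p (fun h => ?_) (fun h => ?_)
    · simpa [Prog.sem, h] using ih₁ hP.1 σ
    · simpa [Prog.sem, h] using ih₂ hP.2 σ
  | loop => simp [Prog.simple] at hP

theorem simple (hP : P.simple = true) (hb : P.cost.ble b = true) (h : R (P.sem σ)) : Runs P σ b R :=
  (of_sem hP σ).mono (Nat.le_of_ble_eq_true hb) fun _ h' => h' ▸ h

/-- A loop whose body makes the number `i` smaller. -/
theorem loop {p : Test} (hpt : p.time.ble 20 = true) (b : ℕ) {c : ℕ} (hc : b + 21 ≤ c)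
    (Inv : ℕ → State → Prop) (hstep : ∀ i σ, Inv i σ → p.Holds σ → Runs P σ b fun τ => ∃ j < i,
      Inv j τ) :
    ∀ i σ, Inv i σ → Runs (.loop p P) σ (i * c + c) fun τ => ∃ j, Inv j τ ∧ ¬ p.Holds τ := by
  have ht := Nat.le_of_ble_eq_true hpt
  intro i
  induction i using Nat.strong_induction_on with
  | _ i ih =>
    intro σ hσ
    by_cases hp : p.Holds σ
    · obtain ⟨T, τ, h1, h2, j, hj, h3⟩ := hstep i σ hσ hp
      obtain ⟨T', τ', h1', h2', h3'⟩ := ih j hj τ h3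
      refine ⟨_, τ', .loopTrue _ _ _ _ _ _ _ hp h1 h1', ?_, h3'⟩
      have : (j + 1) * c ≤ i * c := Nat.mul_le_mul_right _ hj
      rw [Nat.add_mul] at this
      omega
    · exact ⟨_, σ, .loopFalse _ _ _ hp, by omega, i, hσ, hp⟩

/-- A loop whose body is run exactly `N` times. -/
theorem count {p : Test} (hpt : p.time.ble 20 = true) (b : ℕ) {c : ℕ} (hc : b + 21 ≤ c) (N : ℕ)
    (Inv : ℕ → State → Prop) (hp : ∀ i σ, i ≤ N → Inv i σ → (p.Holds σ ↔ i < N))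
    (hstep : ∀ i σ, i < N → Inv i σ → Runs P σ b (Inv (i + 1))) (h0 : Inv 0 σ) :
    Runs (.loop p P) σ (N * c + c) (Inv N) := by
  refine (loop (P := P) (p := p) hpt b hc (fun i σ => i ≤ N ∧ Inv (N - i) σ) ?_ N σ
    ⟨le_rfl, by simpa using h0⟩).mono le_rfl ?_
  · rintro i σ ⟨hi, hσ⟩ h
    have h1 := (hp _ σ (by omega) hσ).1 h
    refine (hstep _ σ h1 hσ).mono le_rfl fun τ hτ => ⟨i - 1, by omega, by omega, ?_⟩
    have : N - i + 1 = N - (i - 1) := by omega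
    rwa [← this]
  · rintro τ ⟨i, ⟨hi, hτ⟩, h⟩
    rw [hp _ τ (by omega) hτ] at h
    have : N - i = N := by omega
    rwa [this] at hτ

end Runs

theorem Frame.sem {P : Prog} (hP : P.simple = true) (σ : State) : Frame P σ (P.sem σ) := by
  obtain ⟨_, _, -, -, rfl, h⟩ := (Runs.of_sem hP σ).frame
  exact h

/-! ### Notation for programs -/

/-- Numerals are literals, `+` is addition, and `-` is truncated subtraction. -/
instance (k : ℕ) : OfNat NExpr k := ⟨.lit k⟩
instance : Add NExpr := ⟨.add⟩
instance : Sub NExpr := ⟨.monus⟩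

/-- The entry with index `0` of the array `a`, which serves as a register. -/
def reg (a : ℕ) : NExpr := .get a (.lit 0)

/-- Assign `x` to the register `a`. -/
def setR (a : ℕ) (x : NExpr) : Prog := .setN a (.lit 0) x

@[simp] theorem eval_ofNat (σ : State) (k : ℕ) : (no_index (OfNat.ofNat k) : NExpr).eval σ = k :=
  rfl
@[simp] theorem eval_add (σ : State) (x y : NExpr) : (x + y).eval σ = x.eval σ + y.eval σ := rfl
@[simp] theorem eval_sub (σ : State) (x y : NExpr) : (x - y).eval σ = x.eval σ - y.eval σ := rfl
@[simp] theorem eval_reg (σ : State) (a : ℕ) : (reg a).eval σ = σ.nat a 0 := rfl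
@[simp] theorem eval_get (σ : State) (a : ℕ) (i : NExpr) :
    (NExpr.get a i).eval σ = σ.nat a (i.eval σ) := rfl

@[simp] theorem storeN_nat (σ : State) (a i k b : ℕ) :
    (σ.storeN a i k).nat b = if b = a then Function.update (σ.nat a) i k else σ.nat b := by
  by_cases h : b = a
  · subst h; simp [State.storeN]
  · simp [State.storeN, h]

@[simp] theorem storeN_cst (σ : State) (a i k : ℕ) : (σ.storeN a i k).cst = σ.cst := rfl
@[simp] theorem storeC_nat (σ : State) (a i : ℕ) (c : ℝ≥0) : (σ.storeC a i c).nat = σ.nat := rfl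

@[simp] theorem storeC_cst (σ : State) (a i : ℕ) (c : ℝ≥0) (b : ℕ) :
    (σ.storeC a i c).cst b = if b = a then Function.update (σ.cst a) i c else σ.cst b := by
  by_cases h : b = a
  · subst h; simp [State.storeC]
  · simp [State.storeC, h]

@[simp] theorem sem_setR (a : ℕ) (x : NExpr) (σ : State) :
    (setR a x).sem σ = σ.storeN a 0 (x.eval σ) := rfl
@[simp] theorem sem_setN (a : ℕ) (i x : NExpr) (σ : State) :
    (Prog.setN a i x).sem σ = σ.storeN a (i.eval σ) (x.eval σ) := rfl
@[simp] theorem sem_setC (a : ℕ) (i : NExpr) (x : CExpr) (σ : State) :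
    (Prog.setC a i x).sem σ = σ.storeC a (i.eval σ) (x.eval σ) := rfl
@[simp] theorem sem_block_nil (σ : State) : (Prog.block []).sem σ = σ := rfl
@[simp] theorem sem_block_cons (P : Prog) (l : List Prog) (σ : State) :
    (Prog.block (P :: l)).sem σ = (Prog.block l).sem (P.sem σ) := rfl

end SPNet

namespace SPNet

/-! ### The memory layout -/

/- Arrays of numbers: the first six are the input and the output. The registers are arrays of which
only the entry with index `0` is used. -/
notation "aPar" => (0 : ℕ)
notation "aSrc" => (1 : ℕ)
notation "aTgt" => (2 : ℕ)
notation "aCap" => (3 : ℕ)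
notation "aOut" => (4 : ℕ)
notation "aAns" => (5 : ℕ)
notation "aMul" => (10 : ℕ)
notation "aSq" => (11 : ℕ)
notation "aRoot" => (12 : ℕ)
notation "aHalf" => (13 : ℕ)
notation "aMat" => (14 : ℕ)
notation "aDeg" => (15 : ℕ)
notation "aSum" => (16 : ℕ)
notation "aSqs" => (17 : ℕ)
notation "aLeft" => (18 : ℕ)
notation "aStk" => (19 : ℕ)
notation "aTy" => (20 : ℕ)
notation "aC1" => (21 : ℕ)
notation "aC2" => (22 : ℕ)
notation "aSg" => (23 : ℕ)
notation "rI" => (30 : ℕ)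
notation "rK" => (31 : ℕ)
notation "rSp" => (32 : ℕ)
notation "rU" => (33 : ℕ)
notation "rA" => (34 : ℕ)
notation "rB" => (35 : ℕ)
notation "rD" => (36 : ℕ)

open NExpr (get)
open Prog (setN setC ite block seq)

/-- The entry of the matrix with the row `a` and the column `b`. -/
def matIdx (a b : ℕ) : NExpr := get aMul (reg a) + reg b

/-- Append a node to the list of the nodes. -/
def emit (ty c₁ c₂ sg : NExpr) : Prog :=
  block [setN aTy (reg rK) ty, setN aC1 (reg rK) c₁, setN aC2 (reg rK) c₂, setN aSg (reg rK) sg,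
    setR rK (reg rK + 1)]

/-- Fill the tables of multiples of `n`, of squares, of square roots, and of halves, up to `2 * n`.
Each square is obtained from the preceding one by additions. -/
def initTables : Prog :=
  seq (setR rI 0) (.loop (.lt (reg rI) (get aPar 0 + get aPar 0)) (block
    [setN aSq (reg rI + 1) (get aSq (reg rI) + reg rI + reg rI + 1),
     setN aRoot (get aSq (reg rI)) (reg rI),
     setN aHalf (reg rI + reg rI) (reg rI),
     setN aMul (reg rI + 1) (get aMul (reg rI) + get aPar 0),
     setR rI (reg rI + 1)]))

/-- Start with the vertices, each of which is a node with its supply, and put all of them on the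
stack. -/
def initVerts : Prog :=
  block [setR rI 0, .loop (.lt (reg rI) (get aPar 0)) (block
    [setN aSg (reg rI) 1,
     setN aMat (get aMul (reg rI) + reg rI) (reg rI + 1),
     setN aLeft (reg rI) 1,
     setN aStk (reg rI) (reg rI),
     setR rI (reg rI + 1)]),
    block [setN aSg (get aPar 2) 2, setN aSg (get aPar 3) 0, setR rK (get aPar 0),
      setR rSp (get aPar 0)]]

/-- Register `b` as a new neighbour of `a`. -/
def link (a b : ℕ) : Prog :=
  block [setN aDeg (reg a) (get aDeg (reg a) + 1), setN aSum (reg a) (get aSum (reg a) + reg b),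
    setN aSqs (reg a) (get aSqs (reg a) + get aSq (reg b))]

/-- Remove `b` from the neighbours of `a`. -/
def unlink (a b : ℕ) : Prog :=
  block [setN aDeg (reg a) (get aDeg (reg a) - 1), setN aSum (reg a) (get aSum (reg a) - reg b),
    setN aSqs (reg a) (get aSqs (reg a) - get aSq (reg b))]

/-- Add the piece between the vertices in the registers `rA` and `rB` that is given by the last but
one node; the last node is its reversal. -/
def addPiece : Prog :=
  ite (.eq (get aMat (matIdx rA rB)) 0)
    (block [setN aMat (matIdx rA rB) (reg rK - 1), setN aMat (matIdx rB rA) (reg rK),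
      link rA rB, link rB rA])
    (block [emit 4 (get aMat (matIdx rA rB) - 1) (reg rK - 2)
        (get aSg (get aMat (matIdx rA rB) - 1) + get aSg (reg rK - 2) - 1),
      emit 2 (reg rK - 1) 0 (get aSg (reg rK - 1)),
      setN aMat (matIdx rA rB) (reg rK - 1), setN aMat (matIdx rB rA) (reg rK)])

/-- Append the nodes for the edge in `rI` and for its reversal. -/
def addEdge : Prog :=
  block [setR rA (get aSrc (reg rI)), setR rB (get aTgt (reg rI)),
    emit 1 (reg rI) 0 1, emit 2 (reg rK - 1) 0 1]

/-- Read all edges, so that parallel edges are combined. -/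
def addEdges : Prog :=
  seq (setR rI 0) (.loop (.lt (reg rI) (get aPar 1))
    (block [addEdge, addPiece, setR rI (reg rI + 1)]))

/-- Put the vertex in the register `a` on the stack. -/
def push (a : ℕ) : Prog := block [setN aStk (reg rSp) (reg a), setR rSp (reg rSp + 1)]

/-- Eliminate the vertex in `rU`, if it has a single neighbour. -/
def elimOne : Prog :=
  block [setR rA (get aSum (reg rU)), setN aLeft (reg rU) 0,
    emit 3 (get aMat (matIdx rA rU) - 1) (get aMat (matIdx rU rU) - 1)
      (get aSg (get aMat (matIdx rA rU) - 1) + get aSg (get aMat (matIdx rU rU) - 1) - 1),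
    emit 5 (reg rK - 1) 0 (get aSg (reg rK - 1)),
    emit 4 (get aMat (matIdx rA rA) - 1) (reg rK - 1)
      (get aSg (get aMat (matIdx rA rA) - 1) + get aSg (reg rK - 1) - 1),
    setN aMat (matIdx rA rA) (reg rK), unlink rA rU, push rA]

/-- The nodes for the elimination of a vertex with two neighbours. -/
def elimTwoNodes : Prog :=
  block [emit 3 (get aMat (matIdx rA rU) - 1) (get aMat (matIdx rU rU) - 1)
      (get aSg (get aMat (matIdx rA rU) - 1) + get aSg (get aMat (matIdx rU rU) - 1) - 1),
    emit 3 (reg rK - 1) (get aMat (matIdx rU rB) - 1)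
      (get aSg (reg rK - 1) + get aSg (get aMat (matIdx rU rB) - 1) - 1),
    emit 2 (reg rK - 1) 0 (get aSg (reg rK - 1))]

/-- Remove the vertex in `rU` with two neighbours. The difference of the neighbours `a` and `b` is
the square root of `2 * (a ^ 2 + b ^ 2) - (a + b) ^ 2`. -/
def cutTwo : Prog :=
  block [setR rD (get aRoot (get aSqs (reg rU) + get aSqs (reg rU) - get aSq (get aSum (reg rU)))),
    setR rA (get aHalf (get aSum (reg rU) + reg rD)), setR rB (get aSum (reg rU) - reg rA),
    setN aLeft (reg rU) 0, elimTwoNodes, unlink rA rU, unlink rB rU]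

/-- Eliminate the vertex in `rU`, if it has two neighbours. -/
def elimTwo : Prog := block [cutTwo, addPiece, push rA, push rB]

/-- Eliminate vertices until the stack is empty. A vertex whose number of neighbours changes is put
on the stack again; vertices that are no longer there, or that have more than two neighbours, are
skipped. -/
def elimAll : Prog :=
  .loop (.lt 0 (reg rSp)) (block [setR rSp (reg rSp - 1), setR rU (get aStk (reg rSp)),
    ite (.eq (get aLeft (reg rU)) 1)
      (ite (.eq (get aDeg (reg rU)) 1) elimOne (ite (.eq (get aDeg (reg rU)) 2) elimTwo .skip))
      .skip])

/-- Reduce the network to the single vertex in `rA`. The register starts with a vertex, for the case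
that none is eliminated. -/
def reduce : Prog := block [initTables, initVerts, addEdges, setR rA 0, elimAll]

/-! ### Nodes -/

/-- The arrays that describe the nodes of a tree: the type, the children, and one more than the
supply. -/
structure Nodes where
  ty : ℕ → ℕ
  c₁ : ℕ → ℕ
  c₂ : ℕ → ℕ
  sg : ℕ → ℕ

namespace Nodes

/-- The nodes that are stored in the memory. -/
def of (σ : State) : Nodes := ⟨σ.nat aTy, σ.nat aC1, σ.nat aC2, σ.nat aSg⟩

/-- Write the node `k`. -/
def emit (N : Nodes) (k a b c d : ℕ) : Nodes :=
  ⟨Function.update N.ty k a, Function.update N.c₁ k b, Function.update N.c₂ k c,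
    Function.update N.sg k d⟩

end Nodes

/-- The node `k` is the root of the tree `T`. -/
def Rep {n m : ℕ} (G : Network n m) (N : Nodes) : Tree n m → ℕ → Prop
  | .nil u, k => N.ty k = 0 ∧ (N.sg k : ℤ) = G.supply {u} + 1
  | .edge e, k => N.ty k = 1 ∧ N.c₁ k = e ∧ N.sg k = 1
  | .rev T, k => N.ty k = 2 ∧ N.c₁ k < k ∧ Rep G N T (N.c₁ k) ∧
      (N.sg k : ℤ) = G.supply T.verts + 1
  | .ser T₁ T₂, k => N.ty k = 3 ∧ N.c₁ k < k ∧ N.c₂ k < k ∧ Rep G N T₁ (N.c₁ k) ∧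
      Rep G N T₂ (N.c₂ k) ∧ (N.sg k : ℤ) = G.supply (T₁.verts ∪ T₂.verts) + 1
  | .par T₁ T₂, k => N.ty k = 4 ∧ N.c₁ k < k ∧ N.c₂ k < k ∧ Rep G N T₁ (N.c₁ k) ∧
      Rep G N T₂ (N.c₂ k) ∧ (N.sg k : ℤ) = G.supply (T₁.verts ∪ T₂.verts) + 1
  | .close T, k => N.ty k = 5 ∧ N.c₁ k < k ∧ Rep G N T (N.c₁ k) ∧
      (N.sg k : ℤ) = G.supply T.verts + 1

namespace Rep

variable {n m : ℕ} {G : Network n m} {N N' : Nodes} {T T₁ T₂ : Tree n m} {k K : ℕ}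

theorem sg (h : Rep G N T k) : (N.sg k : ℤ) = G.supply T.verts + 1 := by
  cases T <;> simp only [Rep] at h
  · exact h.2
  · simp [Tree.verts, Network.supply, h.2.2]
  · exact h.2.2.2
  · exact h.2.2.2.2.2
  · exact h.2.2.2.2.2
  · exact h.2.2.2

theorem congr (hk : Rep G N T k) (h : ∀ j ≤ k, N'.ty j = N.ty j ∧ N'.c₁ j = N.c₁ j ∧
    N'.c₂ j = N.c₂ j ∧ N'.sg j = N.sg j) : Rep G N' T k := by
  induction T generalizing k with
  | nil u => simpa only [Rep, h k le_rfl] using hk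
  | edge e => simpa only [Rep, h k le_rfl] using hk
  | rev T ih =>
    simp only [Rep, h k le_rfl] at hk ⊢
    exact ⟨hk.1, hk.2.1, ih hk.2.2.1 fun j hj => h j (by omega), hk.2.2.2⟩
  | ser T₁ T₂ ih₁ ih₂ =>
    simp only [Rep, h k le_rfl] at hk ⊢
    exact ⟨hk.1, hk.2.1, hk.2.2.1, ih₁ hk.2.2.2.1 fun j hj => h j (by omega),
      ih₂ hk.2.2.2.2.1 fun j hj => h j (by omega), hk.2.2.2.2.2⟩
  | par T₁ T₂ ih₁ ih₂ =>
    simp only [Rep, h k le_rfl] at hk ⊢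
    exact ⟨hk.1, hk.2.1, hk.2.2.1, ih₁ hk.2.2.2.1 fun j hj => h j (by omega),
      ih₂ hk.2.2.2.2.1 fun j hj => h j (by omega), hk.2.2.2.2.2⟩
  | close T ih =>
    simp only [Rep, h k le_rfl] at hk ⊢
    exact ⟨hk.1, hk.2.1, ih hk.2.2.1 fun j hj => h j (by omega), hk.2.2.2⟩

/-- Writing a new node does not affect the trees whose nodes are already there. -/
theorem emit (h : Rep G N T k) (hk : k < K) (a b c d : ℕ) : Rep G (N.emit K a b c d) T k :=
  h.congr fun j hj => by
    have : j ≠ K := by omega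
    simp [Nodes.emit, this]

theorem emit_edge (e : Fin m) (c : ℕ) : Rep G (N.emit K 1 e c 1) (.edge e) K := by
  simp [Rep, Nodes.emit]

theorem emit_rev (h : Rep G N T k) (hk : k < K) (c : ℕ) :
    Rep G (N.emit K 2 k c (N.sg k)) (.rev T) K := by
  refine ⟨by simp [Nodes.emit], by simpa [Nodes.emit] using hk, ?_, ?_⟩
  · have := h.emit hk 2 k c (N.sg k)
    simpa [Nodes.emit] using this
  · simpa [Nodes.emit] using h.sg

theorem emit_close (h : Rep G N T k) (hk : k < K) (c : ℕ) :
    Rep G (N.emit K 5 k c (N.sg k)) (.close T) K := by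
  refine ⟨by simp [Nodes.emit], by simpa [Nodes.emit] using hk, ?_, ?_⟩
  · have := h.emit hk 5 k c (N.sg k)
    simpa [Nodes.emit] using this
  · simpa [Nodes.emit] using h.sg

theorem sg_union (h₁ : Rep G N T₁ k) {l : ℕ} (h₂ : Rep G N T₂ l)
    (hd : Disjoint T₁.verts T₂.verts) :
    ((N.sg k + N.sg l - 1 : ℕ) : ℤ) = G.supply (T₁.verts ∪ T₂.verts) + 1 := by
  have e₁ := h₁.sg
  have e₂ := h₂.sg
  have b₁ := G.supply_bounds T₁.verts
  have b₂ := G.supply_bounds T₂.verts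
  have b₃ := G.supply_bounds (T₁.verts ∪ T₂.verts)
  rw [Tree.supply_union hd] at b₃ ⊢
  omega

theorem emit_ser (h₁ : Rep G N T₁ k) (hk : k < K) {l : ℕ} (h₂ : Rep G N T₂ l) (hl : l < K)
    (hd : Disjoint T₁.verts T₂.verts) :
    Rep G (N.emit K 3 k l (N.sg k + N.sg l - 1)) (.ser T₁ T₂) K := by
  refine ⟨by simp [Nodes.emit], by simpa [Nodes.emit] using hk, by simpa [Nodes.emit] using hl,
    ?_, ?_, ?_⟩
  · have := h₁.emit hk 3 k l (N.sg k + N.sg l - 1)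
    simpa [Nodes.emit] using this
  · have := h₂.emit hl 3 k l (N.sg k + N.sg l - 1)
    simpa [Nodes.emit] using this
  · simpa [Nodes.emit] using h₁.sg_union h₂ hd

theorem emit_par (h₁ : Rep G N T₁ k) (hk : k < K) {l : ℕ} (h₂ : Rep G N T₂ l) (hl : l < K)
    (hd : Disjoint T₁.verts T₂.verts) :
    Rep G (N.emit K 4 k l (N.sg k + N.sg l - 1)) (.par T₁ T₂) K := by
  refine ⟨by simp [Nodes.emit], by simpa [Nodes.emit] using hk, by simpa [Nodes.emit] using hl,
    ?_, ?_, ?_⟩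
  · have := h₁.emit hk 4 k l (N.sg k + N.sg l - 1)
    simpa [Nodes.emit] using this
  · have := h₂.emit hl 4 k l (N.sg k + N.sg l - 1)
    simpa [Nodes.emit] using this
  · simpa [Nodes.emit] using h₁.sg_union h₂ hd

end Rep

theorem eval_matIdx (σ : State) (a b : ℕ) :
    (matIdx a b).eval σ = σ.nat aMul (σ.nat a 0) + σ.nat b 0 := rfl

end SPNet

namespace SPNet

open NExpr (get)
open Prog (setN setC ite block seq)

/-! ### The input and the auxiliary tables -/

/-- The memory `σ` still holds the input. -/
structure Env {n m : ℕ} (G : Network n m) (D : ℕ) (B : ℝ≥0) (σ : State) : Prop where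
  nat : ∀ a < 4, σ.nat a = (input G D B).nat a
  cst : ∀ a < 2, σ.cst a = (input G D B).cst a

namespace Env

variable {n m : ℕ} {G : Network n m} {D : ℕ} {B : ℝ≥0} {σ τ : State}

/-- A program that stores nothing in the arrays of the input preserves the input. -/
theorem frame (h : Env G D B σ) {P : Prog} (hf : Frame P σ τ)
    (hN : P.writesN.all (4 ≤ ·) = true) (hC : P.writesC.all (2 ≤ ·) = true) : Env G D B τ where
  nat a ha := by
    rw [hf.nat a, h.nat a ha]
    intro h'
    have := List.all_eq_true.1 hN a h'
    simp at this
    omega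
  cst a ha := by
    rw [hf.cst a, h.cst a ha]
    intro h'
    have := List.all_eq_true.1 hC a h'
    simp at this
    omega

theorem n_eq (h : Env G D B σ) : σ.nat aPar 0 = n := by
  rw [h.nat 0 (by norm_num)]; simp [input, arrayOf]

theorem m_eq (h : Env G D B σ) : σ.nat aPar 1 = m := by
  rw [h.nat 0 (by norm_num)]; simp [input, arrayOf]

theorem s_eq (h : Env G D B σ) : σ.nat aPar 2 = G.s := by
  rw [h.nat 0 (by norm_num)]; simp [input, arrayOf]

theorem t_eq (h : Env G D B σ) : σ.nat aPar 3 = G.t := by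
  rw [h.nat 0 (by norm_num)]; simp [input, arrayOf]

theorem D_eq (h : Env G D B σ) : σ.nat aPar 4 = D := by
  rw [h.nat 0 (by norm_num)]; simp [input, arrayOf]

theorem src_eq (h : Env G D B σ) (e : Fin m) : σ.nat aSrc e = G.src e := by
  rw [h.nat 1 (by norm_num)]; simp [input, arrayOf]

theorem tgt_eq (h : Env G D B σ) (e : Fin m) : σ.nat aTgt e = G.tgt e := by
  rw [h.nat 2 (by norm_num)]; simp [input, arrayOf]

theorem cap_eq (h : Env G D B σ) (e : Fin m) : σ.nat aCap e = G.cap e := by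
  rw [h.nat 3 (by norm_num)]; simp [input, arrayOf]

theorem cost_eq (h : Env G D B σ) (e : Fin m) : σ.cst 0 e = G.cost e := by
  rw [h.cst 0 (by norm_num)]; simp [input, arrayOf]

theorem B_eq (h : Env G D B σ) : σ.cst 1 0 = B := by
  rw [h.cst 1 (by norm_num)]; simp [input, arrayOf]

end Env

/-- The tables of products with `n`, of squares, of square roots, and of halves. -/
structure Tables (n : ℕ) (σ : State) : Prop where
  mul : ∀ i ≤ 2 * n, σ.nat aMul i = i * n
  sq : ∀ i ≤ 2 * n, σ.nat aSq i = i * i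
  root : ∀ i < 2 * n, σ.nat aRoot (i * i) = i
  half : ∀ i < 2 * n, σ.nat aHalf (i + i) = i

theorem Tables.frame {n : ℕ} {σ τ : State} (h : Tables n σ) {P : Prog} (hf : Frame P σ τ)
    (hN : P.writesN.all (14 ≤ ·) = true) : Tables n τ := by
  have key : ∀ a < 14, τ.nat a = σ.nat a := fun a ha => hf.nat a fun h' => by
    have := List.all_eq_true.1 hN a h'
    simp at this
    omega
  constructor
  · rw [key _ (by norm_num)]; exact h.mul
  · rw [key _ (by norm_num)]; exact h.sq
  · rw [key _ (by norm_num)]; exact h.root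
  · rw [key _ (by norm_num)]; exact h.half

/-! ### The representation of the current graph -/

open Classical in
/-- The neighbours of `u` among the vertices of `W`. -/
noncomputable def nbrs {n : ℕ} (W : Finset (Fin n)) (P : Fin n → Fin n → Prop) (u : Fin n) :
    Finset (Fin n) := {y ∈ W | y ≠ u ∧ P u y}

theorem mem_nbrs {n : ℕ} {W : Finset (Fin n)} {P : Fin n → Fin n → Prop} {u y : Fin n} :
    y ∈ nbrs W P u ↔ y ∈ W ∧ y ≠ u ∧ P u y := by
  simp [nbrs]

/-- The array `A` contains, for each vertex, the sum of the values of `f` at its neighbours. -/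
def NbrSum {n : ℕ} (W : Finset (Fin n)) (P : Fin n → Fin n → Prop) (f : ℕ → ℕ) (A : ℕ → ℕ) : Prop :=
  ∀ u ∈ W, A u = ∑ y ∈ nbrs W P u, f y

namespace NbrSum

variable {n : ℕ} {W : Finset (Fin n)} {P P' : Fin n → Fin n → Prop} {f A A' : ℕ → ℕ}

/-- Two vertices `a` and `b` become neighbours. -/
theorem link (h : NbrSum W P f A) {a b : Fin n} (ha : a ∈ W) (hb : b ∈ W) (hab : a ≠ b)
    (hP : ¬ P a b) (hP₂ : ¬ P b a) (hP' : ∀ x y, P' x y ↔ P x y ∨ s(x, y) = s(a, b))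
    (h₁ : A' a = A a + f b) (h₂ : A' b = A b + f a)
    (h₃ : ∀ x, x ≠ (a : ℕ) → x ≠ b → A' x = A x) : NbrSum W P' f A' := by
  intro u hu
  by_cases hua : u = a
  · subst hua
    have : nbrs W P' u = insert b (nbrs W P u) := by
      ext y; simp only [mem_nbrs, hP', Sym2.eq_iff, Finset.mem_insert]; grind
    rw [this, Finset.sum_insert (by simp [mem_nbrs, hP]), h₁, h u hu, add_comm]
  by_cases hub : u = b
  · subst hub
    have : nbrs W P' u = insert a (nbrs W P u) := by
      ext y; simp only [mem_nbrs, hP', Sym2.eq_iff, Finset.mem_insert]; grind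
    rw [this, Finset.sum_insert (by simp [mem_nbrs, hP₂]), h₂, h u hu, add_comm]
  · have : nbrs W P' u = nbrs W P u := by
      ext y; simp only [mem_nbrs, hP', Sym2.eq_iff]; grind
    rw [this, h₃ u (by omega) (by omega), h u hu]

/-- The vertex `u` is removed from the neighbours of its neighbours. -/
theorem remove (h : NbrSum W P f A) {u : Fin n} (hP : ∀ x y, P x y → P y x) (hu : u ∈ W)
    (h₁ : ∀ x ∈ nbrs W P u, A' x = A x - f u)
    (h₂ : ∀ x ∈ W, x ≠ u → x ∉ nbrs W P u → A' x = A x) :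
    NbrSum (W.erase u) (fun x y => P x y ∧ x ≠ u ∧ y ≠ u) f A' := by
  intro x hx
  rw [Finset.mem_erase] at hx
  have e : nbrs (W.erase u) (fun x y => P x y ∧ x ≠ u ∧ y ≠ u) x = (nbrs W P x).erase u := by
    ext y; simp only [mem_nbrs, Finset.mem_erase]; grind
  rw [e]
  by_cases hxu : x ∈ nbrs W P u
  · have : u ∈ nbrs W P x := by
      rw [mem_nbrs] at hxu ⊢
      exact ⟨hu, hx.1.symm, hP _ _ hxu.2.2⟩
    have h3 := Finset.add_sum_erase (nbrs W P x) (fun y : Fin n => f y) this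
    rw [h₁ x hxu, h x hx.2]
    omega
  · rw [h₂ x hx.2 hx.1 hxu, h x hx.2, Finset.erase_eq_of_notMem]
    rw [mem_nbrs] at hxu ⊢
    exact fun h3 => hxu ⟨hx.2, hx.1, hP _ _ h3.2.2⟩

end NbrSum

theorem index_inj {n : ℕ} {a b c d : Fin n} (h : (a : ℕ) * n + b = c * n + d) : a = c ∧ b = d := by
  have hn : 0 < n := Fin.pos a
  have h1 : ((a : ℕ) * n + b) / n = (c * n + d) / n := by rw [h]
  have h2 : ((a : ℕ) * n + b) % n = (c * n + d) % n := by rw [h]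
  rw [mul_comm, Nat.mul_add_div hn, Nat.div_eq_of_lt b.2, mul_comm, Nat.mul_add_div hn,
    Nat.div_eq_of_lt d.2] at h1
  rw [mul_comm, Nat.mul_add_mod, Nat.mod_eq_of_lt b.2, mul_comm, Nat.mul_add_mod,
    Nat.mod_eq_of_lt d.2] at h2
  exact ⟨Fin.ext (by omega), Fin.ext h2⟩

/-- The matrix `M` contains the roots of the trees of the pieces; all roots are less than `K`. -/
structure Mat {n m : ℕ} (G : Network n m) (W : Finset (Fin n)) (P : Fin n → Fin n → Prop)
    (t : Fin n → Fin n → Tree n m) (N : Nodes) (K : ℕ) (M : ℕ → ℕ) : Prop where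
  piece : ∀ a ∈ W, ∀ b ∈ W, P a b → M (a * n + b) ≠ 0 ∧ M (a * n + b) - 1 < K ∧
    Rep G N (t a b) (M (a * n + b) - 1)
  none : ∀ a ∈ W, ∀ b ∈ W, ¬ P a b → M (a * n + b) = 0

namespace Mat

variable {n m : ℕ} {G : Network n m} {W : Finset (Fin n)} {P P' : Fin n → Fin n → Prop}
  {t t' : Fin n → Fin n → Tree n m} {N : Nodes} {K : ℕ} {M M' : ℕ → ℕ}

theorem emit (h : Mat G W P t N K M) (a b c d : ℕ) : Mat G W P t (N.emit K a b c d) (K + 1) M where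
  piece x hx y hy hP := by
    obtain ⟨h1, h2, h3⟩ := h.piece x hx y hy hP
    exact ⟨h1, by omega, h3.emit h2 a b c d⟩
  none := h.none

/-- The trees of the two entries for the pair `a`, `b` are replaced by `T` and its reversal. -/
theorem set (h : Mat G W P t N K M) {a b : Fin n} {T : Tree n m} {k l : ℕ}
    (hk : k < K) (hT : Rep G N T k) (hl : l < K) (hT' : Rep G N (.rev T) l) (hab : a ≠ b)
    (hP' : ∀ x y, P' x y ↔ P x y ∨ s(x, y) = s(a, b))
    (ht : t' a b = T) (ht₂ : t' b a = .rev T) (ht₃ : ∀ x y, s(x, y) ≠ s(a, b) → t' x y = t x y)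
    (h₁ : M' (a * n + b) = k + 1) (h₂ : M' (b * n + a) = l + 1)
    (h₃ : ∀ i, i ≠ a * n + b → i ≠ b * n + a → M' i = M i) : Mat G W P' t' N K M' := by
  have key : ∀ x y, s(x, y) ≠ s(a, b) → M' (x * n + y) = M (x * n + y) := fun x y hxy =>
    h₃ _ (fun h' => hxy (by obtain ⟨rfl, rfl⟩ := index_inj h'; rfl))
      (fun h' => hxy (by obtain ⟨rfl, rfl⟩ := index_inj h'; exact Sym2.eq_swap))
  constructor
  · intro x hx y hy hxy
    by_cases hs : s(x, y) = s(a, b)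
    · rcases Sym2.eq_iff.1 hs with ⟨rfl, rfl⟩ | ⟨rfl, rfl⟩
      · rw [h₁, ht]; exact ⟨by omega, by simpa using hk, by simpa using hT⟩
      · rw [h₂, ht₂]; exact ⟨by omega, by simpa using hl, by simpa using hT'⟩
    · rw [key x y hs, ht₃ x y hs]
      exact h.piece x hx y hy (((hP' x y).1 hxy).resolve_right hs)
  · intro x hx y hy hxy
    rw [hP', not_or] at hxy
    rw [key x y hxy.2]
    exact h.none x hx y hy hxy.1

/-- The tree of the piece that is attached at `a` is replaced. -/
theorem set_loop (h : Mat G W P t N K M) {a : Fin n} {T : Tree n m} {k : ℕ}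
    (hk : k < K) (hT : Rep G N T k) (hP : P a a)
    (ht : t' a a = T) (ht₃ : ∀ x y, s(x, y) ≠ s(a, a) → t' x y = t x y)
    (h₁ : M' (a * n + a) = k + 1)
    (h₃ : ∀ i, i ≠ a * n + a → M' i = M i) : Mat G W P t' N K M' := by
  have key : ∀ x y, s(x, y) ≠ s(a, a) → M' (x * n + y) = M (x * n + y) := fun x y hxy =>
    h₃ _ (fun h' => hxy (by obtain ⟨rfl, rfl⟩ := index_inj h'; rfl))
  have hs : ∀ x y, ¬ s(x, y) = s(a, a) ∨ (x = a ∧ y = a) := fun x y => by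
    rw [Sym2.eq_iff]; tauto
  constructor
  · intro x hx y hy hxy
    rcases hs x y with hs | ⟨rfl, rfl⟩
    · rw [key x y hs, ht₃ x y hs]
      exact h.piece x hx y hy hxy
    · rw [h₁, ht]; exact ⟨by omega, by simpa using hk, by simpa using hT⟩
  · intro x hx y hy hxy
    rcases hs x y with hs | ⟨rfl, rfl⟩
    · rw [key x y hs]
      exact h.none x hx y hy hxy
    · exact absurd hP hxy

theorem remove (h : Mat G W P t N K M) (u : Fin n) :
    Mat G (W.erase u) (fun x y => P x y ∧ x ≠ u ∧ y ≠ u) t N K M where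
  piece x hx y hy hP := h.piece x (Finset.mem_of_mem_erase hx) y (Finset.mem_of_mem_erase hy) hP.1
  none x hx y hy hP := by
    rw [Finset.mem_erase] at hx hy
    exact h.none x hx.2 y hy.2 fun h' => hP ⟨h', hx.1, hy.1⟩

end Mat

/-- The memory `σ` describes the graph with the vertices `W` and the pieces `t a b`, for `P a b`. -/
structure Graph {n m : ℕ} (G : Network n m) (W : Finset (Fin n)) (P : Fin n → Fin n → Prop)
    (t : Fin n → Fin n → Tree n m) (σ : State) : Prop where
  mat : Mat G W P t (Nodes.of σ) (σ.nat rK 0) (σ.nat aMat)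
  deg : NbrSum W P (fun _ => 1) (σ.nat aDeg)
  sum : NbrSum W P (fun y => y) (σ.nat aSum)
  sqs : NbrSum W P (fun y => y * y) (σ.nat aSqs)
  left : ∀ u, σ.nat aLeft u = 1 ↔ ∃ x ∈ W, (x : ℕ) = u

section addPiece

variable {n m : ℕ} {G : Network n m} {W : Finset (Fin n)} {P : Fin n → Fin n → Prop}
  {t : Fin n → Fin n → Tree n m} {σ : State}

/-- Adding a piece `T` between `a` and `b`, where the nodes `K` and `K + 1` describe it and its
reversal: the new tree `N` is `T`, or a parallel composition if there is a piece between `a` and `b`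
already. -/
theorem addPiece_spec (hT : Tables n σ) (h : Graph G W P t σ) {a b : Fin n} (ha : a ∈ W)
    (hb : b ∈ W) (hab : a ≠ b) (hA : σ.nat rA 0 = a) (hB : σ.nat rB 0 = b)
    (hsymm : ∀ x y, P x y → P y x) {T : Tree n m} {K : ℕ} (hK : σ.nat rK 0 = K + 2)
    (hR : Rep G (Nodes.of σ) T K) (hR' : Rep G (Nodes.of σ) (.rev T) (K + 1))
    (hd : P a b → Disjoint (t a b).verts T.verts) :
    ∃ N t', ((P a b ∧ N = .par (t a b) T) ∨ (¬ P a b ∧ N = T)) ∧ t' a b = N ∧ t' b a = .rev N ∧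
      (∀ x y, s(x, y) ≠ s(a, b) → t' x y = t x y) ∧
      Graph G W (fun x y => P x y ∨ s(x, y) = s(a, b)) t' (addPiece.sem σ) ∧
      (addPiece.sem σ).nat rK 0 ≤ K + 4 := by
  have hab' : (a : ℕ) ≠ b := fun h' => hab (Fin.ext h')
  have hne : (a : ℕ) * n + b ≠ b * n + a := fun h' => hab (index_inj h').1
  have hma := hT.mul a (by omega)
  have hmb := hT.mul b (by omega)
  have hsa := hT.sq a (by omega)
  have hsb := hT.sq b (by omega)
  have htest : (Test.eq (get aMat (matIdx rA rB)) 0).Holds σ ↔ σ.nat aMat (a * n + b) = 0 := by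
    simp only [Test.Holds, eval_get, eval_matIdx, hA, hB, hma]
    rfl
  classical
  set t' : Tree n m → Fin n → Fin n → Tree n m := fun N x y =>
    if x = a ∧ y = b then N else if x = b ∧ y = a then .rev N else t x y with ht'
  have e1 : ∀ N, t' N a b = N := fun N => by simp [ht']
  have e2 : ∀ N, t' N b a = .rev N := fun N => by simp [ht', hab.symm, hab]
  have e3 : ∀ N x y, s(x, y) ≠ s(a, b) → t' N x y = t x y := fun N x y hs => by
    rw [ne_eq, Sym2.eq_iff, not_or] at hs
    simp [ht', hs]
  by_cases hP : P a b
  · obtain ⟨h1, h2, h3⟩ := h.mat.piece a ha b hb hP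
    refine ⟨_, t' (.par (t a b) T), Or.inl ⟨hP, rfl⟩, e1 _, e2 _, e3 _, ?_, ?_⟩
    · set k := σ.nat aMat (a * n + b) - 1 with hk
      have hPP : (fun x y => P x y ∨ s(x, y) = s(a, b)) = P := by
        funext x y
        refine propext ⟨fun h' => h'.elim id fun h' => ?_, Or.inl⟩
        rcases Sym2.eq_iff.1 h' with ⟨rfl, rfl⟩ | ⟨rfl, rfl⟩
        · exact hP
        · exact hsymm _ _ hP
      have hnodes : Nodes.of (addPiece.sem σ) = ((Nodes.of σ).emit (K + 2) 4 k K
          ((Nodes.of σ).sg k + (Nodes.of σ).sg K - 1)).emit (K + 3) 2 (K + 2) 0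
          ((Nodes.of σ).sg k + (Nodes.of σ).sg K - 1) := by
        rw [addPiece, Prog.sem, if_neg (by rwa [htest])]
        simp [emit, Nodes.of, eval_matIdx, Nodes.emit, hA, hB, hma, hK, hk]
      have hKK : (addPiece.sem σ).nat rK 0 = K + 4 := by
        rw [addPiece, Prog.sem, if_neg (by rwa [htest])]
        simp [emit, hK]
      have hM : (addPiece.sem σ).nat aMat = Function.update (Function.update (σ.nat aMat)
          (a * n + b) (K + 3)) (b * n + a) (K + 4) := by
        rw [addPiece, Prog.sem, if_neg (by rwa [htest])]
        simp [emit, eval_matIdx, hA, hB, hma, hmb, hK]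
      have r1 := h3.emit_par h2 hR (by omega) (hd hP)
      rw [hK] at r1
      have r2 := r1.emit_rev (K := K + 3) (by omega) 0
      have e4 : ((Nodes.of σ).emit (K + 2) 4 k K
          ((Nodes.of σ).sg k + (Nodes.of σ).sg K - 1)).sg (K + 2) =
          ((Nodes.of σ).sg k + (Nodes.of σ).sg K - 1) := by simp [Nodes.emit]
      have r3 := r1.emit (K := K + 3) (by omega) 2 (K + 2) 0
        ((Nodes.of σ).sg k + (Nodes.of σ).sg K - 1)
      rw [e4] at r2
      rw [← hnodes] at r2 r3
      have hm := (h.mat.emit 4 k K ((Nodes.of σ).sg k + (Nodes.of σ).sg K - 1))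
      rw [hK] at hm
      replace hm := hm.emit 2 (K + 2) 0 ((Nodes.of σ).sg k + (Nodes.of σ).sg K - 1)
      rw [← hnodes] at hm
      rw [hPP]
      have hother : ∀ c, c = aDeg ∨ c = aSum ∨ c = aSqs ∨ c = aLeft →
          (addPiece.sem σ).nat c = σ.nat c := by
        rintro c (rfl | rfl | rfl | rfl) <;> rw [addPiece, Prog.sem, if_neg (by rwa [htest])] <;>
          simp [emit]
      refine ⟨?_, ?_, ?_, ?_, ?_⟩
      · rw [hKK, hM]
        refine hm.set (P' := P) (a := a) (b := b) (k := K + 2) (l := K + 3) (by omega) r3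
          (by omega) r2 hab (fun x y => ?_) (e1 _) (e2 _) (e3 _) ?_ ?_ ?_
        · exact (iff_of_eq (congrFun (congrFun hPP x) y)).symm
        · rw [Function.update_of_ne hne, Function.update_self]
        · rw [Function.update_self]
        · intro i h4 h5
          rw [Function.update_of_ne h5, Function.update_of_ne h4]
      · rw [hother _ (by simp)]; exact h.deg
      · rw [hother _ (by simp)]; exact h.sum
      · rw [hother _ (by simp)]; exact h.sqs
      · rw [hother _ (by simp)]; exact h.left
    · rw [addPiece, Prog.sem, if_neg (by rwa [htest])]
      simp [emit, hK]
  · have h0 := h.mat.none a ha b hb hP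
    have hP₂ : ¬ P b a := fun h' => hP (hsymm _ _ h')
    have hnodes : Nodes.of (addPiece.sem σ) = Nodes.of σ := by
      rw [addPiece, Prog.sem, if_pos (by rwa [htest])]
      simp [link, Nodes.of]
    have hKK : (addPiece.sem σ).nat rK 0 = K + 2 := by
      rw [addPiece, Prog.sem, if_pos (by rwa [htest])]
      simp [link, hK]
    have hM : (addPiece.sem σ).nat aMat = Function.update (Function.update (σ.nat aMat)
        (a * n + b) (K + 1)) (b * n + a) (K + 2) := by
      rw [addPiece, Prog.sem, if_pos (by rwa [htest])]
      simp [link, eval_matIdx, hA, hB, hma, hmb, hK]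
    have hL : (addPiece.sem σ).nat aLeft = σ.nat aLeft := by
      rw [addPiece, Prog.sem, if_pos (by rwa [htest])]
      simp [link]
    have hadj : ∀ (c : ℕ) (f : ℕ → ℕ), (c = aDeg ∧ f = fun _ => 1) ∨ (c = aSum ∧ f = fun y => y) ∨
        (c = aSqs ∧ f = fun y => y * y) → (addPiece.sem σ).nat c = Function.update
          (Function.update (σ.nat c) a (σ.nat c a + f b)) b (σ.nat c b + f a) := by
      rintro c f (⟨rfl, rfl⟩ | ⟨rfl, rfl⟩ | ⟨rfl, rfl⟩) <;>
        rw [addPiece, Prog.sem, if_pos (by rwa [htest])] <;>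
        simp [link, hA, hB, hsa, hsb, Function.update_of_ne hab'.symm]
    have hlink : ∀ (c : ℕ) (f : ℕ → ℕ), (c = aDeg ∧ f = fun _ => 1) ∨ (c = aSum ∧ f = fun y => y) ∨
        (c = aSqs ∧ f = fun y => y * y) → NbrSum W P f (σ.nat c) →
        NbrSum W (fun x y => P x y ∨ s(x, y) = s(a, b)) f ((addPiece.sem σ).nat c) := by
      intro c f hc hs
      rw [hadj c f hc]
      refine hs.link ha hb hab hP hP₂ (fun x y => Iff.rfl) ?_ ?_ ?_
      · rw [Function.update_of_ne hab', Function.update_self]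
      · rw [Function.update_self]
      · intro x h4 h5
        rw [Function.update_of_ne h5, Function.update_of_ne h4]
    refine ⟨_, t' T, Or.inr ⟨hP, rfl⟩, e1 _, e2 _, e3 _, ⟨?_, ?_, ?_, ?_, ?_⟩, by omega⟩
    · rw [hKK, hnodes, hM]
      have hm := h.mat
      rw [hK] at hm
      refine hm.set (a := a) (b := b) (k := K) (l := K + 1) (by omega) hR
          (by omega) hR' hab (fun x y => Iff.rfl) (e1 _) (e2 _) (e3 _) ?_ ?_ ?_
      · rw [Function.update_of_ne hne, Function.update_self]
      · rw [Function.update_self]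
      · intro i h4 h5
        rw [Function.update_of_ne h5, Function.update_of_ne h4]
    · exact hlink _ _ (by simp) h.deg
    · exact hlink _ _ (by simp) h.sum
    · exact hlink _ _ (by simp) h.sqs
    · rw [hL]; exact h.left

end addPiece

end SPNet

namespace SPNet

open NExpr (get)
open Prog (setN setC ite block seq)

variable {n m : ℕ} {G : Network n m} {D : ℕ} {B : ℝ≥0} {σ : State}

/-! ### Verification of the reduction -/

theorem initTables_spec (hE : Env G D B σ) (h₁ : σ.nat aSq 0 = 0) (h₂ : σ.nat aMul 0 = 0) :
    Runs initTables σ (200 * (n + 1)) fun τ => Env G D B τ ∧ Tables n τ := by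
  refine (Runs.seq (Runs.simple (b := 20) (R := fun τ => Env G D B τ ∧ τ.nat rI 0 = 0 ∧
    τ.nat aSq 0 = 0 ∧ τ.nat aMul 0 = 0) rfl rfl ⟨hE.frame (Frame.sem rfl σ) rfl rfl, by simp,
      by simpa, by simpa⟩)
    fun τ hτ _ => Runs.count rfl 60 (c := 81) (by norm_num) (2 * n) (fun i τ => Env G D B τ ∧ τ.nat
      rI 0 = i ∧
      (∀ j ≤ i, τ.nat aMul j = j * n) ∧ (∀ j ≤ i, τ.nat aSq j = j * j) ∧
      (∀ j < i, τ.nat aRoot (j * j) = j) ∧ (∀ j < i, τ.nat aHalf (j + j) = j)) ?_ ?_ ?_).mono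
      (by omega) ?_
  · rintro i τ hi ⟨h1, h2, -⟩
    simp only [Test.Holds, eval_reg, eval_add, eval_get, eval_ofNat, h1.n_eq, h2]
    omega
  · rintro i τ hi ⟨h1, h2, h3, h4, h5, h6⟩
    refine Runs.simple rfl rfl ⟨h1.frame (Frame.sem rfl τ) rfl rfl, by simp [h2], ?_, ?_, ?_, ?_⟩
    · intro j hj
      simp only [sem_block_cons, sem_setN, sem_setR, sem_block_nil, storeN_nat]
      simp [h1.n_eq, h2, h3 i le_rfl, Function.update_apply]
      split_ifs with hj'
      · subst hj'; ring
      · exact h3 j (by omega)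
    · intro j hj
      simp [h2, h4 i le_rfl, Function.update_apply]
      split_ifs with hj'
      · subst hj'; ring
      · exact h4 j (by omega)
    · intro j hj
      simp [h2, h4 i le_rfl, Function.update_apply]
      split_ifs with hj'
      · exact (Nat.mul_self_inj.1 hj').symm
      · exact h5 j (by rcases Nat.lt_succ_iff_lt_or_eq.1 hj with h | rfl <;> [exact h; simp at hj'])
    · intro j hj
      simp [h2, Function.update_apply]
      split_ifs with hj'
      · omega
      · exact h6 j (by omega)
  · obtain ⟨h1, h2, h3, h4⟩ := hτ
    refine ⟨h1, h2, ?_, ?_, by simp, by simp⟩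
    · intro j hj
      obtain rfl : j = 0 := by omega
      simpa
    · intro j hj
      obtain rfl : j = 0 := by omega
      simpa
  · rintro τ ⟨h1, -, h3, h4, h5, h6⟩
    exact ⟨h1, h3, h4, h5, h6⟩

/-- The vertices with one or two neighbours are on the stack. -/
def Stacked (W : Finset (Fin n)) (P : Fin n → Fin n → Prop) (sp : ℕ) (stk : ℕ → ℕ) : Prop :=
  ∀ u ∈ W, 1 ≤ (nbrs W P u).card → (nbrs W P u).card ≤ 2 → ∃ j < sp, stk j = u

theorem initVerts_spec (hE : Env G D B σ) (hT : Tables n σ)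
    (h₁ : ∀ c ∈ [aMat, aDeg, aSum, aSqs, aLeft, aTy], ∀ i, σ.nat c i = 0) :
    Runs initVerts σ (150 * (n + 1)) fun τ => Env G D B τ ∧ Tables n τ ∧
      Graph G Finset.univ (fun a b => a = b) (fun a _ => .nil a) τ ∧ τ.nat rK 0 = n ∧
      τ.nat rSp 0 = n ∧ ∀ u < n, τ.nat aStk u = u := by
  refine (Runs.seq (Runs.simple (b := 20) (R := fun τ => Env G D B τ ∧ Tables n τ ∧ τ.nat rI 0 = 0 ∧
    ∀ c ∈ [aMat, aDeg, aSum, aSqs, aLeft, aTy], ∀ i, τ.nat c i = 0) rfl rfl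
    ⟨hE.frame (Frame.sem rfl σ) rfl rfl, hT.frame (Frame.sem rfl σ) rfl, by simp,
      fun c hc i => ?_⟩)
    fun τ hτ _ => Runs.seq (Runs.count rfl 50 (c := 75) (by norm_num) n
      (fun i τ => Env G D B τ ∧ Tables n τ ∧ τ.nat rI 0 = i ∧
        (∀ c ∈ [aDeg, aSum, aSqs, aTy], ∀ i, τ.nat c i = 0) ∧
        (∀ a b : Fin n, τ.nat aMat (a * n + b) = if a = b ∧ (a : ℕ) < i then (a : ℕ) + 1 else 0) ∧
        (∀ u, τ.nat aLeft u = if u < i then 1 else 0) ∧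
        (∀ u < i, τ.nat aStk u = u ∧ τ.nat aSg u = 1)) ?_ ?_ ?_)
      fun τ hτ _ => Runs.simple (b := 20) rfl rfl ?_).mono (by omega) (fun τ h => h)
  · simp only [sem_setR, storeN_nat]
    rw [if_neg, h₁ c hc]
    rintro rfl
    simp at hc
  · rintro i τ hi ⟨h1, -, h2, -⟩
    simp only [Test.Holds, eval_reg, eval_get, eval_ofNat, h1.n_eq, h2]
  · rintro i τ hi ⟨h1, h2, h3, h4, h5, h6, h7⟩
    have hm := h2.mul i (by omega)
    refine Runs.simple rfl rfl ⟨h1.frame (Frame.sem rfl τ) rfl rfl,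
      h2.frame (Frame.sem rfl τ) rfl, by simp [h3], ?_, ?_, ?_, ?_⟩
    · intro c hc j
      rw [(Frame.sem rfl τ).nat c, h4 c hc]
      simp only [List.mem_cons, List.not_mem_nil, or_false] at hc
      rcases hc with rfl | rfl | rfl | rfl <;> decide
    · intro a b
      simp only [sem_block_cons, sem_setN, sem_setR, sem_block_nil, storeN_nat]
      simp [h3, hm, Function.update_apply]
      split_ifs with h8 h9 h9
      · obtain ⟨h10, h11⟩ := index_inj (c := ⟨i, hi⟩) (d := ⟨i, hi⟩) h8
        rw [h10]
      · obtain ⟨h10, h11⟩ := index_inj (c := ⟨i, hi⟩) (d := ⟨i, hi⟩) h8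
        exact absurd ⟨h10.trans h11.symm, by simp [h10]⟩ h9
      · rw [h5, if_pos]
        refine ⟨h9.1, ?_⟩
        obtain ⟨rfl, h10⟩ := h9
        rcases Nat.lt_or_eq_of_le h10 with h | h
        · exact h
        · rw [h] at h8; exact absurd rfl h8
      · rw [h5, if_neg]
        exact fun h => h9 ⟨h.1, by omega⟩
    · intro u
      simp [h3, Function.update_apply, h6]
      split_ifs <;> omega
    · intro u hu
      simp [h3, Function.update_apply]
      rcases Nat.lt_succ_iff_lt_or_eq.1 hu with h | rfl
      · simpa [h.ne] using h7 u h
      · simp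
  · obtain ⟨h1, h2, h3, h4⟩ := hτ
    refine ⟨h1, h2, h3, fun c hc => h4 c ?_, fun a b => by simp [h4], fun u => by simp [h4],
      by simp⟩
    simp only [List.mem_cons, List.not_mem_nil, or_false] at hc ⊢
    tauto
  · obtain ⟨h1, h2, h3, h4, h5, h6, h7⟩ := hτ
    have hst : (G.s : ℕ) ≠ G.t := fun h => G.s_ne_t (Fin.ext h)
    refine ⟨h1.frame (Frame.sem rfl τ) rfl rfl, h2.frame (Frame.sem rfl τ) rfl, ⟨⟨?_, ?_⟩, ?_, ?_,
      ?_, ?_⟩,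
      by simp [h1.n_eq], by simp [h1.n_eq], fun u hu => by simpa using (h7 u hu).1⟩
    · rintro a - b - rfl
      simp [h5, Rep, Nodes.of, h1.n_eq, h1.s_eq, h1.t_eq, h4, Network.supply_le]
      simp only [Function.update_apply, Fin.val_inj, eq_comm (a := a)]
      have := (h7 a a.2).2
      by_cases h8 : G.t = a
      · have : G.s ≠ a := fun h => G.s_ne_t (h.trans h8.symm)
        simp [h8, this]
      · by_cases h9 : G.s = a <;> simp [h8, h9, this]
    · intro a _ b _ hab
      simp [h5, hab]
    · intro u _
      have : nbrs Finset.univ (fun a b => a = b) u = ∅ := by ext y; simp [mem_nbrs]; tauto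
      simp [this, h4]
    · intro u _
      have : nbrs Finset.univ (fun a b => a = b) u = ∅ := by ext y; simp [mem_nbrs]; tauto
      simp [this, h4]
    · intro u _
      have : nbrs Finset.univ (fun a b => a = b) u = ∅ := by ext y; simp [mem_nbrs]; tauto
      simp [this, h4]
    · intro u
      simp [h6]
      exact ⟨fun h => ⟨⟨u, h⟩, rfl⟩, fun ⟨x, hx⟩ => hx ▸ x.2⟩

/-- The matrix and the sums over the neighbours are not affected by changes of other arrays. -/
theorem Graph.congr {W : Finset (Fin n)} {P : Fin n → Fin n → Prop} {t : Fin n → Fin n → Tree n m}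
    {τ : State} (h : Graph G W P t σ)
    (h' : ∀ c ∈ [aMat, aDeg, aSum, aSqs, aLeft, aTy, aC1, aC2, aSg, rK], τ.nat c = σ.nat c) :
    Graph G W P t τ := by
  simp only [List.mem_cons, List.not_mem_nil, or_false, forall_eq_or_imp, forall_eq] at h'
  obtain ⟨h1, h2, h3, h4, h5, h6, h7, h8, h9, h10⟩ := h'
  have hN : Nodes.of τ = Nodes.of σ := by simp only [Nodes.of, h6, h7, h8, h9]
  exact ⟨by rw [hN, h10, h1]; exact h.mat, by rw [h2]; exact h.deg, by rw [h3]; exact h.sum,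
    by rw [h4]; exact h.sqs, by rw [h5]; exact h.left⟩

theorem addEdge_spec {t : Fin n → Fin n → Tree n m} {W : Finset (Fin n)}
    {P : Fin n → Fin n → Prop} (hE : Env G D B σ) (h : Graph G W P t σ)
    (e : Fin m) (he : σ.nat rI 0 = e) :
    Graph G W P t (addEdge.sem σ) ∧ (addEdge.sem σ).nat rK 0 = σ.nat rK 0 + 2 ∧
    (addEdge.sem σ).nat rA 0 = G.src e ∧ (addEdge.sem σ).nat rB 0 = G.tgt e ∧
    Rep G (Nodes.of (addEdge.sem σ)) (.edge e) (σ.nat rK 0) ∧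
    Rep G (Nodes.of (addEdge.sem σ)) (.rev (.edge e)) (σ.nat rK 0 + 1) := by
  have hN : Nodes.of (addEdge.sem σ) = ((Nodes.of σ).emit (σ.nat rK 0) 1 e 0 1).emit
      (σ.nat rK 0 + 1) 2 (σ.nat rK 0) 0 1 := by
    simp [addEdge, emit, Nodes.of, Nodes.emit, he]
  have hK : (addEdge.sem σ).nat rK 0 = σ.nat rK 0 + 2 := by simp [addEdge, emit]
  have r1 := (Rep.emit_edge (G := G) (N := Nodes.of σ) (K := σ.nat rK 0) e 0)
  have r2 := r1.emit_rev (K := σ.nat rK 0 + 1) (by omega) 0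
  have e1 : ((Nodes.of σ).emit (σ.nat rK 0) 1 e 0 1).sg (σ.nat rK 0) = 1 := by simp [Nodes.emit]
  rw [e1, ← hN] at r2
  have hm := (h.mat.emit 1 e 0 1).emit 2 (σ.nat rK 0) 0 1
  rw [← hN] at hm
  have hc : ∀ c ∈ [aMat, aDeg, aSum, aSqs, aLeft], (addEdge.sem σ).nat c = σ.nat c := by
    intro c hc
    refine (Frame.sem rfl σ).nat c ?_
    simp only [List.mem_cons, List.not_mem_nil, or_false] at hc
    rcases hc with rfl | rfl | rfl | rfl | rfl <;> decide
  refine ⟨⟨?_, ?_, ?_, ?_, ?_⟩, hK, ?_, ?_, ?_, r2⟩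
  · rw [hK, hc _ (by simp)]; exact hm
  · rw [hc _ (by simp)]; exact h.deg
  · rw [hc _ (by simp)]; exact h.sum
  · rw [hc _ (by simp)]; exact h.sqs
  · rw [hc _ (by simp)]; exact h.left
  · simp [addEdge, emit, he, hE.src_eq]
  · simp [addEdge, emit, he, hE.tgt_eq]
  · rw [hN]; exact r1.emit (by omega) 2 (σ.nat rK 0) 0 1

/-- The graph with the first `i` edges. -/
def EdgeRel (G : Network n m) (i : ℕ) (x y : Fin n) : Prop :=
  x = y ∨ ∃ e : Fin m, (e : ℕ) < i ∧ s(G.src e, G.tgt e) = s(x, y)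

theorem addEdges_spec (hE : Env G D B σ) (hT : Tables n σ)
    (hl : ∀ e, G.src e ≠ G.tgt e) (hK : σ.nat rK 0 = n)
    (h : Graph G Finset.univ (fun a b => a = b) (fun a _ => .nil a) σ) :
    Runs addEdges σ (600 * (m + 1)) fun τ => Env G D B τ ∧ Tables n τ ∧ τ.nat rK 0 ≤ n + 4 * m ∧
      ∃ t, Red G m Finset.univ (EdgeRel G m) t (fun y => s(y, y)) (fun e => s(G.src e, G.tgt e))
        ∅ ∅ ∧ Graph G Finset.univ (EdgeRel G m) t τ := by
  have h0 : (fun a b : Fin n => a = b) = EdgeRel G 0 := by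
    funext a b; simp [EdgeRel]
  refine (Runs.seq (Runs.simple (b := 20) (R := fun τ => Env G D B τ ∧ Tables n τ ∧ τ.nat rI 0 = 0 ∧
      τ.nat rK 0 = n ∧ Graph G Finset.univ (fun a b => a = b) (fun a _ => .nil a) τ) rfl rfl ?_)
    fun τ hτ _ => Runs.count rfl 500 (c := 530) (by norm_num) m
      (fun i τ => Env G D B τ ∧ Tables n τ ∧ τ.nat rI 0 = i ∧ τ.nat rK 0 ≤ n + 4 * i ∧
        ∃ t, Red G i Finset.univ (EdgeRel G i) t (fun y => s(y, y))
          (fun e => s(G.src e, G.tgt e)) ∅ ∅ ∧ Graph G Finset.univ (EdgeRel G i) t τ)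
        ?_ ?_ ?_).mono (by omega) ?_
  · refine ⟨hE.frame (Frame.sem rfl σ) rfl rfl, hT.frame (Frame.sem rfl σ) rfl, by simp, by simpa,
      h.congr fun c hc => (Frame.sem rfl σ).nat c ?_⟩
    simp only [List.mem_cons, List.not_mem_nil, or_false] at hc
    rcases hc with rfl | rfl | rfl | rfl | rfl | rfl | rfl | rfl | rfl | rfl <;> decide
  · rintro i τ hi ⟨h1, -, h2, -⟩
    simp only [Test.Holds, eval_reg, eval_get, eval_ofNat, h1.m_eq, h2]
  · rintro i τ hi ⟨h1, h2, h3, h4, t, h5, h6⟩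
    obtain ⟨g1, g2, g3, g4, g5, g6⟩ := addEdge_spec (W := Finset.univ) h1 h6 ⟨i, hi⟩ h3
    have hT₁ : Tables n (addEdge.sem τ) := h2.frame (Frame.sem rfl τ) rfl
    obtain ⟨N, t', f1, f2, f3, f4, f5, f6⟩ := addPiece_spec hT₁ g1 (Finset.mem_univ _)
      (Finset.mem_univ _) (hl ⟨i, hi⟩) g3 g4 h5.symm g2 g5 g6 fun hP => by simp [Tree.verts]
    have hrel : ∀ x y, EdgeRel G (i + 1) x y ↔ EdgeRel G i x y ∨
        s(x, y) = s(G.src ⟨i, hi⟩, G.tgt ⟨i, hi⟩) := by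
      intro x y
      simp only [EdgeRel, or_assoc]
      refine or_congr_right ⟨?_, ?_⟩
      · rintro ⟨e, h7, h8⟩
        rcases Nat.lt_succ_iff_lt_or_eq.1 h7 with h | h
        · exact Or.inl ⟨e, h, h8⟩
        · obtain rfl : e = ⟨i, hi⟩ := Fin.ext h
          exact Or.inr h8.symm
      · rintro (⟨e, h7, h8⟩ | h8)
        · exact ⟨e, by omega, h8⟩
        · exact ⟨⟨i, hi⟩, by simp, h8.symm⟩
    have hr := (h5.insert_edge ⟨i, hi⟩ rfl rfl).merge (T := .edge ⟨i, hi⟩) (Finset.mem_univ _)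
      (Finset.mem_univ _) (hl ⟨i, hi⟩) (.edge _ (hl _)) rfl rfl (by simp)
      (by simp) (by simp [Tree.size, Tree.edges, Tree.verts]) f1 hrel f2 f3 fun x y _ => f4 x y
    refine Runs.simple rfl rfl ⟨h1.frame (Frame.sem rfl τ) rfl rfl, h2.frame (Frame.sem rfl τ) rfl,
      ?_, ?_, t', hr, ?_⟩
    · simp only [sem_block_cons, sem_block_nil, sem_setR, storeN_nat]
      simp
      rw [(Frame.sem rfl (addEdge.sem τ)).nat rI (by decide), (Frame.sem rfl τ).nat rI (by decide),
        h3]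
    · simp only [sem_block_cons, sem_block_nil, sem_setR, storeN_nat]
      simp
      omega
    · have : EdgeRel G (i + 1) = fun x y => EdgeRel G i x y ∨
          s(x, y) = s(G.src ⟨i, hi⟩, G.tgt ⟨i, hi⟩) := by
        funext x y; exact propext (hrel x y)
      rw [this]
      refine f5.congr fun c hc => ?_
      simp only [sem_block_cons, sem_block_nil, sem_setR, storeN_nat]
      rw [if_neg]
      rintro rfl
      simp at hc
  · obtain ⟨h1, h2, h3, h4, h5⟩ := hτ
    refine ⟨h1, h2, h3, by omega, _, ?_, h0 ▸ h5⟩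
    rw [← h0]
    exact Red.init G
  · rintro τ ⟨h1, h2, -, h3⟩
    exact ⟨h1, h2, h3⟩

/-- A vertex that is not adjacent to the eliminated vertex `u` keeps its neighbours. -/
theorem nbrs_eq_of_notMem {W : Finset (Fin n)} {P P' : Fin n → Fin n → Prop} {u x : Fin n}
    (h : ∀ y ∈ W, y ≠ u → y ≠ x → (P' x y ↔ P x y)) (hu : ¬ P x u) :
    nbrs (W.erase u) P' x = nbrs W P x := by
  ext y
  simp only [mem_nbrs, Finset.mem_erase]
  constructor
  · rintro ⟨⟨h1, h2⟩, h3, h4⟩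
    exact ⟨h2, h3, (h y h2 h1 h3).1 h4⟩
  · rintro ⟨h2, h3, h4⟩
    have h1 : y ≠ u := by rintro rfl; exact hu h4
    exact ⟨⟨h1, h2⟩, h3, (h y h2 h1 h3).2 h4⟩

/-- Elimination of a vertex with a single neighbour. -/
theorem elimOne_spec {W : Finset (Fin n)} {P : Fin n → Fin n → Prop}
    {t : Fin n → Fin n → Tree n m} {lv : Fin n → Sym2 (Fin n)} {le : Fin m → Sym2 (Fin n)}
    (hT : Tables n σ) (hR : Red G m W P t lv le ∅ ∅) (h : Graph G W P t σ) {u a : Fin n}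
    (hu : u ∈ W) (hU : σ.nat rU 0 = u) (hn : nbrs W P u = {a}) :
    ∃ t' lv' le', Red G m (W.erase u) (fun x y => P x y ∧ x ≠ u ∧ y ≠ u) t' lv' le' ∅ ∅ ∧
      Graph G (W.erase u) (fun x y => P x y ∧ x ≠ u ∧ y ≠ u) t' (elimOne.sem σ) ∧
      (elimOne.sem σ).nat rA 0 = a ∧ (elimOne.sem σ).nat rK 0 = σ.nat rK 0 + 3 ∧
      (elimOne.sem σ).nat rSp 0 = σ.nat rSp 0 + 1 ∧
      (elimOne.sem σ).nat aStk = Function.update (σ.nat aStk) (σ.nat rSp 0) a := by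
  have hmem : ∀ y, y ∈ nbrs W P u ↔ y = a := by simp [hn]
  obtain ⟨haW, hau, hua⟩ := mem_nbrs.1 ((hmem a).2 rfl)
  have hPa := hR.symm _ _ hua
  have hnb : ∀ y, P u y → y = u ∨ y = a := fun y hy => by
    by_cases hyu : y = u
    · exact Or.inl hyu
    · exact Or.inr ((hmem y).1 (mem_nbrs.2 ⟨(hR.mem _ _ hy).2, hyu, hy⟩))
  obtain ⟨m1, m2, m3⟩ := h.mat.piece a haW u hu hPa
  obtain ⟨m4, m5, m6⟩ := h.mat.piece u hu u hu (hR.refl u hu)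
  obtain ⟨m7, m8, m9⟩ := h.mat.piece a haW a haW (hR.refl a haW)
  have hma := hT.mul a (by omega)
  have hmu := hT.mul u (by omega)
  have hsu := hT.sq u (by omega)
  have hsum : σ.nat aSum u = a := by rw [h.sum u hu, hn]; simp
  generalize hk₁ : σ.nat aMat (a * n + u) - 1 = k₁ at m2 m3
  generalize hk₂ : σ.nat aMat (u * n + u) - 1 = k₂ at m5 m6
  generalize hk₃ : σ.nat aMat (a * n + a) - 1 = k₃ at m8 m9
  generalize hK : σ.nat rK 0 = K at m2 m5 m8
  have hau' : (a : ℕ) ≠ u := fun h => hau (Fin.ext h)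
  obtain ⟨w1, w2, w3, w4⟩ := hR.pendant_tree hu hau hPa hnb rfl
  have hd := (hR.absorb_tree hu hau hPa).2.2.2.2
  set N₁ := (Nodes.of σ).emit K 3 k₁ k₂ ((Nodes.of σ).sg k₁ + (Nodes.of σ).sg k₂ - 1) with hN₁
  set N₂ := N₁.emit (K + 1) 5 K 0 (N₁.sg K) with hN₂
  set N₃ := N₂.emit (K + 2) 4 k₃ (K + 1) (N₂.sg k₃ + N₂.sg (K + 1) - 1) with hN₃
  have hnodes : Nodes.of (elimOne.sem σ) = N₃ := by
    simp [elimOne, emit, unlink, push, Nodes.of, Nodes.emit, eval_matIdx, hU, hsum, hma, hmu, hK,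
      hk₁, hk₂, hk₃, hN₃, hN₂, hN₁]
  have hKK : (elimOne.sem σ).nat rK 0 = K + 3 := by
    simp [elimOne, emit, unlink, push, hK]
  have hM : (elimOne.sem σ).nat aMat = Function.update (σ.nat aMat) (a * n + a) (K + 3) := by
    simp [elimOne, emit, unlink, push, eval_matIdx, hU, hsum, hma, hmu, hK]
  have hL : (elimOne.sem σ).nat aLeft = Function.update (σ.nat aLeft) u 0 := by
    simp [elimOne, emit, unlink, push, hU]
  have r1 := m3.emit_ser m2 m6 m5 hd
  have r2 := r1.emit_close (K := K + 1) (by omega) 0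
  have r3 := (((m9.emit m8 3 k₁ k₂ ((Nodes.of σ).sg k₁ + (Nodes.of σ).sg k₂ - 1)).emit
    (K := K + 1) (by omega) 5 K 0 (N₁.sg K)))
  have hdis : Disjoint (t a a).verts (Tree.close (.ser (t a u) (t u u))).verts := by
    rw [Tree.verts, Tree.verts, Finset.disjoint_union_right]
    exact ⟨hR.disjoint_verts (hR.refl a haW) hPa (by rw [ne_eq, Sym2.eq_iff]; grind),
      hR.disjoint_verts (hR.refl a haW) (hR.refl u hu) (by rw [ne_eq, Sym2.eq_iff]; grind)⟩
  have r4 := r3.emit_par (K := K + 2) (by omega) r2 (by omega) hdis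
  classical
  set t' : Fin n → Fin n → Tree n m := fun x y =>
    if x = a ∧ y = a then .par (t a a) (.close (.ser (t a u) (t u u))) else t x y with ht'
  have e1 : t' a a = .par (t a a) (.close (.ser (t a u) (t u u))) := by simp [ht']
  have e2 : ∀ x y, s(x, y) ≠ s(a, a) → t' x y = t x y := fun x y hs => by
    rw [ne_eq, Sym2.eq_iff] at hs
    simp only [or_self] at hs
    simp [ht', hs]
  have hr := (hR.remove (u := u) (a := a) (b := a) (by simpa using hnb)).merge_loop
    (Finset.mem_erase.2 ⟨hau, haW⟩) w1 w2 w3 (by simp; tauto) (by simp; tauto) w4 e1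
    fun x y _ => e2 x y
  have hsub : ∀ (c : ℕ) (f : ℕ → ℕ), (c = aDeg ∧ f = fun _ => 1) ∨ (c = aSum ∧ f = fun y => y) ∨
      (c = aSqs ∧ f = fun y => y * y) → (elimOne.sem σ).nat c = Function.update (σ.nat c) a
        (σ.nat c a - f u) := by
    rintro c f (⟨rfl, rfl⟩ | ⟨rfl, rfl⟩ | ⟨rfl, rfl⟩) <;>
      simp [elimOne, emit, unlink, push, hU, hsum, hsu]
  have hrem : ∀ (c : ℕ) (f : ℕ → ℕ), (c = aDeg ∧ f = fun _ => 1) ∨ (c = aSum ∧ f = fun y => y) ∨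
      (c = aSqs ∧ f = fun y => y * y) → NbrSum W P f (σ.nat c) →
      NbrSum (W.erase u) (fun x y => P x y ∧ x ≠ u ∧ y ≠ u) f ((elimOne.sem σ).nat c) := by
    intro c f hc hs
    rw [hsub c f hc]
    refine hs.remove hR.symm hu (fun x hx => ?_) (fun x hx hxu hxn => ?_)
    · rw [(hmem x).1 hx, Function.update_self]
    · rw [Function.update_of_ne]
      exact fun h => hxn ((hmem x).2 (Fin.ext h))
  refine ⟨t', _, _, hr, ⟨?_, hrem _ _ (by simp) h.deg, hrem _ _ (by simp) h.sum,
    hrem _ _ (by simp) h.sqs, ?_⟩, ?_, hKK, ?_, ?_⟩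
  · rw [hnodes, hKK, hM]
    have hm := h.mat
    rw [hK] at hm
    refine ((((hm.emit 3 k₁ k₂ ((Nodes.of σ).sg k₁ + (Nodes.of σ).sg k₂ - 1)).emit 5 K 0
      (N₁.sg K)).emit 4 k₃ (K + 1) (N₂.sg k₃ + N₂.sg (K + 1) - 1)).remove u).set_loop (a := a)
      (k := K + 2) (by omega) r4 ⟨hR.refl a haW, hau, hau⟩ e1 e2 ?_ ?_
    · rw [Function.update_self]
    · intro i hi
      rw [Function.update_of_ne hi]
  · intro y
    rw [hL, Function.update_apply]
    split_ifs with hy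
    · simp only [Finset.mem_erase, false_iff]
      rintro ⟨x, ⟨hx, -⟩, hxy⟩
      exact hx (Fin.ext (hxy.trans hy))
    · rw [h.left]
      refine exists_congr fun x => ⟨fun ⟨h1, h2⟩ => ⟨Finset.mem_erase.2 ⟨?_, h1⟩, h2⟩,
        fun ⟨h1, h2⟩ => ⟨Finset.mem_of_mem_erase h1, h2⟩⟩
      rintro rfl
      exact hy h2.symm
  · simp [elimOne, emit, unlink, push, hU, hsum]
  · simp [elimOne, emit, unlink, push]
  · simp [elimOne, emit, unlink, push, hU, hsum]

/-- Removal of a vertex with two neighbours. -/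
theorem cutTwo_spec {W : Finset (Fin n)} {P : Fin n → Fin n → Prop}
    {t : Fin n → Fin n → Tree n m} {lv : Fin n → Sym2 (Fin n)} {le : Fin m → Sym2 (Fin n)}
    (hT : Tables n σ) (hR : Red G m W P t lv le ∅ ∅) (h : Graph G W P t σ) {u a b : Fin n}
    (hu : u ∈ W) (hU : σ.nat rU 0 = u) (hn : nbrs W P u = {a, b}) (hab : b < a) :
    ∃ K, σ.nat rK 0 = K ∧ (cutTwo.sem σ).nat rK 0 = K + 3 ∧
      Graph G (W.erase u) (fun x y => P x y ∧ x ≠ u ∧ y ≠ u) t (cutTwo.sem σ) ∧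
      Rep G (Nodes.of (cutTwo.sem σ)) (.ser (.ser (t a u) (t u u)) (t u b)) (K + 1) ∧
      Rep G (Nodes.of (cutTwo.sem σ)) (.rev (.ser (.ser (t a u) (t u u)) (t u b))) (K + 2) ∧
      (cutTwo.sem σ).nat rA 0 = a ∧ (cutTwo.sem σ).nat rB 0 = b := by
  have hmem : ∀ y, y ∈ nbrs W P u ↔ y = a ∨ y = b := by simp [hn]
  obtain ⟨haW, hau, hua⟩ := mem_nbrs.1 ((hmem a).2 (Or.inl rfl))
  obtain ⟨hbW, hbu, hub⟩ := mem_nbrs.1 ((hmem b).2 (Or.inr rfl))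
  have hPa := hR.symm _ _ hua
  have hnb : ∀ y, P u y → y = u ∨ y = a ∨ y = b := fun y hy => by
    by_cases hyu : y = u
    · exact Or.inl hyu
    · exact Or.inr ((hmem y).1 (mem_nbrs.2 ⟨(hR.mem _ _ hy).2, hyu, hy⟩))
  obtain ⟨m1, m2, m3⟩ := h.mat.piece a haW u hu hPa
  obtain ⟨m4, m5, m6⟩ := h.mat.piece u hu u hu (hR.refl u hu)
  obtain ⟨m7, m8, m9⟩ := h.mat.piece u hu b hbW hub
  have hma := hT.mul a (by omega)
  have hmu := hT.mul u (by omega)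
  have hsu := hT.sq u (by omega)
  have hsum : σ.nat aSum u = a + b := by rw [h.sum u hu, hn, Finset.sum_pair hab.ne']
  have hsqs : σ.nat aSqs u = a * a + b * b := by rw [h.sqs u hu, hn, Finset.sum_pair hab.ne']
  have hlt : (b : ℕ) < a := hab
  obtain ⟨d, hd⟩ : ∃ d, (a : ℕ) = b + d := ⟨a - b, by omega⟩
  have hsq := hT.sq (a + b) (by omega)
  have hroot := hT.root d (by omega)
  have hhalf := hT.half a (by omega)
  -- the difference of the neighbours
  have hdiff : a * a + b * b + (a * a + b * b) - (a + b) * (a + b) = d * d := by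
    rw [hd]; apply Nat.sub_eq_of_eq_add; ring
  have hsumd : (a : ℕ) + b + d = a + a := by omega
  have hsub' : (a : ℕ) + b - a = b := by omega
  generalize hk₁ : σ.nat aMat (a * n + u) - 1 = k₁ at m2 m3
  generalize hk₂ : σ.nat aMat (u * n + u) - 1 = k₂ at m5 m6
  generalize hk₃ : σ.nat aMat (u * n + b) - 1 = k₃ at m8 m9
  generalize hK : σ.nat rK 0 = K at m2 m5 m8
  have hau' : (a : ℕ) ≠ u := fun h => hau (Fin.ext h)
  have hba' : (b : ℕ) ≠ a := hlt.ne
  have hdis := (hR.absorb_tree hu hau hPa).2.2.2.2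
  have hdis' := (hR.series_tree hu hau hbu hab.ne' hPa hub hnb rfl).2.2.2.2
  set N₁ := (Nodes.of σ).emit K 3 k₁ k₂ ((Nodes.of σ).sg k₁ + (Nodes.of σ).sg k₂ - 1) with hN₁
  set N₂ := N₁.emit (K + 1) 3 K k₃ (N₁.sg K + N₁.sg k₃ - 1) with hN₂
  set N₃ := N₂.emit (K + 2) 2 (K + 1) 0 (N₂.sg (K + 1)) with hN₃
  have hnodes : Nodes.of (cutTwo.sem σ) = N₃ := by
    simp [cutTwo, elimTwoNodes, emit, unlink, Nodes.of, Nodes.emit, eval_matIdx, hU, hsum, hsqs,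
      hsq, hdiff, hroot, hsumd, hhalf, hsub', hma, hmu, hK, hk₁, hk₂, hk₃, hN₃, hN₂, hN₁]
  have hKK : (cutTwo.sem σ).nat rK 0 = K + 3 := by
    simp [cutTwo, elimTwoNodes, emit, unlink, hK]
  have hA : (cutTwo.sem σ).nat rA 0 = a := by
    simp [cutTwo, elimTwoNodes, emit, unlink, hU, hsum, hsqs, hsq, hdiff, hroot, hsumd, hhalf]
  have hB : (cutTwo.sem σ).nat rB 0 = b := by
    simp [cutTwo, elimTwoNodes, emit, unlink, hU, hsum, hsqs, hsq, hdiff, hroot, hsumd, hhalf,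
      hsub']
  have hM : (cutTwo.sem σ).nat aMat = σ.nat aMat := (Frame.sem rfl σ).nat _ (by decide)
  have hL : (cutTwo.sem σ).nat aLeft = Function.update (σ.nat aLeft) u 0 := by
    simp [cutTwo, elimTwoNodes, emit, unlink, hU]
  have r1 := m3.emit_ser m2 m6 m5 hdis
  have r2 := r1.emit_ser (K := K + 1) (by omega)
    (m9.emit m8 3 k₁ k₂ ((Nodes.of σ).sg k₁ + (Nodes.of σ).sg k₂ - 1)) (by omega) hdis'
  have r3 := r2.emit_rev (K := K + 2) (by omega) 0
  have hsub : ∀ (c : ℕ) (f : ℕ → ℕ), (c = aDeg ∧ f = fun _ => 1) ∨ (c = aSum ∧ f = fun y => y) ∨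
      (c = aSqs ∧ f = fun y => y * y) → (cutTwo.sem σ).nat c = Function.update
        (Function.update (σ.nat c) a (σ.nat c a - f u)) b (σ.nat c b - f u) := by
    rintro c f (⟨rfl, rfl⟩ | ⟨rfl, rfl⟩ | ⟨rfl, rfl⟩) <;>
      simp [cutTwo, elimTwoNodes, emit, unlink, hU, hsum, hsu, hsqs, hsq, hdiff, hroot, hsumd,
        hhalf, hsub', Function.update_of_ne hba']
  have hrem : ∀ (c : ℕ) (f : ℕ → ℕ), (c = aDeg ∧ f = fun _ => 1) ∨ (c = aSum ∧ f = fun y => y) ∨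
      (c = aSqs ∧ f = fun y => y * y) → NbrSum W P f (σ.nat c) →
      NbrSum (W.erase u) (fun x y => P x y ∧ x ≠ u ∧ y ≠ u) f ((cutTwo.sem σ).nat c) := by
    intro c f hc hs
    rw [hsub c f hc]
    refine hs.remove hR.symm hu (fun x hx => ?_) (fun x hx hxu hxn => ?_)
    · rcases (hmem x).1 hx with rfl | rfl
      · rw [Function.update_of_ne hba'.symm, Function.update_self]
      · rw [Function.update_self]
    · rw [hmem] at hxn
      rw [Function.update_of_ne, Function.update_of_ne]
      · exact fun h => hxn (Or.inl (Fin.ext h))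
      · exact fun h => hxn (Or.inr (Fin.ext h))
  refine ⟨K, rfl, hKK, ⟨?_, hrem _ _ (by simp) h.deg, hrem _ _ (by simp) h.sum,
    hrem _ _ (by simp) h.sqs, ?_⟩, ?_, ?_, hA, hB⟩
  · rw [hnodes, hKK, hM]
    have hm := h.mat
    rw [hK] at hm
    exact (((hm.emit 3 k₁ k₂ ((Nodes.of σ).sg k₁ + (Nodes.of σ).sg k₂ - 1)).emit 3 K k₃
      (N₁.sg K + N₁.sg k₃ - 1)).emit 2 (K + 1) 0 (N₂.sg (K + 1))).remove u
  · intro y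
    rw [hL, Function.update_apply]
    split_ifs with hy
    · simp only [Finset.mem_erase, false_iff]
      rintro ⟨x, ⟨hx, -⟩, hxy⟩
      exact hx (Fin.ext (hxy.trans hy))
    · rw [h.left]
      refine exists_congr fun x => ⟨fun ⟨h1, h2⟩ => ⟨Finset.mem_erase.2 ⟨?_, h1⟩, h2⟩,
        fun ⟨h1, h2⟩ => ⟨Finset.mem_of_mem_erase h1, h2⟩⟩
      rintro rfl
      exact hy h2.symm
  · rw [hnodes]
    exact r2.emit (by omega) 2 (K + 1) 0 (N₂.sg (K + 1))
  · rw [hnodes]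
    exact r3

/-- Elimination of a vertex with two neighbours. -/
theorem elimTwo_spec {W : Finset (Fin n)} {P : Fin n → Fin n → Prop}
    {t : Fin n → Fin n → Tree n m} {lv : Fin n → Sym2 (Fin n)} {le : Fin m → Sym2 (Fin n)}
    (hT : Tables n σ) (hR : Red G m W P t lv le ∅ ∅) (h : Graph G W P t σ) {u a b : Fin n}
    (hu : u ∈ W) (hU : σ.nat rU 0 = u) (hn : nbrs W P u = {a, b}) (hab : b < a) :
    ∃ P' t' lv' le', (∀ x y, P' x y ↔ (P x y ∧ x ≠ u ∧ y ≠ u) ∨ s(x, y) = s(a, b)) ∧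
      Red G m (W.erase u) P' t' lv' le' ∅ ∅ ∧
      Graph G (W.erase u) P' t' (elimTwo.sem σ) ∧
      (elimTwo.sem σ).nat rA 0 = a ∧ (elimTwo.sem σ).nat rK 0 ≤ σ.nat rK 0 + 5 ∧
      (elimTwo.sem σ).nat rSp 0 = σ.nat rSp 0 + 2 ∧
      (elimTwo.sem σ).nat aStk = Function.update (Function.update (σ.nat aStk) (σ.nat rSp 0) a)
        (σ.nat rSp 0 + 1) b := by
  obtain ⟨K, hK, hK₁, hg, r1, r2, hA, hB⟩ := cutTwo_spec hT hR h hu hU hn hab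
  have hmem : ∀ y, y ∈ nbrs W P u ↔ y = a ∨ y = b := by simp [hn]
  obtain ⟨haW, hau, hua⟩ := mem_nbrs.1 ((hmem a).2 (Or.inl rfl))
  obtain ⟨hbW, hbu, hub⟩ := mem_nbrs.1 ((hmem b).2 (Or.inr rfl))
  have hPa := hR.symm _ _ hua
  have hnb : ∀ y, P u y → y = u ∨ y = a ∨ y = b := fun y hy => by
    by_cases hyu : y = u
    · exact Or.inl hyu
    · exact Or.inr ((hmem y).1 (mem_nbrs.2 ⟨(hR.mem _ _ hy).2, hyu, hy⟩))
  have hT₁ : Tables n (cutTwo.sem σ) := hT.frame (Frame.sem rfl σ) rfl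
  obtain ⟨w1, w2, w3, w4, -⟩ := hR.series_tree hu hau hbu hab.ne' hPa hub hnb rfl
  have haW' := Finset.mem_erase.2 ⟨hau, haW⟩
  have hbW' := Finset.mem_erase.2 ⟨hbu, hbW⟩
  have hrem := hR.remove hnb
  obtain ⟨N, t', f1, f2, f3, f4, f5, f6⟩ := addPiece_spec hT₁ hg haW' hbW' hab.ne' hA hB
    hrem.symm hK₁ r1 r2 (fun hP => by
      rw [w2, Finset.disjoint_left]
      intro y hy hy'
      have := (hrem.verts a b hP y).1 hy
      exact this.2 hy')
  have hr := hrem.merge haW' hbW' hab.ne' w1 w2 w3 (by simp; tauto) (by simp; tauto) w4 f1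
    (P' := fun x y => (P x y ∧ x ≠ u ∧ y ≠ u) ∨ s(x, y) = s(a, b)) (fun x y => Iff.rfl) f2 f3
    fun x y _ => f4 x y
  have hsem : elimTwo.sem σ = (push rB).sem ((push rA).sem (addPiece.sem (cutTwo.sem σ))) := rfl
  set τ := addPiece.sem (cutTwo.sem σ) with hτ
  have e1 : ∀ c, c ∉ addPiece.writesN → c ∉ cutTwo.writesN → τ.nat c = σ.nat c := by
    intro c h1 h2
    rw [hτ, (Frame.sem rfl _).nat c h1, (Frame.sem rfl _).nat c h2]
  have e2 : τ.nat rSp = σ.nat rSp := e1 _ (by decide) (by decide)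
  have e3 : τ.nat aStk = σ.nat aStk := e1 _ (by decide) (by decide)
  have e4 : τ.nat rA 0 = a := by rw [hτ, (Frame.sem rfl _).nat rA (by decide), hA]
  have e5 : τ.nat rB 0 = b := by rw [hτ, (Frame.sem rfl _).nat rB (by decide), hB]
  refine ⟨_, t', _, _, fun x y => Iff.rfl, hr, ?_, ?_, ?_, ?_, ?_⟩
  · rw [hsem]
    refine f5.congr fun c hc => ?_
    rw [(Frame.sem rfl _).nat c, (Frame.sem rfl _).nat c] <;>
      · rintro h'
        simp [push, block, setR, Prog.writesN] at h'
        rcases h' with rfl | rfl <;> simp at hc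
  · rw [hsem]; simp [push, e4]
  · rw [hsem]; simp [push]; omega
  · rw [hsem]; simp [push, e2]
  · rw [hsem]; simp [push, e2, e3, e4, e5]

/-- The invariant of the elimination of the vertices: `W` are the vertices that are left. -/
structure Elim (G : Network n m) (D : ℕ) (B : ℝ≥0) (W : Finset (Fin n)) (σ : State) : Prop where
  env : Env G D B σ
  tables : Tables n σ
  left : ∃ a ∈ W, σ.nat rA 0 = a
  size : σ.nat rK 0 + 5 * W.card ≤ 6 * n + 4 * m
  red : ∃ P t lv le, Red G m W P t lv le ∅ ∅ ∧ Sparse W P ∧ Graph G W P t σ ∧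
    Stacked W P (σ.nat rSp 0) (σ.nat aStk)

/-- Eliminating a vertex with a single neighbour preserves the invariant; here the entry of the
stack that has just been read no longer counts. -/
theorem elimOne_elim {W : Finset (Fin n)} {P : Fin n → Fin n → Prop}
    {t : Fin n → Fin n → Tree n m} {lv : Fin n → Sym2 (Fin n)} {le : Fin m → Sym2 (Fin n)}
    (hE : Env G D B σ) (hT : Tables n σ) (hsz : σ.nat rK 0 + 5 * W.card ≤ 6 * n + 4 * m)
    (hR : Red G m W P t lv le ∅ ∅) (hS : Sparse W P) (h : Graph G W P t σ)
    (hst : Stacked W P (σ.nat rSp 0 + 1) (σ.nat aStk)) {u : Fin n} (hu : u ∈ W)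
    (hU : σ.nat rU 0 = u) (hU' : σ.nat aStk (σ.nat rSp 0) = u) (hn : (nbrs W P u).card = 1) :
    Elim G D B (W.erase u) (elimOne.sem σ) ∧
      (elimOne.sem σ).nat rSp 0 ≤ σ.nat rSp 0 + 2 := by
  obtain ⟨a, hn⟩ := Finset.card_eq_one.1 hn
  have hmem : ∀ y, y ∈ nbrs W P u ↔ y = a := by simp [hn]
  obtain ⟨haW, hau, hua⟩ := mem_nbrs.1 ((hmem a).2 rfl)
  obtain ⟨t', lv', le', h1, h2, h3, h4, h5, h6⟩ := elimOne_spec hT hR h hu hU hn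
  have hc := Finset.card_erase_add_one hu
  refine ⟨⟨hE.frame (Frame.sem rfl σ) rfl rfl, hT.frame (Frame.sem rfl σ) rfl,
    ⟨a, Finset.mem_erase.2 ⟨hau, haW⟩, h3⟩, by omega, _, t', lv', le', h1, ?_, h2, ?_⟩, by omega⟩
  · refine hS.eliminate haW hau hu hua hau hua haW hR.symm (fun y hy hyu hP => ?_)
      fun x hx y hy hxy => ?_
    · exact Or.inl ((hmem y).1 (mem_nbrs.2 ⟨hy, hyu, hP⟩))
    · rw [Finset.mem_erase] at hx hy
      constructor
      · exact fun h => Or.inl h.1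
      · rintro (h | ⟨rfl, rfl⟩ | ⟨rfl, rfl⟩)
        · exact ⟨h, hx.1, hy.1⟩
        · exact absurd rfl hxy
        · exact absurd rfl hxy
  · intro x hx c1 c2
    rw [h5, h6]
    by_cases hxa : x = a
    · exact ⟨σ.nat rSp 0, by omega, by rw [hxa, Function.update_self]⟩
    · rw [Finset.mem_erase] at hx
      rw [nbrs_eq_of_notMem (P := P) (by grind) (fun h => hxa ((hmem x).1
        (mem_nbrs.2 ⟨hx.2, hx.1, hR.symm _ _ h⟩)))] at c1 c2
      obtain ⟨j, hj, hjx⟩ := hst x hx.2 c1 c2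
      have : j ≠ σ.nat rSp 0 := by
        rintro rfl
        exact hx.1 (Fin.ext (hjx.symm.trans hU'))
      exact ⟨j, by omega, by rw [Function.update_of_ne this, hjx]⟩

/-- Eliminating a vertex with two neighbours preserves the invariant. -/
theorem elimTwo_elim {W : Finset (Fin n)} {P : Fin n → Fin n → Prop}
    {t : Fin n → Fin n → Tree n m} {lv : Fin n → Sym2 (Fin n)} {le : Fin m → Sym2 (Fin n)}
    (hE : Env G D B σ) (hT : Tables n σ) (hsz : σ.nat rK 0 + 5 * W.card ≤ 6 * n + 4 * m)
    (hR : Red G m W P t lv le ∅ ∅) (hS : Sparse W P) (h : Graph G W P t σ)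
    (hst : Stacked W P (σ.nat rSp 0 + 1) (σ.nat aStk)) {u : Fin n} (hu : u ∈ W)
    (hU : σ.nat rU 0 = u) (hU' : σ.nat aStk (σ.nat rSp 0) = u) (hn : (nbrs W P u).card = 2) :
    Elim G D B (W.erase u) (elimTwo.sem σ) ∧
      (elimTwo.sem σ).nat rSp 0 ≤ σ.nat rSp 0 + 2 := by
  obtain ⟨a, b, hab, hn⟩ : ∃ a b, b < a ∧ nbrs W P u = {a, b} := by
    obtain ⟨x, y, hxy, hn⟩ := Finset.card_eq_two.1 hn
    rcases lt_or_gt_of_ne hxy with h | h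
    · exact ⟨y, x, h, by rw [hn, Finset.pair_comm]⟩
    · exact ⟨x, y, h, hn⟩
  have hmem : ∀ y, y ∈ nbrs W P u ↔ y = a ∨ y = b := by simp [hn]
  obtain ⟨haW, hau, hua⟩ := mem_nbrs.1 ((hmem a).2 (Or.inl rfl))
  obtain ⟨hbW, hbu, hub⟩ := mem_nbrs.1 ((hmem b).2 (Or.inr rfl))
  obtain ⟨P', t', lv', le', hP', h1, h2, h3, h4, h5, h6⟩ := elimTwo_spec hT hR h hu hU hn hab
  have hc := Finset.card_erase_add_one hu
  refine ⟨⟨hE.frame (Frame.sem rfl σ) rfl rfl, hT.frame (Frame.sem rfl σ) rfl,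
    ⟨a, Finset.mem_erase.2 ⟨hau, haW⟩, h3⟩, by omega, P', t', lv', le', h1, ?_, h2, ?_⟩, by omega⟩
  · refine hS.eliminate haW hau hu hua hbu hub hbW hR.symm (fun y hy hyu hP => ?_)
      fun x hx y hy hxy => ?_
    · exact (hmem y).1 (mem_nbrs.2 ⟨hy, hyu, hP⟩)
    · rw [Finset.mem_erase] at hx hy
      rw [hP', Sym2.eq_iff]
      simp [hx.1, hy.1]
  · intro x hx c1 c2
    rw [h5, h6]
    by_cases hxa : x = a
    · exact ⟨σ.nat rSp 0, by omega, by rw [hxa, Function.update_of_ne (by omega),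
        Function.update_self]⟩
    by_cases hxb : x = b
    · exact ⟨σ.nat rSp 0 + 1, by omega, by rw [hxb, Function.update_self]⟩
    · rw [Finset.mem_erase] at hx
      rw [nbrs_eq_of_notMem (P := P) (fun y hy hyu hyx => by
        rw [hP', Sym2.eq_iff]; simp [hx.1, hyu, hxa, hxb]) (fun h => ((hmem x).1
        (mem_nbrs.2 ⟨hx.2, hx.1, hR.symm _ _ h⟩)).elim hxa hxb)] at c1 c2
      obtain ⟨j, hj, hjx⟩ := hst x hx.2 c1 c2
      have : j ≠ σ.nat rSp 0 := by
        rintro rfl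
        exact hx.1 (Fin.ext (hjx.symm.trans hU'))
      exact ⟨j, by omega, by rw [Function.update_of_ne (by omega), Function.update_of_ne this, hjx]⟩

/-- Each elimination adds at most two entries to the stack and removes a vertex, so that the size of
the stack plus three times the number of vertices decreases in each round. -/
theorem elimAll_spec {W : Finset (Fin n)} (h : Elim G D B W σ) :
    Runs elimAll σ ((σ.nat rSp 0 + 3 * W.card) * 1100 + 1100) fun τ => ∃ W, Elim G D B W τ ∧
      τ.nat rSp 0 = 0 := by
  refine (Runs.loop rfl 1000 (by norm_num) (fun i τ => ∃ W, Elim G D B W τ ∧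
    i = τ.nat rSp 0 + 3 * W.card) ?_ _ σ ⟨W, h, rfl⟩).mono le_rfl ?_
  · rintro i τ ⟨W, hτ, hi⟩ hp
    have hsp : 0 < τ.nat rSp 0 := hp
    set pop : Prog := block [setR rSp (reg rSp - 1), setR rU (get aStk (reg rSp))] with hpop
    have hs : (block [setR rSp (reg rSp - 1), setR rU (get aStk (reg rSp)),
        ite (.eq (get aLeft (reg rU)) 1)
          (ite (.eq (get aDeg (reg rU)) 1) elimOne (ite (.eq (get aDeg (reg rU)) 2) elimTwo .skip))
          .skip]).sem τ = (ite (.eq (get aLeft (reg rU)) 1)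
          (ite (.eq (get aDeg (reg rU)) 1) elimOne (ite (.eq (get aDeg (reg rU)) 2) elimTwo .skip))
          .skip).sem (pop.sem τ) := rfl
    refine Runs.simple rfl rfl ?_
    rw [hs]
    set ρ := pop.sem τ with hρ
    have e1 : ρ.nat rSp 0 = τ.nat rSp 0 - 1 := by simp [hρ, hpop]
    have e2 : ρ.nat rU 0 = τ.nat aStk (ρ.nat rSp 0) := by simp [hρ, hpop]
    have e3 : ∀ c, c ≠ rSp → c ≠ rU → ρ.nat c = τ.nat c := fun c h1 h2 =>
      (Frame.sem rfl τ).nat c (by simp [pop, block, setR, Prog.writesN, h1, h2])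
    have hE : Env G D B ρ := hτ.env.frame (Frame.sem rfl τ) rfl rfl
    have hT : Tables n ρ := hτ.tables.frame (Frame.sem rfl τ) rfl
    obtain ⟨P, t, lv, le, r1, r2, r3, r4⟩ := hτ.red
    have hG : Graph G W P t ρ := r3.congr fun c hc => e3 c (by rintro rfl; simp at hc)
      (by rintro rfl; simp at hc)
    have hsz := hτ.size
    rw [← e3 rK (by decide) (by decide)] at hsz
    rw [show τ.nat rSp 0 = ρ.nat rSp 0 + 1 by omega, ← e3 aStk (by decide) (by decide)] at r4
    rw [← e3 aStk (by decide) (by decide)] at e2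
    have hskip : (∀ x ∈ W, (x : ℕ) = ρ.nat rU 0 → ¬ (1 ≤ (nbrs W P x).card ∧
        (nbrs W P x).card ≤ 2)) → ∃ j < i, ∃ W, Elim G D B W ρ ∧ j = ρ.nat rSp 0 + 3 * W.card := by
      intro hx
      refine ⟨_, ?_, W, ⟨hE, hT, ?_, hsz, P, t, lv, le, r1, r2, hG, ?_⟩, rfl⟩
      · omega
      · rw [e3 rA (by decide) (by decide)]; exact hτ.left
      · intro x hxW c1 c2
        obtain ⟨j, hj, hjx⟩ := r4 x hxW c1 c2
        refine ⟨j, ?_, hjx⟩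
        have : j ≠ ρ.nat rSp 0 := by
          rintro rfl
          exact hx x hxW (hjx.symm.trans e2.symm) ⟨c1, c2⟩
        omega
    rw [Prog.sem]
    split_ifs with t1
    · obtain ⟨u, hu, hu'⟩ := (hG.left _).1 t1
      rw [eval_reg] at hu'
      have hc := Finset.card_erase_add_one hu
      have hdeg : ρ.nat aDeg (ρ.nat rU 0) = (nbrs W P u).card := by
        rw [← hu', hG.deg u hu]; simp
      rw [Prog.sem]
      split_ifs with t2
      · obtain ⟨g1, g2⟩ := elimOne_elim hE hT hsz r1 r2 hG r4 hu hu'.symm (e2.symm.trans hu'.symm)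
          (hdeg.symm.trans t2)
        exact ⟨_, by omega, _, g1, rfl⟩
      · rw [Prog.sem]
        split_ifs with t3
        · obtain ⟨g1, g2⟩ := elimTwo_elim hE hT hsz r1 r2 hG r4 hu hu'.symm
            (e2.symm.trans hu'.symm) (hdeg.symm.trans t3)
          exact ⟨_, by omega, _, g1, rfl⟩
        · refine hskip fun x hx hxu => ?_
          obtain rfl : x = u := Fin.ext (hxu.trans hu'.symm)
          have t2' : (nbrs W P x).card ≠ 1 := fun h => t2 (hdeg.trans h)
          have t3' : (nbrs W P x).card ≠ 2 := fun h => t3 (hdeg.trans h)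
          omega
    · exact hskip fun x hx hxu => absurd ((hG.left _).2 ⟨x, hx, hxu⟩) t1
  · rintro τ ⟨j, ⟨W, hτ, -⟩, hp⟩
    exact ⟨W, hτ, by simpa [Test.Holds] using hp⟩

/-- The node `k` is the root of a tree that describes the whole network. The number `K` of the nodes
and the size of the tree are linear in the size of the network; the nodes need not all belong to the
tree. -/
def HasTree (G : Network n m) (N : Nodes) (K k : ℕ) : Prop :=
  ∃ (T : Tree n m) (a : Fin n), Rep G N T k ∧ T.WF G a a ∧ T.verts = Finset.univ ∧ k < K ∧
    K ≤ 6 * n + 4 * m ∧ T.size ≤ 4 * (n + m)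

/-- When the stack is empty, no vertex has one or two neighbours, and since the graph still has
tree-width two, only one vertex is left. -/
theorem Elim.hasTree {W : Finset (Fin n)} (h : Elim G D B W σ) (h0 : σ.nat rSp 0 = 0) :
    HasTree G (Nodes.of σ) (σ.nat rK 0) (σ.nat aMat ((matIdx rA rA).eval σ) - 1) := by
  obtain ⟨a, ha, hA⟩ := h.left
  obtain ⟨P, t, lv, le, h1, h2, h3, h4⟩ := h.red
  classical
  have hW : W.card < 2 := by
    by_contra hW
    obtain ⟨w, hw, c1, c2⟩ := h2.exists_low (by omega)
    have : {y ∈ W | y ≠ w ∧ P w y} = nbrs W P w := by ext y; simp [mem_nbrs]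
    rw [this] at c1 c2
    obtain ⟨j, hj, -⟩ := h4 w hw c1 c2
    omega
  have hWa : W = {a} := by
    refine Finset.eq_singleton_iff_unique_mem.2 ⟨ha, fun x hx => ?_⟩
    exact Finset.card_le_one.1 (by omega) x hx a ha
  obtain ⟨w1, w2, w3⟩ := h1.final hWa
  obtain ⟨m1, m2, m3⟩ := h3.mat.piece a ha a ha (h1.refl a ha)
  have hs := h1.size a a (h1.refl a ha)
  rw [w2, w3, Finset.card_univ, Finset.card_univ, Fintype.card_fin, Fintype.card_fin] at hs
  rw [eval_matIdx, hA, h.tables.mul a (by omega)]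
  have := h.size
  exact ⟨t a a, a, m3, w1, w2, m2, by omega, by omega⟩

/-- A series-parallel network is reduced to a tree in time `O(m)`. -/
theorem reduce_spec (hsp : G.IsSeriesParallel) :
    Runs reduce (input G D B) (20000 * m) fun τ => Env G D B τ ∧
      HasTree G (Nodes.of τ) (τ.nat rK 0) (τ.nat aMat ((matIdx rA rA).eval τ) - 1) := by
  obtain ⟨hn, hm, hl⟩ := hsp.card_le
  have hn' : 2 ≤ n := by
    have h1 := G.s.2
    have h2 := G.t.2
    have h3 : (G.s : ℕ) ≠ G.t := fun h => G.s_ne_t (Fin.ext h)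
    omega
  have hE : Env G D B (input G D B) := ⟨fun a _ => rfl, fun a _ => rfl⟩
  have hzero : ∀ c, 4 ≤ c → (input G D B).nat c = fun _ => 0 := by
    intro c hc
    obtain ⟨c, rfl⟩ := Nat.exists_eq_add_of_le hc
    simp [input, Nat.add_comm 4]
  refine ((initTables_spec hE (by rw [hzero _ (by norm_num)]) (by rw [hzero _ (by norm_num)])).seq
    (b₂ := 12000 * m) fun σ₁ ⟨hE₁, hT₁⟩ hf₁ => ?_).mono (by omega) fun τ h => h
  refine ((initVerts_spec hE₁ hT₁ ?_).seq (b₂ := 11500 * m)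
    fun σ₂ ⟨hE₂, hT₂, hG₂, hK₂, hs₂, hst₂⟩ hf₂ => ?_).mono (by omega) fun τ h => h
  · intro c hc i
    have hc' : c ∉ initTables.writesN ∧ 4 ≤ c := by
      simp only [List.mem_cons, List.not_mem_nil, or_false] at hc
      rcases hc with rfl | rfl | rfl | rfl | rfl | rfl <;> exact ⟨by decide, by decide⟩
    rw [hf₁.nat c hc'.1, hzero c hc'.2]
  refine ((addEdges_spec hE₂ hT₂ hl hK₂ hG₂).seq (b₂ := 10200 * m)
    fun σ₃ ⟨hE₃, hT₃, hK₃, t, hR₃, hG₃⟩ hf₃ => ?_).mono (by omega) fun τ h => h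
  have hsp₃ : σ₃.nat rSp 0 = n := by rw [hf₃.nat _ (by decide), hs₂]
  have hst₃ : ∀ u < n, σ₃.nat aStk u = u := fun u hu => by rw [hf₃.nat _ (by decide), hst₂ u hu]
  refine Runs.mono (b₁ := 20 + (((n + 3 * n) * 1100 + 1100) + 1)) ?_ (by omega) fun τ h => h
  refine Runs.seq (Runs.simple (R := fun τ => Elim G D B Finset.univ τ ∧ τ.nat rSp 0 = n) rfl rfl
    ?_)
    fun σ₄ ⟨hσ₄, hsp₄⟩ _ => ?_
  · refine ⟨⟨hE₃.frame (Frame.sem rfl _) rfl rfl, hT₃.frame (Frame.sem rfl _) rfl,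
      ⟨⟨0, by omega⟩, by simp, by simp⟩, ?_, EdgeRel G m, t, _, _, hR₃, ?_, ?_, ?_⟩, by simpa⟩
    · simp; omega
    · refine hsp.sparse fun x y hxy => ?_
      simp [EdgeRel, hxy]
    · exact hG₃.congr fun c hc => (Frame.sem rfl _).nat c (by
        simp only [List.mem_cons, List.not_mem_nil, or_false] at hc
        rcases hc with rfl | rfl | rfl | rfl | rfl | rfl | rfl | rfl | rfl | rfl <;> decide)
    · intro u _ _ _
      exact ⟨u, by simp [hsp₃], by simpa using hst₃ u u.2⟩
  · have := elimAll_spec hσ₄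
    rw [hsp₄, Finset.card_univ, Fintype.card_fin] at this
    refine this.seq fun τ ⟨W, hW, h0⟩ _ => ⟨_, τ, .skip τ, le_rfl, hW.env, hW.hasTree h0⟩

end SPNet

namespace SPNet

open NExpr (get)
open Prog (setN setC ite block seq)

/-! ### Dynamic programming -/

/- More arrays; the arrays of costs are `tCost`, which contains the values of the nodes, and
`rCost`, which is a register. -/
notation "aVm" => (25 : ℕ)
notation "rV" => (37 : ℕ)
notation "rRoot" => (42 : ℕ)
notation "rW" => (43 : ℕ)
notation "aOff" => (50 : ℕ)
notation "aFin" => (51 : ℕ)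
notation "aCh" => (52 : ℕ)
notation "rX" => (53 : ℕ)
notation "rY" => (54 : ℕ)
notation "rOk" => (55 : ℕ)
notation "rJ" => (56 : ℕ)
notation "rPos" => (57 : ℕ)
notation "tCost" => (2 : ℕ)
notation "rCost" => (3 : ℕ)

/-- Make the value at the position `p` of the table the current candidate. -/
def loadOne (p : NExpr) : Prog :=
  ite (.eq (get aFin p) 1) (block [setC rCost 0 (.get tCost p), setR rOk 1]) .skip

/-- Make the sum of the values at the positions `p` and `q` of the table the current candidate. -/
def loadTwo (p q : NExpr) : Prog :=
  ite (.and (.eq (get aFin p) 1) (.eq (get aFin q) 1))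
    (block [setC rCost 0 (.add (.get tCost p) (.get tCost q)), setR rOk 1]) .skip

/-- The first child of the current node. -/
def child₁ : NExpr := get aC1 (reg rJ)

/-- The second child of the current node. -/
def child₂ : NExpr := get aC2 (reg rJ)

/-- One more than the supply of the first child, times the value of the flow. -/
def shift : NExpr := get aVm (get aSg child₁)

/-- The candidate for an edge: the edge is needed unless the amount is zero, that is, unless the
shifted amount is `v`. -/
def candEdge : Prog :=
  ite (.eq (reg rY) (reg rX))
    (ite (.eq (reg rX) (reg rV)) (block [setC rCost 0 .zero, setR rOk 1])
      (ite (.and (.not (.lt (reg rV + get aCap child₁) (reg rX)))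
          (.not (.lt (reg rX + get aCap child₁) (reg rV))))
        (block [setC rCost 0 (.get 0 child₁), setR rOk 1]) .skip))
    .skip

/-- The candidate for a reversal. -/
def candRev : Prog :=
  ite (.eq (reg rY + reg rX + shift) (reg rV + reg rV + reg rV))
    (loadOne (get aOff child₁ + reg rY)) .skip

/-- The candidate for a series composition. -/
def candSer : Prog :=
  ite (.eq (reg rY + reg rV) (reg rX + shift))
    (loadTwo (get aOff child₁ + reg rX) (get aOff child₂ + reg rY)) .skip

/-- The candidate for a parallel composition. -/
def candPar : Prog :=
  ite (.and (.not (.lt (reg rX + reg rV) (reg rY)))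
      (.not (.lt (reg rY + reg rV + reg rV) (reg rX + reg rV))))
    (loadTwo (get aOff child₁ + reg rY) (get aOff child₂ + (reg rX + reg rV - reg rY))) .skip

/-- The candidate for a piece that is attached at its first end only. -/
def candClose : Prog :=
  ite (.eq (reg rY + shift) (reg rV + reg rV)) (loadOne (get aOff child₁ + reg rY)) .skip

/-- Compute the candidate `rY` of the value of the node `rJ` at `rX`. -/
def candidate : Prog :=
  seq (setR rOk 0)
    (ite (.eq (get aTy (reg rJ)) 0) (block [setC rCost 0 .zero, setR rOk 1])
    (ite (.eq (get aTy (reg rJ)) 1) candEdge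
    (ite (.eq (get aTy (reg rJ)) 2) candRev
    (ite (.eq (get aTy (reg rJ)) 3) candSer
    (ite (.eq (get aTy (reg rJ)) 4) candPar candClose)))))

/-- Replace the value at the position `rPos` by the current candidate, if the latter is smaller. -/
def improve : Prog :=
  ite (.and (.eq (reg rOk) 1) (.not (.and (.eq (get aFin (reg rPos)) 1)
      (.costLe (.get tCost (reg rPos)) (.get rCost 0)))))
    (block [setN aFin (reg rPos) 1, setC tCost (reg rPos) (.get rCost 0),
      setN aCh (reg rPos) (reg rY)]) .skip

/-- Compute the value of the node `rJ` at `rX`. -/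
def fillEntry : Prog :=
  seq (block [setR rPos (get aOff (reg rJ) + reg rX), setN aFin (reg rPos) 0, setR rY 0])
    (.loop (.lt (reg rY) (reg rW)) (block [candidate, improve, setR rY (reg rY + 1)]))

/-- Compute the values of the node `rJ`. -/
def fillRow : Prog :=
  seq (block [setN aOff (reg rJ + 1) (get aOff (reg rJ) + reg rW), setR rX 0])
    (.loop (.lt (reg rX) (reg rW)) (seq fillEntry (setR rX (reg rX + 1))))

/-- Compute the values of all nodes; the children of a node precede it. -/
def fillTable : Prog :=
  seq (block [setN aOff 0 0, setR rJ 0])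
    (.loop (.lt (reg rJ) (reg rK)) (seq fillRow (setR rJ (reg rJ + 1))))

variable {n m : ℕ} {G : Network n m} {D : ℕ} {B : ℝ≥0} {N : Nodes} {K v : ℕ} {σ τ : State}

/-- The part of the memory that does not change during the computation for the flow value `v`. -/
structure Ctx (G : Network n m) (D : ℕ) (B : ℝ≥0) (N : Nodes) (K v : ℕ) (σ : State) : Prop where
  env : Env G D B σ
  nodes : Nodes.of σ = N
  K_eq : σ.nat rK 0 = K
  v_eq : σ.nat rV 0 = v
  W_eq : σ.nat rW 0 = 2 * v + 1
  vm : ∀ i ≤ 2, σ.nat aVm i = v * i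

theorem Ctx.frame (h : Ctx G D B N K v σ) {P : Prog} (hf : Frame P σ τ)
    (hN : P.writesN.all (fun c => c = aOut ∨ c = aAns ∨ 50 ≤ c) = true)
    (hC : P.writesC.all (2 ≤ ·) = true) : Ctx G D B N K v τ := by
  have key : ∀ a, 6 ≤ a ∧ a < 50 → τ.nat a = σ.nat a := fun a ha => hf.nat a fun h' => by
    have := List.all_eq_true.1 hN a h'
    simp at this
    omega
  refine ⟨h.env.frame hf ?_ hC, ?_, ?_, ?_, ?_, ?_⟩
  · rw [List.all_eq_true] at hN ⊢
    intro a ha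
    have := hN a ha
    simp at this ⊢
    omega
  · rw [← h.nodes]
    simp only [Nodes.of]
    rw [key _ (by norm_num), key _ (by norm_num), key _ (by norm_num), key _ (by norm_num)]
  · rw [key _ (by norm_num)]; exact h.K_eq
  · rw [key _ (by norm_num)]; exact h.v_eq
  · rw [key _ (by norm_num)]; exact h.W_eq
  · rw [key _ (by norm_num)]; exact h.vm

/-- A cost that is stored together with a flag that tells whether it is finite. -/
noncomputable def flagged (ok : ℕ) (c : ℝ≥0) : ENNReal := if ok = 1 then c else ⊤

/-- The entry `p` of the table describes the minimum of the first `i` candidates for the value of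
the node `k` at `x`. -/
def Entry (G : Network n m) (N : Nodes) (v p k x i : ℕ) (σ : State) : Prop :=
  ∀ T : Tree n m, Rep G N T k →
    flagged (σ.nat aFin p) (σ.cst tCost p) = (Finset.range i).inf (Tree.cand G v T x) ∧
    (σ.nat aFin p = 1 → σ.nat aCh p < i ∧ Tree.cand G v T x (σ.nat aCh p) =
      flagged (σ.nat aFin p) (σ.cst tCost p))

/-- All entries of the table before the position `p` are correct. -/
def Filled (G : Network n m) (N : Nodes) (v p : ℕ) (σ : State) : Prop :=
  ∀ k x, x ≤ 2 * v → k * (2 * v + 1) + x < p →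
    Entry G N v (k * (2 * v + 1) + x) k x (2 * v + 1) σ

theorem Filled.val {p k x : ℕ} {T : Tree n m} (h : Filled G N v p σ) (hx : x ≤ 2 * v)
    (hp : k * (2 * v + 1) + x < p) (hT : Rep G N T k) :
    flagged (σ.nat aFin (k * (2 * v + 1) + x)) (σ.cst tCost (k * (2 * v + 1) + x)) =
      Tree.val G v T x := by
  rw [Tree.val_eq]; exact (h k x hx hp T hT).1

/-- The value of the current candidate. -/
noncomputable def current (σ : State) : ENNReal := flagged (σ.nat rOk 0) (σ.cst rCost 0)

theorem current_skip (h0 : σ.nat rOk 0 = 0) : current (Prog.skip.sem σ) = ⊤ := by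
  simp [current, flagged, Prog.sem, h0]

theorem current_block (σ : State) (c : CExpr) :
    current ((block [setC rCost 0 c, setR rOk 1]).sem σ) = c.eval σ := by
  simp [current, flagged]

theorem current_loadOne (p : NExpr) (h0 : σ.nat rOk 0 = 0) : current ((loadOne p).sem σ) =
    flagged (σ.nat aFin (p.eval σ)) (σ.cst tCost (p.eval σ)) := by
  rw [loadOne, Prog.sem]
  split_ifs with h
  · have h' : σ.nat aFin (p.eval σ) = 1 := h
    rw [current_block]; simp [flagged, h', CExpr.eval]
  · have h' : ¬ σ.nat aFin (p.eval σ) = 1 := h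
    rw [current_skip h0]; simp [flagged, h']

theorem current_loadTwo (p q : NExpr) (h0 : σ.nat rOk 0 = 0) : current ((loadTwo p q).sem σ) =
    flagged (σ.nat aFin (p.eval σ)) (σ.cst tCost (p.eval σ)) +
      flagged (σ.nat aFin (q.eval σ)) (σ.cst tCost (q.eval σ)) := by
  rw [loadTwo, Prog.sem]
  split_ifs with h
  · have h' : σ.nat aFin (p.eval σ) = 1 ∧ σ.nat aFin (q.eval σ) = 1 := h
    rw [current_block]; simp [flagged, h', CExpr.eval]
  · have h' : ¬ (σ.nat aFin (p.eval σ) = 1 ∧ σ.nat aFin (q.eval σ) = 1) := h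
    rw [current_skip h0]
    by_cases h1 : σ.nat aFin (p.eval σ) = 1
    · have h2 : ¬ σ.nat aFin (q.eval σ) = 1 := fun h => h' ⟨h1, h⟩
      simp [flagged, h2]
    · simp [flagged, h1]

/-- The array `aVm` replaces multiplication by `v`: one more than a supply is `0`, `1`, or `2`. -/
theorem Rep.vm {T : Tree n m} {k : ℕ} (h : Rep G N T k) (hC : Ctx G D B N K v σ) :
    (σ.nat aVm (N.sg k) : ℤ) = v * (G.supply T.verts + 1) := by
  have h1 := h.sg
  have h2 := G.supply_bounds T.verts
  rw [hC.vm _ (by omega)]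
  push_cast
  rw [h1]

/-- The program computes the candidates of `Tree.cand`, if the table contains the values of the
preceding nodes. -/
theorem candidate_spec (hC : Ctx G D B N K v σ) {k x y : ℕ} (hk : σ.nat rJ 0 = k)
    (hx : σ.nat rX 0 = x) (hy : σ.nat rY 0 = y) (hxv : x ≤ 2 * v) (hyv : y ≤ 2 * v)
    (hoff : ∀ i ≤ k, σ.nat aOff i = i * (2 * v + 1))
    (hF : Filled G N v (k * (2 * v + 1) + x) σ) {T : Tree n m} (hT : Rep G N T k) :
    current (candidate.sem σ) = Tree.cand G v T x y := by
  have hfill : ∀ j < k, ∀ z ≤ 2 * v, j * (2 * v + 1) + z < k * (2 * v + 1) + x := by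
    intro j hj z hz
    have : (j + 1) * (2 * v + 1) ≤ k * (2 * v + 1) := Nat.mul_le_mul_right _ hj
    rw [Nat.add_mul] at this
    omega
  have e1 : ∀ c, c ≠ rOk → ((setR rOk 0).sem σ).nat c = σ.nat c := fun c hc => by simp [hc]
  have e2 : ((setR rOk 0).sem σ).cst = σ.cst := by simp
  have e0 : ((setR rOk 0).sem σ).nat rOk 0 = 0 := by simp
  have hs : ∀ P, (seq (setR rOk 0) P).sem σ = P.sem ((setR rOk 0).sem σ) := fun P => rfl
  rw [candidate, hs]
  generalize (setR rOk 0).sem σ = ρ at e1 e2 e0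
  have hρ : Ctx G D B N K v ρ := by
    refine ⟨⟨fun a ha => ?_, fun a ha => ?_⟩, ?_, ?_, ?_, ?_, ?_⟩
    · rw [e1 a (by omega), hC.env.nat a ha]
    · rw [e2, hC.env.cst a ha]
    · rw [← hC.nodes, Nodes.of, e1 _ (by decide), e1 _ (by decide), e1 _ (by decide),
        e1 _ (by decide), Nodes.of]
    · rw [e1 _ (by decide), hC.K_eq]
    · rw [e1 _ (by decide), hC.v_eq]
    · rw [e1 _ (by decide), hC.W_eq]
    · rw [e1 _ (by decide)]; exact hC.vm
  rw [← e1 rJ (by decide)] at hk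
  rw [← e1 rX (by decide)] at hx
  rw [← e1 rY (by decide)] at hy
  rw [← e1 aOff (by decide)] at hoff
  have hF' : Filled G N v (k * (2 * v + 1) + x) ρ := by
    intro j z hz hp T hT
    rw [e1 aFin (by decide), e1 aCh (by decide), e2]
    exact hF j z hz hp T hT
  have hty : ∀ i : ℕ, (Test.eq (get aTy (reg rJ)) (OfNat.ofNat i)).Holds ρ ↔ N.ty k = i := by
    intro i; rw [← hρ.nodes, ← hk]; rfl
  have hc₁ : child₁.eval ρ = N.c₁ k := by rw [← hρ.nodes, ← hk]; rfl
  have hc₂ : child₂.eval ρ = N.c₂ k := by rw [← hρ.nodes, ← hk]; rfl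
  have hsh : shift.eval ρ = ρ.nat aVm (N.sg (N.c₁ k)) := by
    rw [shift, eval_get, eval_get, hc₁, ← hρ.nodes]; rfl
  have ht : ∀ (i : ℕ) (P Q : Prog), (ite (.eq (get aTy (reg rJ)) (OfNat.ofNat i)) P Q).sem ρ =
      if N.ty k = i then P.sem ρ else Q.sem ρ := by
    intro i P Q
    rw [Prog.sem]
    by_cases h : N.ty k = i
    · rw [if_pos ((hty i).2 h), if_pos h]
    · rw [if_neg (fun h' => h ((hty i).1 h')), if_neg h]
  cases T with
  | nil u =>
    rw [ht 0, if_pos hT.1, current_block]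
    simp [Tree.cand, CExpr.eval]
  | edge e =>
    have hE := hρ.env
    rw [ht 0, if_neg (by rw [hT.1]; decide), ht 1, if_pos hT.1, candEdge, Prog.sem]
    simp only [Test.Holds, eval_reg, hx, hy, Tree.cand]
    by_cases t1 : y = x
    · rw [if_pos t1, if_pos t1, Prog.sem]
      simp only [Test.Holds, eval_reg, hx, hρ.v_eq]
      by_cases t2 : x = v
      · rw [if_pos t2, if_pos t2, current_block]; simp [CExpr.eval]
      · rw [if_neg t2, if_neg t2, Prog.sem]
        simp only [Test.Holds, eval_reg, eval_add, eval_get, hx, hρ.v_eq, hc₁, hT.2.1, hE.cap_eq,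
          not_lt]
        split_ifs with t3
        · rw [current_block, CExpr.eval, hc₁, hT.2.1, hE.cost_eq]
        · exact current_skip e0
    · rw [if_neg t1, if_neg t1]
      exact current_skip e0
  | rev T =>
    obtain ⟨a1, a2, a3, a4⟩ := hT
    have a5 := a3.vm hρ
    rw [ht 0, if_neg (by rw [a1]; decide), ht 1, if_neg (by rw [a1]; decide), ht 2, if_pos a1,
      candRev, Prog.sem]
    simp only [Test.Holds, eval_reg, eval_add, hx, hy, hsh, hρ.v_eq, Tree.cand]
    rw [← a5]
    split_ifs with t1 t2 t2
    · rw [current_loadOne _ e0, eval_add, eval_get, hc₁, eval_reg, hy, hoff _ a2.le]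
      exact hF'.val hyv (hfill _ a2 _ hyv) a3
    · omega
    · omega
    · exact current_skip e0
  | ser T₁ T₂ =>
    obtain ⟨a1, a2, a2', a3, a3', a4⟩ := hT
    have a5 := a3.vm hρ
    rw [ht 0, if_neg (by rw [a1]; decide), ht 1, if_neg (by rw [a1]; decide), ht 2,
      if_neg (by rw [a1]; decide), ht 3, if_pos a1, candSer, Prog.sem]
    simp only [Test.Holds, eval_reg, eval_add, hx, hy, hsh, hρ.v_eq, Tree.cand]
    rw [← a5]
    split_ifs with t1 t2 t2
    · rw [current_loadTwo _ _ e0, eval_add, eval_get, hc₁, eval_reg, hx, hoff _ a2.le, eval_add,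
        eval_get, hc₂, eval_reg, hy, hoff _ a2'.le, hF'.val hxv (hfill _ a2 _ hxv) a3,
        hF'.val hyv (hfill _ a2' _ hyv) a3']
    · omega
    · omega
    · exact current_skip e0
  | par T₁ T₂ =>
    obtain ⟨a1, a2, a2', a3, a3', a4⟩ := hT
    rw [ht 0, if_neg (by rw [a1]; decide), ht 1, if_neg (by rw [a1]; decide), ht 2,
      if_neg (by rw [a1]; decide), ht 3, if_neg (by rw [a1]; decide), ht 4, if_pos a1, candPar,
      Prog.sem]
    simp only [Test.Holds, eval_reg, eval_add, hx, hy, hρ.v_eq, Tree.cand]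
    split_ifs with t1 t2 t2
    · have hz : x + v - y ≤ 2 * v := by omega
      rw [current_loadTwo _ _ e0, eval_add, eval_get, hc₁, eval_reg, hy, hoff _ a2.le, eval_add,
        eval_get, hc₂, eval_sub, eval_add, eval_reg, eval_reg, eval_reg, hx, hy, hρ.v_eq,
        hoff _ a2'.le, hF'.val hyv (hfill _ a2 _ hyv) a3, hF'.val hz (hfill _ a2' _ hz) a3']
    · omega
    · omega
    · exact current_skip e0
  | close T =>
    obtain ⟨a1, a2, a3, a4⟩ := hT
    have a5 := a3.vm hρ
    rw [ht 0, if_neg (by rw [a1]; decide), ht 1, if_neg (by rw [a1]; decide), ht 2,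
      if_neg (by rw [a1]; decide), ht 3, if_neg (by rw [a1]; decide), ht 4,
        if_neg (by rw [a1]; decide),
      candClose, Prog.sem]
    simp only [Test.Holds, eval_reg, eval_add, hy, hsh, hρ.v_eq, Tree.cand]
    rw [← a5]
    split_ifs with t1 t2 t2
    · rw [current_loadOne _ e0, eval_add, eval_get, hc₁, eval_reg, hy, hoff _ a2.le]
      exact hF'.val hyv (hfill _ a2 _ hyv) a3
    · omega
    · omega
    · exact current_skip e0

/-- Taking one more candidate into account. -/
theorem improve_spec {p k x y : ℕ} (hp : σ.nat rPos 0 = p) (hy : σ.nat rY 0 = y)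
    (hc : ∀ T : Tree n m, Rep G N T k → current σ = Tree.cand G v T x y)
    (h : Entry G N v p k x y σ) : Entry G N v p k x (y + 1) (improve.sem σ) ∧
      ∀ q, q ≠ p → (improve.sem σ).nat aFin q = σ.nat aFin q ∧
        (improve.sem σ).nat aCh q = σ.nat aCh q ∧ (improve.sem σ).cst tCost q = σ.cst tCost q := by
  have ht : (Test.and (.eq (reg rOk) 1) (.not (.and (.eq (get aFin (reg rPos)) 1)
      (.costLe (.get tCost (reg rPos)) (.get rCost 0))))).Holds σ ↔
      σ.nat rOk 0 = 1 ∧ ¬ (σ.nat aFin p = 1 ∧ σ.cst tCost p ≤ σ.cst rCost 0) := by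
    rw [← hp]; rfl
  rw [improve, Prog.sem]
  split_ifs with t1 <;> rw [ht] at t1
  · refine ⟨fun T hT => ?_, fun q hq => ?_⟩
    · obtain ⟨h1, h2⟩ := h T hT
      have h3 := hc T hT
      have h4 : flagged 1 (σ.cst rCost 0) = Tree.cand G v T x y := by
        rw [← h3, current, t1.1]
      rw [Finset.range_add_one, Finset.inf_insert, ← h1, ← h4]
      have h5 : flagged 1 (σ.cst rCost 0) ≤ flagged (σ.nat aFin p) (σ.cst tCost p) := by
        unfold flagged
        rw [if_pos rfl]
        by_cases h6 : σ.nat aFin p = 1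
        · have := not_le.1 fun h7 => t1.2 ⟨h6, h7⟩
          rw [if_pos h6]
          exact_mod_cast this.le
        · rw [if_neg h6]; exact le_top
      rw [inf_eq_left.2 h5]
      simp [hp, hy, CExpr.eval, h4]
    · simp [hp, hq, CExpr.eval]
  · refine ⟨fun T hT => ?_, fun q hq => ⟨rfl, rfl, rfl⟩⟩
    obtain ⟨h1, h2⟩ := h T hT
    have h3 := hc T hT
    have h5 : flagged (σ.nat aFin p) (σ.cst tCost p) ≤ Tree.cand G v T x y := by
      rw [← h3, current]
      unfold flagged
      by_cases h6 : σ.nat rOk 0 = 1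
      · rw [if_pos h6]
        have : σ.nat aFin p = 1 ∧ σ.cst tCost p ≤ σ.cst rCost 0 := by
          by_contra h7; exact t1 ⟨h6, h7⟩
        rw [if_pos this.1]
        exact_mod_cast this.2
      · rw [if_neg h6]; exact le_top
    rw [Finset.range_add_one, Finset.inf_insert, ← h1, inf_eq_right.2 h5]
    exact ⟨rfl, fun h6 => ⟨(h2 h6).1.trans (by omega), (h2 h6).2⟩⟩

theorem Filled.of_eq {p : ℕ} (h : Filled G N v p σ) (h' : ∀ q < p, τ.nat aFin q = σ.nat aFin q ∧
    τ.nat aCh q = σ.nat aCh q ∧ τ.cst tCost q = σ.cst tCost q) : Filled G N v p τ := by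
  intro k x hx hp T hT
  obtain ⟨h1, h2, h3⟩ := h' _ hp
  rw [h1, h2, h3]
  exact h k x hx hp T hT

/-- The state of the computation of the table when the position `p` in the row of the node `k` is
reached. -/
structure Partial (G : Network n m) (D : ℕ) (B : ℝ≥0) (N : Nodes) (K v k x : ℕ) (σ : State) :
    Prop where
  ctx : Ctx G D B N K v σ
  j_eq : σ.nat rJ 0 = k
  off : ∀ i ≤ k, σ.nat aOff i = i * (2 * v + 1)
  filled : Filled G N v (k * (2 * v + 1) + x) σ

theorem Partial.frame {k x : ℕ} (h : Partial G D B N K v k x σ) {P : Prog} (hf : Frame P σ τ)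
    (hN : P.writesN.all (fun c => 50 ≤ c ∧ c ∉ [50, 56]) = true)
    (hC : P.writesC.all (2 ≤ ·) = true)
    (h' : ∀ q < k * (2 * v + 1) + x, τ.nat aFin q = σ.nat aFin q ∧
      τ.nat aCh q = σ.nat aCh q ∧ τ.cst tCost q = σ.cst tCost q) :
    Partial G D B N K v k x τ := by
  have key : ∀ c ∈ [50, 56], τ.nat c = σ.nat c := fun c hc => hf.nat c fun h' => by
    have := List.all_eq_true.1 hN c h'
    simp only [decide_eq_true_eq] at this
    exact this.2 hc
  refine ⟨h.ctx.frame hf ?_ hC, ?_, ?_, h.filled.of_eq h'⟩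
  · rw [List.all_eq_true] at hN ⊢
    intro a ha
    have := hN a ha
    simp at this ⊢
    omega
  · rw [key _ (by simp)]; exact h.j_eq
  · rw [key _ (by simp)]; exact h.off

theorem fillEntry_spec {k x : ℕ} (h : Partial G D B N K v k x σ) (hX : σ.nat rX 0 = x)
    (hx : x ≤ 2 * v) : Runs fillEntry σ (1000 * (v + 1)) fun τ =>
      Partial G D B N K v k (x + 1) τ ∧ τ.nat rX 0 = x := by
  set p := k * (2 * v + 1) + x with hp
  refine (Runs.seq (b₁ := 40) (Runs.simple (R := fun τ => Partial G D B N K v k x τ ∧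
      τ.nat rX 0 = x ∧ τ.nat rPos 0 = p ∧ τ.nat rY 0 = 0 ∧ Entry G N v p k x 0 τ) rfl rfl ?_)
    fun τ hτ _ => Runs.count rfl 400 (c := 430) (by norm_num) (2 * v + 1)
      (fun i τ => Partial G D B N K v k x τ ∧ τ.nat rX 0 = x ∧ τ.nat rPos 0 = p ∧ τ.nat rY 0 = i ∧
        Entry G N v p k x i τ) ?_ ?_ hτ).mono (by omega) ?_
  · have hoff := h.off k le_rfl
    refine ⟨h.frame (Frame.sem rfl σ) rfl rfl ?_, ?_, ?_, ?_, ?_⟩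
    · intro q hq
      have : q ≠ p := hq.ne
      simp [h.j_eq, hoff, hX, ← hp, this]
    · simp [hX]
    · simp [hX, h.j_eq, hoff, hp]
    · simp
    · intro T hT
      simp [hX, h.j_eq, hoff, ← hp, flagged]
  · rintro i τ hi ⟨h1, -, -, h2, -⟩
    simp only [Test.Holds, eval_reg, h1.ctx.W_eq, h2]
  · rintro i τ hi ⟨h1, h2, h3, h4, h5⟩
    refine Runs.simple rfl rfl ?_
    have hs : (block [candidate, improve, setR rY (reg rY + 1)]).sem τ =
      (setR rY (reg rY + 1)).sem (improve.sem (candidate.sem τ)) := rfl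
    rw [hs]
    have hc := fun T => candidate_spec h1.ctx h1.j_eq h2 h4 hx (by omega) h1.off h1.filled (T := T)
    have hf₁ : Frame candidate τ (candidate.sem τ) := Frame.sem rfl τ
    have e1 : ∀ c, c ≠ rOk → (candidate.sem τ).nat c = τ.nat c := fun c hc => hf₁.nat c (by
      simp [candidate, candEdge, candRev, candSer, candPar, candClose, loadOne, loadTwo, block,
        setR, Prog.writesN, hc])
    have e2 : (candidate.sem τ).cst tCost = τ.cst tCost := hf₁.cst _ (by decide)
    have h5' : Entry G N v p k x i (candidate.sem τ) := by
      intro T hT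
      rw [e1 _ (by decide), e1 _ (by decide), e2]
      exact h5 T hT
    obtain ⟨g1, g2⟩ := improve_spec (by rw [e1 _ (by decide), h3]) (by rw [e1 _ (by decide), h4])
      hc h5'
    have hf₂ : Frame improve (candidate.sem τ) (improve.sem (candidate.sem τ)) := Frame.sem rfl _
    have hf : Frame (block [candidate, improve, setR rY (reg rY + 1)]) τ
        ((setR rY (reg rY + 1)).sem (improve.sem (candidate.sem τ))) := Frame.sem rfl τ
    refine ⟨h1.frame hf rfl rfl ?_, ?_, ?_, ?_, ?_⟩
    · intro q hq
      obtain ⟨g3, g4, g5⟩ := g2 q hq.ne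
      simp [g3, g4, g5, e1, e2]
    · rw [hf.nat _ (by decide), h2]
    · rw [hf.nat _ (by decide), h3]
    · simp only [sem_setR, storeN_nat, if_true, Function.update_self, eval_add, eval_reg,
        eval_ofNat]
      rw [hf₂.nat _ (by decide), hf₁.nat _ (by decide), h4]
    · intro T hT
      simpa using g1 T hT
  · rintro τ ⟨h1, h2, -, -, h3⟩
    refine ⟨⟨h1.ctx, h1.j_eq, h1.off, fun k' x' hx' hp' => ?_⟩, h2⟩
    rcases Nat.lt_or_eq_of_le (show k' * (2 * v + 1) + x' ≤ k * (2 * v + 1) + x by omega) with h | h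
    · exact h1.filled k' x' hx' h
    · have hk : k' = k := by
        have a1 : (k' * (2 * v + 1) + x') / (2 * v + 1) = (k * (2 * v + 1) + x) / (2 * v + 1) := by
          rw [h]
        rwa [mul_comm, Nat.mul_add_div (by omega), Nat.div_eq_of_lt (by omega), mul_comm,
          Nat.mul_add_div (by omega), Nat.div_eq_of_lt (by omega)] at a1
      subst hk
      obtain rfl : x' = x := by omega
      exact h3

theorem fillRow_spec {k : ℕ} (h : Partial G D B N K v k 0 σ) :
    Runs fillRow σ (4000 * (v + 1) ^ 2) fun τ => Partial G D B N K v k (2 * v + 1) τ ∧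
      τ.nat aOff (k + 1) = (k + 1) * (2 * v + 1) := by
  refine (Runs.seq (b₁ := 40) (Runs.simple (R := fun τ => Partial G D B N K v k 0 τ ∧
      τ.nat rX 0 = 0 ∧ τ.nat aOff (k + 1) = (k + 1) * (2 * v + 1)) rfl rfl ?_)
    fun τ hτ _ => Runs.count rfl (1000 * (v + 1) + 20) (c := 1000 * (v + 1) + 50) (by omega)
      (2 * v + 1)
      (fun i τ => Partial G D B N K v k i τ ∧ τ.nat rX 0 = i ∧
        τ.nat aOff (k + 1) = (k + 1) * (2 * v + 1)) ?_ ?_ hτ).mono (by nlinarith) ?_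
  · refine ⟨⟨h.ctx.frame (Frame.sem rfl σ) rfl rfl, by simp [h.j_eq], fun i hi => ?_,
      h.filled.of_eq fun q _ => by simp⟩, by simp, ?_⟩
    · have : i ≠ k + 1 := by omega
      simpa [h.j_eq, this] using h.off i hi
    · simp [h.j_eq, h.off k le_rfl, h.ctx.W_eq]; ring
  · rintro i τ hi ⟨h1, h2, -⟩
    simp only [Test.Holds, eval_reg, h1.ctx.W_eq, h2]
  · rintro i τ hi ⟨h1, h2, h3⟩
    refine (fillEntry_spec h1 h2 (by omega)).seq fun ρ ⟨g1, g2⟩ hf =>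
      Runs.simple rfl rfl ⟨g1.frame (Frame.sem rfl ρ) rfl rfl fun q _ => by simp, by simp [g2], ?_⟩
    rw [(Frame.sem rfl ρ).nat _ (by decide), hf.nat _ (by decide), h3]
  · rintro τ ⟨h1, -, h2⟩
    exact ⟨h1, h2⟩

/-- The table is filled in time `O((K + 1) (v + 1)²)`. -/
theorem fillTable_spec (h : Ctx G D B N K v σ) :
    Runs fillTable σ (5000 * ((K + 1) * (v + 1) ^ 2)) fun τ => Ctx G D B N K v τ ∧
      (∀ i ≤ K, τ.nat aOff i = i * (2 * v + 1)) ∧ Filled G N v (K * (2 * v + 1)) τ := by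
  refine (Runs.seq (b₁ := 20) (Runs.simple (R := fun τ => Partial G D B N K v 0 0 τ) rfl rfl ?_)
    fun τ hτ _ => Runs.count rfl (4000 * (v + 1) ^ 2 + 20) (c := 4000 * (v + 1) ^ 2 + 50) (by omega)
      K (fun i τ => Partial G D B N K v i 0 τ) ?_ ?_ hτ).mono ?_ ?_
  · refine ⟨h.frame (Frame.sem rfl σ) rfl rfl, by simp, fun i hi => ?_, fun k x _ hp => ?_⟩
    · obtain rfl : i = 0 := by omega
      simp
    · omega
  · rintro i τ hi h1
    simp only [Test.Holds, eval_reg, h1.ctx.K_eq, h1.j_eq]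
  · rintro i τ hi h1
    refine (fillRow_spec h1).seq fun ρ ⟨g1, g2⟩ hf =>
      Runs.simple rfl rfl ⟨g1.ctx.frame (Frame.sem rfl ρ) rfl rfl, by simp [g1.j_eq],
        fun j hj => ?_, ?_⟩
    · rcases Nat.lt_succ_iff_lt_or_eq.1 (Nat.lt_succ_of_le hj) with h | rfl
      · simpa using g1.off j (by omega)
      · simpa using g2
    · have := g1.filled
      rw [show i * (2 * v + 1) + (2 * v + 1) = (i + 1) * (2 * v + 1) + 0 by ring] at this
      exact this.of_eq fun q _ => by simp
  · have : 1 ≤ (v + 1) ^ 2 := Nat.one_le_pow _ _ (by omega)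
    nlinarith
  · exact fun τ h1 => ⟨h1.ctx, h1.off, h1.filled⟩

end SPNet

namespace SPNet

open NExpr (get)
open Prog (setN setC ite block seq)

/-! ### Backtracking -/

notation "aStkN" => (60 : ℕ)
notation "aStkX" => (61 : ℕ)
notation "rTop" => (62 : ℕ)
notation "rE" => (63 : ℕ)
notation "rN" => (64 : ℕ)
notation "rXx" => (65 : ℕ)
notation "rYy" => (66 : ℕ)

/-- Select no edges. -/
def clear : Prog :=
  seq (setR rE 0) (.loop (.lt (reg rE) (get aPar 1))
    (block [setN aOut (reg rE) 0, setR rE (reg rE + 1)]))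

/-- Put the node `k` at `x` on the stack of the nodes that are still to be treated. -/
def pushNode (k x : NExpr) : Prog :=
  block [setN aStkN (reg rTop) k, setN aStkX (reg rTop) x, setR rTop (reg rTop + 1)]

/-- Take a node and an index from the stack, and look up the candidate that attains the minimum. -/
def popNode : Prog :=
  block [setR rTop (reg rTop - 1), setR rN (get aStkN (reg rTop)),
    setR rXx (get aStkX (reg rTop)), setR rYy (get aCh (get aOff (reg rN) + reg rXx))]

/-- Select the edge of the node that has been taken from the stack, if it is an edge that is used,
or put its children on the stack. Reversals and pieces that are attached at one end have one
child. -/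
def expand : Prog :=
  ite (.eq (get aTy (reg rN)) 0) .skip
  (ite (.eq (get aTy (reg rN)) 1)
    (ite (.eq (reg rXx) (reg rV)) .skip (setN aOut (get aC1 (reg rN)) 1))
  (ite (.eq (get aTy (reg rN)) 3)
    (block [pushNode (get aC2 (reg rN)) (reg rYy), pushNode (get aC1 (reg rN)) (reg rXx)])
  (ite (.eq (get aTy (reg rN)) 4)
    (block [pushNode (get aC2 (reg rN)) (reg rXx + reg rV - reg rYy),
      pushNode (get aC1 (reg rN)) (reg rYy)])
  (pushNode (get aC1 (reg rN)) (reg rYy)))))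

/-- Write a selection of edges that realizes the value of the root to the output. -/
def backtrack : Prog :=
  seq clear (seq (block [setR rTop 0, pushNode (reg rRoot) 0])
    (.loop (.lt 0 (reg rTop)) (seq popNode expand)))

variable {n m : ℕ} {G : Network n m} {D : ℕ} {B : ℝ≥0} {N : Nodes} {K v : ℕ} {σ τ : State}

/-- The table is complete. -/
structure Table (G : Network n m) (D : ℕ) (B : ℝ≥0) (N : Nodes) (K v : ℕ) (σ : State) : Prop where
  ctx : Ctx G D B N K v σ
  off : ∀ i ≤ K, σ.nat aOff i = i * (2 * v + 1)
  filled : Filled G N v (K * (2 * v + 1)) σ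

theorem Table.frame (h : Table G D B N K v σ) {P : Prog} (hf : Frame P σ τ)
    (hN : P.writesN.all (fun c => c = aOut ∨ c = aAns ∨ 60 ≤ c) = true)
    (hC : P.writesC = []) : Table G D B N K v τ := by
  have key : ∀ a, 6 ≤ a ∧ a < 60 → τ.nat a = σ.nat a := fun a ha => hf.nat a fun h' => by
    have := List.all_eq_true.1 hN a h'
    simp at this
    omega
  refine ⟨h.ctx.frame hf ?_ (by simp [hC]), ?_, h.filled.of_eq fun q _ => ⟨?_, ?_, ?_⟩⟩
  · rw [List.all_eq_true] at hN ⊢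
    intro a ha
    have := hN a ha
    simp at this ⊢
    omega
  · rw [key _ (by norm_num)]; exact h.off
  · rw [key _ (by norm_num)]
  · rw [key _ (by norm_num)]
  · rw [hf.cst _ (by simp [hC])]

theorem position_lt {k x : ℕ} (hk : k < K) (hx : x ≤ 2 * v) :
    k * (2 * v + 1) + x < K * (2 * v + 1) := by
  have : (k + 1) * (2 * v + 1) ≤ K * (2 * v + 1) := Nat.mul_le_mul_right _ hk
  rw [Nat.add_mul] at this
  omega

/-- The candidate that is recorded in the table attains the minimum, if this is finite. -/
theorem Table.choice (h : Table G D B N K v σ) {T : Tree n m} {k x : ℕ} (hT : Rep G N T k)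
    (hk : k < K) (hx : x ≤ 2 * v) (hfin : T.val G v x ≠ ⊤) :
    σ.nat aCh (k * (2 * v + 1) + x) ≤ 2 * v ∧
      T.cand G v x (σ.nat aCh (k * (2 * v + 1) + x)) = T.val G v x := by
  obtain ⟨h1, h2⟩ := h.filled k x hx (position_lt hk hx) T hT
  rw [← Tree.val_eq] at h1
  have h3 : σ.nat aFin (k * (2 * v + 1) + x) = 1 := by
    by_contra h3
    exact hfin (by rw [← h1, flagged, if_neg h3])
  obtain ⟨h4, h5⟩ := h2 h3
  exact ⟨by omega, h5.trans h1⟩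

/-- The stack consists of the roots of the trees of a list, each together with a number. -/
def OnStack (G : Network n m) (N : Nodes) (K v : ℕ) (sN sX : ℕ → ℕ) :
    List (Tree n m × ℕ) → ℕ → Prop
  | [], s => s = 0
  | (T, x) :: L, s => ∃ r, s = r + 1 ∧ Rep G N T (sN r) ∧ sN r < K ∧ sX r = x ∧ x ≤ 2 * v ∧
      T.val G v x ≠ ⊤ ∧ OnStack G N K v sN sX L r

theorem OnStack.congr {sN sX sN' sX' : ℕ → ℕ} {L : List (Tree n m × ℕ)} {s : ℕ}
    (h : OnStack G N K v sN sX L s) (h' : ∀ r < s, sN' r = sN r ∧ sX' r = sX r) :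
    OnStack G N K v sN' sX' L s := by
  induction L generalizing s with
  | nil => exact h
  | cons a L ih =>
    obtain ⟨r, rfl, h1, h2, h3, h4, h5, h6⟩ := h
    obtain ⟨e1, e2⟩ := h' r (by omega)
    exact ⟨r, rfl, by rwa [e1], by rwa [e1], by rwa [e2], h4, h5,
      ih h6 fun j hj => h' j (by omega)⟩

theorem OnStack.push {L : List (Tree n m × ℕ)} {T : Tree n m} {k x : NExpr}
    (h : OnStack G N K v (σ.nat aStkN) (σ.nat aStkX) L (σ.nat rTop 0))
    (hT : Rep G N T (k.eval σ)) (hk : k.eval σ < K)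
    (hx' : x.eval (σ.storeN aStkN (σ.nat rTop 0) (k.eval σ)) = x.eval σ)
    (hx : x.eval σ ≤ 2 * v) (hfin : T.val G v (x.eval σ) ≠ ⊤) :
    OnStack G N K v (((pushNode k x).sem σ).nat aStkN) (((pushNode k x).sem σ).nat aStkX)
      ((T, x.eval σ) :: L) (((pushNode k x).sem σ).nat rTop 0) := by
  refine ⟨σ.nat rTop 0, by simp [pushNode], ?_, ?_, ?_, hx, hfin, h.congr fun r hr => ?_⟩
  · simpa [pushNode] using hT
  · simpa [pushNode] using hk
  · simp [pushNode, hx']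
  · simp [pushNode, hr.ne]

/-- Selections for all the trees of a list. -/
def SelAll (G : Network n m) (v : ℕ) : List (Tree n m × ℕ) → Finset (Fin m) → Prop
  | [], U => U = ∅
  | (T, x) :: L, U => ∃ U₁ U₂, U = U₁ ∪ U₂ ∧ T.Sel G v x U₁ ∧ SelAll G v L U₂

/-- The invariant of the backtracking: the output and selections for the trees on the stack together
form a selection for the root `T`. -/
structure Back (G : Network n m) (D : ℕ) (B : ℝ≥0) (N : Nodes) (K v : ℕ) (T : Tree n m)
    (L : List (Tree n m × ℕ)) (σ : State) : Prop where
  table : Table G D B N K v σ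
  stack : OnStack G N K v (σ.nat aStkN) (σ.nat aStkX) L (σ.nat rTop 0)
  sel : ∀ U, SelAll G v L U → T.Sel G v 0 (σ.outputEdges m ∪ U)

theorem clear_spec (h : Table G D B N K v σ) : Runs clear σ (100 * (m + 1)) fun τ =>
    Table G D B N K v τ ∧ τ.outputEdges m = ∅ ∧ τ.nat rRoot = σ.nat rRoot := by
  refine (Runs.seq (b₁ := 20) (Runs.simple (R := fun τ => Table G D B N K v τ ∧ τ.nat rE 0 = 0 ∧
      (∀ j < 0, τ.nat aOut j = 0) ∧ τ.nat rRoot = σ.nat rRoot) rfl rfl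
      ⟨h.frame (Frame.sem rfl σ) rfl rfl, by simp, by simp, by simp⟩)
    fun τ hτ _ => Runs.count rfl 40 (c := 70) (by norm_num) m
      (fun i τ => Table G D B N K v τ ∧ τ.nat rE 0 = i ∧ (∀ j < i, τ.nat aOut j = 0) ∧
        τ.nat rRoot = σ.nat rRoot) ?_ ?_ hτ).mono (by omega) ?_
  · rintro i τ hi ⟨h1, h2, -⟩
    simp only [Test.Holds, eval_reg, eval_get, eval_ofNat, h1.ctx.env.m_eq, h2]
  · rintro i τ hi ⟨h1, h2, h3, h4⟩
    refine Runs.simple rfl rfl ⟨h1.frame (Frame.sem rfl τ) rfl rfl, by simp [h2], fun j hj => ?_,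
      by simpa⟩
    rcases Nat.lt_succ_iff_lt_or_eq.1 hj with h | rfl
    · simpa [h2, h.ne] using h3 j h
    · simp [h2]
  · rintro τ ⟨h1, -, h2, h3⟩
    refine ⟨h1, ?_, h3⟩
    ext e
    simp [State.outputEdges, h2 e e.2]

/-- The total size of the trees of a list. -/
def totalSize (L : List (Tree n m × ℕ)) : ℕ := (L.map fun p => p.1.size).sum

/-- Treating a node preserves the invariant and makes the total size of the trees on the stack
smaller. -/
theorem expand_spec {T₀ T : Tree n m} {L : List (Tree n m × ℕ)} {k x y : ℕ}
    (hB : Table G D B N K v σ)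
    (hL : OnStack G N K v (σ.nat aStkN) (σ.nat aStkX) L (σ.nat rTop 0))
    (hs : ∀ U, SelAll G v ((T, x) :: L) U → T₀.Sel G v 0 (σ.outputEdges m ∪ U))
    (hk : σ.nat rN 0 = k) (hx : σ.nat rXx 0 = x) (hy : σ.nat rYy 0 = y) (hkK : k < K)
    (hxv : x ≤ 2 * v) (hyv : y ≤ 2 * v) (hT : Rep G N T k) (hfin : T.val G v x ≠ ⊤)
    (hc : T.cand G v x y = T.val G v x) :
    ∃ L', totalSize L' < totalSize ((T, x) :: L) ∧ Back G D B N K v T₀ L' (expand.sem σ) := by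
  have hN := hB.ctx.nodes
  have ht : ∀ (i : ℕ) (P Q : Prog), (ite (.eq (get aTy (reg rN)) (OfNat.ofNat i)) P Q).sem σ =
      if N.ty k = i then P.sem σ else Q.sem σ := by
    intro i P Q
    rw [Prog.sem]
    have h : (Test.eq (get aTy (reg rN)) (OfNat.ofNat i)).Holds σ ↔ N.ty k = i := by
      rw [← hN, ← hk]; rfl
    by_cases h' : N.ty k = i
    · rw [if_pos (h.2 h'), if_pos h']
    · rw [if_neg (fun h'' => h' (h.1 h'')), if_neg h']
  have hc₁ : (get aC1 (reg rN)).eval σ = N.c₁ k := by rw [← hN, ← hk]; rfl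
  have hc₂ : (get aC2 (reg rN)).eval σ = N.c₂ k := by rw [← hN, ← hk]; rfl
  have hTab : Table G D B N K v (expand.sem σ) := hB.frame (Frame.sem rfl σ) rfl rfl
  cases T with
  | nil u =>
    refine ⟨L, by simp [totalSize, Tree.size], hTab, ?_, ?_⟩
    · rw [expand, ht 0, if_pos hT.1]; exact hL
    · rw [expand, ht 0, if_pos hT.1]
      exact fun U hU => hs U ⟨∅, U, by simp, .nil u x, hU⟩
  | edge e =>
    have hst : ∀ c, c ≠ aOut → (expand.sem σ).nat c = σ.nat c := by
      intro c hc
      rw [expand, ht 0, if_neg (by rw [hT.1]; decide), ht 1, if_pos hT.1, Prog.sem]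
      split_ifs
      · rfl
      · simp [hc]
    refine ⟨L, by simp [totalSize, Tree.size], hTab, ?_, ?_⟩
    · rw [hst _ (by decide), hst _ (by decide), hst _ (by decide)]; exact hL
    · rw [expand, ht 0, if_neg (by rw [hT.1]; decide), ht 1, if_pos hT.1, Prog.sem]
      simp only [Test.Holds, eval_reg, hx, hB.ctx.v_eq]
      split_ifs with hxv
      · subst hxv
        exact fun U hU => hs U ⟨∅, U, by simp, .edgeZero e, hU⟩
      · intro U hU
        have := hs ({e} ∪ U) ⟨{e}, U, rfl, .edge e x hxv, hU⟩
        convert this using 1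
        rw [← Finset.union_assoc]
        congr 1
        ext e'
        simp only [State.outputEdges, sem_setN, hc₁, hT.2.1, storeN_nat, Finset.mem_filter,
          Finset.mem_univ, true_and, if_true, Function.update_apply, Finset.mem_union,
          Finset.mem_singleton, eval_ofNat, Fin.val_inj]
        by_cases h : e' = e <;> simp [h]
  | rev T =>
    obtain ⟨a1, a2, a3, a4⟩ := hT
    have hsem : expand.sem σ = (pushNode (get aC1 (reg rN)) (reg rYy)).sem σ := by
      rw [expand, ht 0, if_neg (by rw [a1]; decide), ht 1, if_neg (by rw [a1]; decide), ht 3,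
        if_neg (by rw [a1]; decide), ht 4, if_neg (by rw [a1]; decide)]
    have hfin' : T.val G v y ≠ ⊤ := by
      rw [← hc] at hfin
      simp only [Tree.cand] at hfin
      split_ifs at hfin
      · exact hfin
      · exact absurd rfl hfin
    rw [hsem] at hTab ⊢
    refine ⟨(T, y) :: L, by simp [totalSize, Tree.size], hTab, ?_, ?_⟩
    · have := hL.push (T := T) (k := get aC1 (reg rN)) (x := reg rYy) (by rwa [hc₁])
        (by rw [hc₁]; omega) (by simp) (by simpa [hy]) (by simpa [hy])
      simpa only [eval_reg, hy] using this
    · rintro U ⟨U₁, U₂, rfl, h1, h2⟩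
      have := hs (U₁ ∪ U₂) ⟨U₁, U₂, rfl, .rev T x y U₁ hc h1, h2⟩
      simpa [State.outputEdges, pushNode] using this
  | close T =>
    obtain ⟨a1, a2, a3, a4⟩ := hT
    have hsem : expand.sem σ = (pushNode (get aC1 (reg rN)) (reg rYy)).sem σ := by
      rw [expand, ht 0, if_neg (by rw [a1]; decide), ht 1, if_neg (by rw [a1]; decide), ht 3,
        if_neg (by rw [a1]; decide), ht 4, if_neg (by rw [a1]; decide)]
    have hfin' : T.val G v y ≠ ⊤ := by
      rw [← hc] at hfin
      simp only [Tree.cand] at hfin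
      split_ifs at hfin
      · exact hfin
      · exact absurd rfl hfin
    rw [hsem] at hTab ⊢
    refine ⟨(T, y) :: L, by simp [totalSize, Tree.size], hTab, ?_, ?_⟩
    · have := hL.push (T := T) (k := get aC1 (reg rN)) (x := reg rYy) (by rwa [hc₁])
        (by rw [hc₁]; omega) (by simp) (by simpa [hy]) (by simpa [hy])
      simpa only [eval_reg, hy] using this
    · rintro U ⟨U₁, U₂, rfl, h1, h2⟩
      have := hs (U₁ ∪ U₂) ⟨U₁, U₂, rfl, .close T x y U₁ hc h1, h2⟩
      simpa [State.outputEdges, pushNode] using this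
  | ser T₁ T₂ =>
    obtain ⟨a1, a2, a2', a3, a3', a4⟩ := hT
    have hsem : expand.sem σ = (pushNode (get aC1 (reg rN)) (reg rXx)).sem
        ((pushNode (get aC2 (reg rN)) (reg rYy)).sem σ) := by
      rw [expand, ht 0, if_neg (by rw [a1]; decide), ht 1, if_neg (by rw [a1]; decide), ht 3,
        if_pos a1]
      rfl
    have hfin' : T₁.val G v x ≠ ⊤ ∧ T₂.val G v y ≠ ⊤ := by
      rw [← hc] at hfin
      simp only [Tree.cand] at hfin
      split_ifs at hfin
      · exact ENNReal.add_ne_top.1 hfin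
      · exact absurd rfl hfin
    rw [hsem] at hTab ⊢
    refine ⟨(T₁, x) :: (T₂, y) :: L, by simp [totalSize, Tree.size]; omega, hTab, ?_, ?_⟩
    · have h1 := hL.push (T := T₂) (k := get aC2 (reg rN)) (x := reg rYy) (by rwa [hc₂])
        (by rw [hc₂]; omega) (by simp) (by simpa [hy]) (by simpa [hy] using hfin'.2)
      have e1 : (get aC1 (reg rN)).eval ((pushNode (get aC2 (reg rN)) (reg rYy)).sem σ) =
          N.c₁ k := by rw [← hc₁]; simp [pushNode]
      have e2 : (reg rXx).eval ((pushNode (get aC2 (reg rN)) (reg rYy)).sem σ) = x := by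
        rw [← hx]; simp [pushNode]
      have h2 := h1.push (T := T₁) (k := get aC1 (reg rN)) (x := reg rXx) (by rwa [e1])
        (by rw [e1]; omega) (by simp) (by rwa [e2]) (by rw [e2]; exact hfin'.1)
      rw [e2, eval_reg, hy] at h2
      exact h2
    · rintro U ⟨U₁, U', rfl, h1, U₂, U₃, rfl, h2, h3⟩
      have := hs (U₁ ∪ U₂ ∪ U₃) ⟨_, U₃, rfl, .ser T₁ T₂ x y U₁ U₂ hc h1 h2, h3⟩
      rw [← Finset.union_assoc]
      simpa [State.outputEdges, pushNode] using this
  | par T₁ T₂ =>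
    obtain ⟨a1, a2, a2', a3, a3', a4⟩ := hT
    have hsem : expand.sem σ = (pushNode (get aC1 (reg rN)) (reg rYy)).sem
        ((pushNode (get aC2 (reg rN)) (reg rXx + reg rV - reg rYy)).sem σ) := by
      rw [expand, ht 0, if_neg (by rw [a1]; decide), ht 1, if_neg (by rw [a1]; decide), ht 3,
        if_neg (by rw [a1]; decide), ht 4, if_pos a1]
      rfl
    have hfin' : (T₁.val G v y ≠ ⊤ ∧ T₂.val G v (x + v - y) ≠ ⊤) ∧ x + v - y ≤ 2 * v := by
      rw [← hc] at hfin
      simp only [Tree.cand] at hfin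
      split_ifs at hfin
      · exact ⟨ENNReal.add_ne_top.1 hfin, by omega⟩
      · exact absurd rfl hfin
    rw [hsem] at hTab ⊢
    refine ⟨(T₁, y) :: (T₂, x + v - y) :: L, by simp [totalSize, Tree.size]; omega, hTab, ?_, ?_⟩
    · have e0 : (reg rXx + reg rV - reg rYy).eval σ = x + v - y := by
        simp [hx, hy, hB.ctx.v_eq]
      have h1 := hL.push (T := T₂) (k := get aC2 (reg rN)) (x := reg rXx + reg rV - reg rYy)
        (by rwa [hc₂]) (by rw [hc₂]; omega) (by simp) (by rw [e0]; exact hfin'.2)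
        (by rw [e0]; exact hfin'.1.2)
      rw [e0] at h1
      have e1 : (get aC1 (reg rN)).eval ((pushNode (get aC2 (reg rN))
          (reg rXx + reg rV - reg rYy)).sem σ) = N.c₁ k := by rw [← hc₁]; simp [pushNode]
      have e2 : (reg rYy).eval ((pushNode (get aC2 (reg rN))
          (reg rXx + reg rV - reg rYy)).sem σ) = y := by
        rw [← hy]; simp [pushNode]
      have h2 := h1.push (T := T₁) (k := get aC1 (reg rN)) (x := reg rYy) (by rwa [e1])
        (by rw [e1]; omega) (by simp) (by rwa [e2]) (by rw [e2]; exact hfin'.1.1)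
      rw [e2] at h2
      exact h2
    · rintro U ⟨U₁, U', rfl, h1, U₂, U₃, rfl, h2, h3⟩
      have := hs (U₁ ∪ U₂ ∪ U₃) ⟨_, U₃, rfl, .par T₁ T₂ x y U₁ U₂ hc h1 h2, h3⟩
      rw [← Finset.union_assoc]
      simpa [State.outputEdges, pushNode] using this

/-- The output becomes a selection for the root, in time linear in the size of the tree. -/
theorem backtrack_spec (h : Table G D B N K v σ) {T : Tree n m} (hT : Rep G N T (σ.nat rRoot 0))
    (hk : σ.nat rRoot 0 < K) (hfin : T.val G v 0 ≠ ⊤) :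
    Runs backtrack σ (1000 * (m + T.size + 1)) fun τ =>
      Table G D B N K v τ ∧ T.Sel G v 0 (τ.outputEdges m) := by
  refine ((clear_spec h).seq (b₂ := 900 * (m + T.size + 1)) fun σ₁ ⟨h1, h2, h3⟩ _ => ?_).mono
    (by omega) fun τ h => h
  refine (Runs.seq (b₁ := 50) (Runs.simple (R := fun τ => Back G D B N K v T [(T, 0)] τ) rfl rfl
    ⟨h1.frame (Frame.sem rfl σ₁) rfl rfl, ?_, ?_⟩) fun σ₂ h₂ _ =>
    Runs.loop rfl 300 (c := 325) (by norm_num)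
      (fun i τ => ∃ L, Back G D B N K v T L τ ∧ i = totalSize L) ?_ T.size σ₂
        ⟨_, h₂, by simp [totalSize]⟩).mono (by omega) ?_
  · have := h3 ▸ hT
    refine ⟨0, by simp [pushNode], ?_, ?_, ?_, by omega, hfin, rfl⟩
    · simpa [pushNode] using this
    · simpa [pushNode, h3] using hk
    · simp [pushNode]
  · rintro U ⟨U₁, U₂, rfl, h4, rfl⟩
    have e : ((block [setR rTop 0, pushNode (reg rRoot) 0]).sem σ₁).outputEdges m = ∅ := by
      rw [← h2]; simp [State.outputEdges, pushNode]
    rw [e]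
    simpa using h4
  · rintro i τ ⟨L, hL, rfl⟩ hp
    have hp' : 0 < τ.nat rTop 0 := hp
    refine Runs.simple rfl rfl ?_
    have hs : (seq popNode expand).sem τ = expand.sem (popNode.sem τ) := rfl
    rw [hs]
    obtain ⟨g1, g2, g3⟩ := hL
    cases L with
    | nil => simp only [OnStack] at g2; omega
    | cons p L =>
      obtain ⟨T', x⟩ := p
      obtain ⟨r, f1, f2, f3, f4, f5, f6, f7⟩ := g2
      have hf : Frame popNode τ (popNode.sem τ) := Frame.sem rfl τ
      have e1 : (popNode.sem τ).nat rTop 0 = r := by simp [popNode, f1]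
      have e2 : (popNode.sem τ).nat rN 0 = τ.nat aStkN r := by simp [popNode, f1]
      have e3 : (popNode.sem τ).nat rXx 0 = x := by simp [popNode, f1, f4]
      have e4 : (popNode.sem τ).nat rYy 0 =
          τ.nat aCh (τ.nat aStkN r * (2 * v + 1) + x) := by
        simp [popNode, f1, f4, g1.off _ f3.le]
      obtain ⟨c1, c2⟩ := g1.choice f2 f3 f5 f6
      obtain ⟨L', hL', hB⟩ := expand_spec (T₀ := T) (L := L) (g1.frame hf rfl rfl)
        (by rw [hf.nat _ (by decide), hf.nat _ (by decide), e1]; exact f7)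
        (by
          have : (popNode.sem τ).outputEdges m = τ.outputEdges m := by
            simp [State.outputEdges, popNode]
          rw [this]; exact g3)
        e2 e3 e4 f3 f5 c1 f2 f6 c2
      exact ⟨_, hL', L', hB, rfl⟩
  · rintro τ ⟨i, ⟨L, hL, rfl⟩, hp⟩
    have hp' : ¬ 0 < τ.nat rTop 0 := hp
    obtain ⟨g1, g2, g3⟩ := hL
    cases L with
    | nil => exact ⟨g1, by simpa using g3 ∅ rfl⟩
    | cons p L =>
      obtain ⟨T', x⟩ := p
      obtain ⟨r, f1, -⟩ := g2
      omega

end SPNet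

namespace SPNet

open NExpr (get)
open Prog (setN setC ite block seq)

/-! ### The algorithms -/

notation "rGo" => (67 : ℕ)

/-- Store the width `2 * v + 1` of the rows and the multiples of the flow value `v`. -/
def prepare : Prog :=
  block [setR rW (reg rV + reg rV + 1), setN aVm 0 0, setN aVm 1 (reg rV),
    setN aVm 2 (reg rV + reg rV)]

/-- Compute the table for the flow value in `rV`, and try the next flow value if the value of the
root is accepted and the current flow value is not the last one. -/
def round (accept last : Test) : Prog :=
  seq prepare (seq fillTable (ite accept
    (seq backtrack (ite last (block [setN aAns 0 1, setR rGo 0]) (setR rV (reg rV + 1))))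
    (setR rGo 0)))

/-- Find the largest flow value that is accepted and is not preceded by a last flow value, and an
optimal selection of edges for it. -/
def solve (accept last : Test) : Prog :=
  seq reduce (seq (block [setR rRoot (get aMat (matIdx rA rA) - 1), setR rV 0, setR rGo 1])
    (.loop (.lt 0 (reg rGo)) (round accept last)))

/-- The value of the root is finite. -/
def rootFinite : Test := .eq (get aFin (get aOff (reg rRoot))) 1

/-- The value of the root is at most the budget. -/
def rootInBudget : Test :=
  .and rootFinite (.costLe (.get tCost (get aOff (reg rRoot))) (.get 1 0))

variable {n m : ℕ} {G : Network n m} {D : ℕ} {B : ℝ≥0} {N : Nodes} {K k v : ℕ} {σ τ : State}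

/-- The state between two rounds. -/
structure Ready (G : Network n m) (D : ℕ) (B : ℝ≥0) (N : Nodes) (K k v : ℕ) (σ : State) : Prop where
  env : Env G D B σ
  nodes : Nodes.of σ = N
  K_eq : σ.nat rK 0 = K
  v_eq : σ.nat rV 0 = v
  root_eq : σ.nat rRoot 0 = k

theorem Table.root (h : Table G D B N K v σ) (hk : σ.nat rRoot 0 = k) (hkK : k < K)
    {T : Tree n m} (hT : Rep G N T k) :
    flagged (σ.nat aFin ((get aOff (reg rRoot)).eval σ))
      (σ.cst tCost ((get aOff (reg rRoot)).eval σ)) = T.val G v 0 := by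
  rw [eval_get, eval_reg, hk, h.off k hkK.le]
  exact h.filled.val (x := 0) (by omega) (position_lt hkK (by omega)) hT

theorem rootFinite_holds (h : Table G D B N K v σ) (hk : σ.nat rRoot 0 = k) (hkK : k < K)
    {T : Tree n m} (hT : Rep G N T k) : rootFinite.Holds σ ↔ T.val G v 0 ≠ ⊤ := by
  rw [← h.root hk hkK hT]
  change σ.nat aFin ((get aOff (reg rRoot)).eval σ) = 1 ↔ _
  generalize (get aOff (reg rRoot)).eval σ = p
  unfold flagged
  split_ifs with h' <;> simp [h']

theorem rootInBudget_holds (h : Table G D B N K v σ) (hk : σ.nat rRoot 0 = k) (hkK : k < K)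
    {T : Tree n m} (hT : Rep G N T k) : rootInBudget.Holds σ ↔ T.val G v 0 ≤ B := by
  rw [← h.root hk hkK hT]
  change σ.nat aFin ((get aOff (reg rRoot)).eval σ) = 1 ∧
    σ.cst tCost ((get aOff (reg rRoot)).eval σ) ≤ σ.cst 1 0 ↔ _
  rw [h.ctx.env.B_eq]
  generalize (get aOff (reg rRoot)).eval σ = p
  unfold flagged
  split_ifs with h' <;> simp [h']

/-- `S` carries a flow of value `v` and is at most as expensive as the value of the tree `T`. -/
def Good (G : Network n m) (T : Tree n m) (v : ℕ) (S : Finset (Fin m)) : Prop :=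
  (v : ℝ) ≤ G.maxFlow S ∧ (G.totalCost S : ENNReal) ≤ T.val G v 0

theorem good_of_sel {T : Tree n m} {a : Fin n} (hT : T.WF G a a) (hV : T.verts = Finset.univ)
    {S : Finset (Fin m)} (hS : T.Sel G v 0 S) (hfin : T.val G v 0 ≠ ⊤) : Good G T v S := by
  refine ⟨hS.le_maxFlow hT hV hfin, ?_⟩
  have := hS.cost_le hfin
  rwa [← ENNReal.ofNNReal_finsetSum] at this

theorem prepare_spec (h : Ready G D B N K k v σ) : Ctx G D B N K v (prepare.sem σ) := by
  refine ⟨h.env.frame (Frame.sem rfl σ) rfl rfl, ?_, ?_, ?_, ?_, ?_⟩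
  · rw [← h.nodes]; simp [prepare, Nodes.of]
  · simp [prepare, h.K_eq]
  · simp [prepare, h.v_eq]
  · simp [prepare, h.v_eq]; omega
  · intro i hi
    interval_cases i <;> simp [prepare, h.v_eq]; omega

/-- A round for the flow value `v`. The tests `accept` and `last` decide the properties `Q` of the
value of the root and `R` of the flow value. -/
theorem round_spec {accept last : Test} {Q : ENNReal → Prop} {R : ℕ → Prop}
    (ha : accept.time.ble 30 = true) (hs : last.time.ble 30 = true) {T : Tree n m} {a : Fin n}
    (hacc : ∀ v σ, Table G D B N K v σ → σ.nat rRoot 0 = k → (accept.Holds σ ↔ Q (T.val G v 0)))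
    (hlast : ∀ v σ, Table G D B N K v σ → (last.Holds σ ↔ R v)) (hQ : ∀ w, Q w → w ≠ ⊤)
    (hrep : Rep G N T k) (hkK : k < K) (hT : T.WF G a a) (hV : T.verts = Finset.univ)
    (h : Ready G D B N K k v σ) :
    Runs (round accept last) σ (5000 * ((K + 1) * (v + 1) ^ 2) + 1000 * (m + T.size + 1) + 200)
      fun τ => Ready G D B N K k (τ.nat rV 0) τ ∧
        ((¬ Q (T.val G v 0) ∧ τ.nat rV 0 = v ∧ τ.nat rGo 0 = 0 ∧ τ.nat aAns = σ.nat aAns ∧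
            τ.nat aOut = σ.nat aOut) ∨
          (Q (T.val G v 0) ∧ Good G T v (τ.outputEdges m) ∧
            ((R v ∧ τ.nat rV 0 = v ∧ τ.nat rGo 0 = 0 ∧ τ.nat aAns 0 = 1) ∨
            (¬ R v ∧ τ.nat rV 0 = v + 1 ∧ τ.nat rGo = σ.nat rGo ∧ τ.nat aAns = σ.nat aAns)))) := by
  have ha' := Nat.le_of_ble_eq_true ha
  have hs' := Nat.le_of_ble_eq_true hs
  have hready : ∀ {u : ℕ} {τ : State}, Ctx G D B N K u τ → τ.nat rRoot 0 = k →
      Ready G D B N K k (τ.nat rV 0) τ := fun hC hr =>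
    ⟨hC.env, hC.nodes, hC.K_eq, rfl, hr⟩
  refine (Runs.seq (b₁ := 50) (b₂ := 5000 * ((K + 1) * (v + 1) ^ 2) + (accept.time + 1 +
    ((1000 * (m + T.size + 1) + (last.time + 1 + (20 + 20))) + 20)))
    (Runs.simple (R := fun τ => Ctx G D B N K v τ) rfl rfl (prepare_spec h))
    fun σ₁ h₁ hf₁ => (fillTable_spec h₁).seq fun σ₂ ⟨h2, h3, h4⟩ hf₂ => ?_).mono (by omega)
    fun τ h => h
  have hTab : Table G D B N K v σ₂ := ⟨h2, h3, h4⟩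
  have hr₂ : σ₂.nat rRoot 0 = k := by
    rw [hf₂.nat _ (by decide), hf₁.nat _ (by decide), h.root_eq]
  have hgo₂ : σ₂.nat rGo = σ.nat rGo := by
    rw [hf₂.nat _ (by decide), hf₁.nat _ (by decide)]
  have hans₂ : σ₂.nat aAns = σ.nat aAns := by
    rw [hf₂.nat _ (by decide), hf₁.nat _ (by decide)]
  have hout₂ : σ₂.nat aOut = σ.nat aOut := by
    rw [hf₂.nat _ (by decide), hf₁.nat _ (by decide)]
  refine Runs.ite _ (fun ht => ?_) (fun ht => ?_)
  · rw [hacc v σ₂ hTab hr₂] at ht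
    have hfin := hQ _ ht
    refine (backtrack_spec hTab (T := T) (by rwa [hr₂]) (by rwa [hr₂]) hfin).seq
      fun σ₃ ⟨h5, h6⟩ hf₃ => ?_
    have hg := good_of_sel hT hV h6 hfin
    have hr₃ : σ₃.nat rRoot 0 = k := by rw [hf₃.nat _ (by decide), hr₂]
    have hgo₃ : σ₃.nat rGo = σ.nat rGo := by rw [hf₃.nat _ (by decide), hgo₂]
    have hans₃ : σ₃.nat aAns = σ.nat aAns := by rw [hf₃.nat _ (by decide), hans₂]
    refine Runs.ite _ (fun hst => Runs.simple rfl rfl ⟨?_, Or.inr ⟨ht, ?_, Or.inl ⟨?_, ?_, ?_,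
      ?_⟩⟩⟩)
      (fun hst => Runs.simple rfl rfl ⟨?_, Or.inr ⟨ht, ?_, Or.inr ⟨?_, ?_, ?_, ?_⟩⟩⟩)
    · refine ⟨h5.ctx.env.frame (Frame.sem rfl σ₃) rfl rfl, ?_, ?_, rfl, ?_⟩
      · rw [← h5.ctx.nodes]; simp [Nodes.of]
      · simp [h5.ctx.K_eq]
      · simp [hr₃]
    · simpa [State.outputEdges] using hg
    · exact (hlast v σ₃ h5).1 hst
    · simp [h5.ctx.v_eq]
    · simp
    · simp
    · refine ⟨h5.ctx.env.frame (Frame.sem rfl σ₃) rfl rfl, ?_, ?_, rfl, ?_⟩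
      · rw [← h5.ctx.nodes]; simp [Nodes.of]
      · simp [h5.ctx.K_eq]
      · simp [hr₃]
    · simpa [State.outputEdges] using hg
    · exact fun hR => hst ((hlast v σ₃ h5).2 hR)
    · simp [h5.ctx.v_eq]
    · simp [hgo₃]
    · simp [hans₃]
  · rw [hacc v σ₂ hTab hr₂] at ht
    refine Runs.simple rfl rfl ⟨?_, Or.inl ⟨ht, ?_, ?_, ?_, ?_⟩⟩
    · refine ⟨h2.env.frame (Frame.sem rfl σ₂) rfl rfl, ?_, ?_, rfl, ?_⟩
      · rw [← h2.nodes]; simp [Nodes.of]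
      · simp [h2.K_eq]
      · simp [hr₂]
    · simp [h2.v_eq]
    · simp
    · simp [hans₂]
    · simp [hout₂]

/-- The result of `solve`: the flow values before `v` are accepted, and none of them is the last
one. -/
def Solved (G : Network n m) (T : Tree n m) (Q : ENNReal → Prop) (R : ℕ → Prop) (τ : State) :
    Prop :=
  ∃ v, (∀ u < v, Q (T.val G u 0) ∧ ¬ R u) ∧
    ((¬ Q (T.val G v 0) ∧ τ.nat aAns 0 = 0 ∧ (0 < v → Good G T (v - 1) (τ.outputEdges m))) ∨
      (R v ∧ τ.nat aAns 0 = 1 ∧ Good G T v (τ.outputEdges m)))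

/-- The result and the running time of `solve`. An accepted flow value is at most the maximum flow
`F`, so that there are at most `F + 2` rounds, each of which takes time `O(m (F + 1)²)`. -/
theorem solve_spec (hsp : G.IsSeriesParallel) {accept last : Test} {Q : ENNReal → Prop}
    {R : ℕ → Prop} (ha : accept.time.ble 30 = true) (hs : last.time.ble 30 = true)
    (hacc : ∀ N K k v (T : Tree n m) σ, Table G D B N K v σ → σ.nat rRoot 0 = k → k < K →
      Rep G N T k → (accept.Holds σ ↔ Q (T.val G v 0)))
    (hlast : ∀ N K v σ, Table G D B N K v σ → (last.Holds σ ↔ R v)) (hQ : ∀ w, Q w → w ≠ ⊤) :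
    ∃ (t : ℕ) (τ : State) (T : Tree n m) (a : Fin n), Exec (solve accept last) (input G D B) t τ ∧
      (t : ℝ) ≤ (2000000 : ℕ) * (m * (G.maxFlow Finset.univ + 1) ^ 4) ∧ T.WF G a a ∧
      Solved G T Q R τ := by
  obtain ⟨hn, hm, -⟩ := hsp.card_le
  obtain ⟨F, hF⟩ := G.exists_nat_maxFlow Finset.univ
  obtain ⟨t₁, σ, hσ, ht₁, ⟨hE, T, a, hrep, hT, hV, hkK, hK, hsz⟩, hf⟩ :=
    (reduce_spec (D := D) (B := B) hsp).frame
  generalize hk : σ.nat aMat ((matIdx rA rA).eval σ) - 1 = k at hrep hkK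
  generalize hNN : Nodes.of σ = N at hrep
  generalize hKK : σ.nat rK 0 = K at hkK hK
  -- a flow value that is accepted is the value of a flow
  have hle : ∀ v S, Good G T v S → v ≤ F := fun v S hg => by
    have := hg.1.trans (G.maxFlow_mono (Finset.subset_univ S))
    rw [hF] at this
    exact_mod_cast this
  set c := 85000 * (m * (F + 2) ^ 2) + 16000 * m + 250 with hc
  have hrun : Runs (seq (block [setR rRoot (get aMat (matIdx rA rA) - 1), setR rV 0, setR rGo 1])
      (.loop (.lt 0 (reg rGo)) (round accept last))) σ (50 + ((F + 2) * c + c))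
      fun τ => Solved G T Q R τ := by
    refine (Runs.seq (b₁ := 50) (Runs.simple (R := fun τ => Ready G D B N K k 0 τ ∧
        τ.nat rGo 0 = 1 ∧ τ.nat aAns 0 = 0) rfl rfl ⟨⟨hE.frame (Frame.sem rfl σ) rfl rfl, ?_, ?_,
          ?_,
          ?_⟩, ?_, ?_⟩)
      fun τ hτ _ => Runs.loop rfl (c - 21) (c := c) (by omega) (fun i τ => ∃ v,
        Ready G D B N K k v τ ∧ (∀ u < v, Q (T.val G u 0) ∧ ¬ R u) ∧
        ((τ.nat rGo 0 = 1 ∧ i + v = F + 2 ∧ v ≤ F + 1 ∧ τ.nat aAns 0 = 0 ∧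
          (0 < v → Good G T (v - 1) (τ.outputEdges m))) ∨
          (i = 0 ∧ τ.nat rGo 0 = 0 ∧ ((¬ Q (T.val G v 0) ∧ τ.nat aAns 0 = 0 ∧
            (0 < v → Good G T (v - 1) (τ.outputEdges m))) ∨
            (R v ∧ τ.nat aAns 0 = 1 ∧ Good G T v (τ.outputEdges m)))))) ?_ (F + 2) τ ?_).mono
      le_rfl ?_
    · rw [← hNN]; simp [Nodes.of]
    · simp [hKK]
    · simp
    · simp [hk]
    · simp
    · have : σ.nat aAns = fun _ => 0 := hf.nat aAns (by decide)
      simp [this]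
    -- `i` bounds the number of the remaining rounds
    · rintro i τ ⟨v, h1, h2, h3⟩ hp
      have hp' : 0 < τ.nat rGo 0 := hp
      rcases h3 with ⟨h3, h4, h5, h6, h7⟩ | ⟨-, h3, -⟩
      swap
      · omega
      refine (round_spec (a := a) (T := T) ha hs
        (fun v σ hT hr => hacc N K k v T σ hT hr hkK hrep) (hlast N K) hQ hrep hkK hT hV h1).mono
        ?_ ?_
      · have e1 : (v + 1) ^ 2 ≤ (F + 2) ^ 2 := Nat.pow_le_pow_left (by omega) 2
        have e2 : (K + 1) * (v + 1) ^ 2 ≤ (17 * m) * (F + 2) ^ 2 :=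
          Nat.mul_le_mul (by omega) e1
        rw [mul_assoc] at e2
        omega
      · rintro ρ ⟨g1, g2⟩
        rcases g2 with ⟨g2, g3, g4, g5, g6⟩ | ⟨g2, g3, ⟨g4, g5, g6, g7⟩ | ⟨g4, g5, g6, g7⟩⟩
        · refine ⟨0, by omega, v, g3 ▸ g1, h2, Or.inr ⟨rfl, g4, Or.inl ⟨g2, by rw [g5, h6], ?_⟩⟩⟩
          simpa [State.outputEdges, g6] using h7
        · exact ⟨0, by omega, v, g5 ▸ g1, h2, Or.inr ⟨rfl, g6, Or.inr ⟨g4, g7, g3⟩⟩⟩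
        · have := hle v _ g3
          refine ⟨i - 1, by omega, v + 1, g5 ▸ g1, fun u hu => ?_, Or.inl ⟨by rw [g6, h3], by omega,
            by omega, by rw [g7, h6], fun _ => g3⟩⟩
          rcases Nat.lt_succ_iff_lt_or_eq.1 hu with h | rfl
          · exact h2 u h
          · exact ⟨g2, g4⟩
    · exact ⟨0, hτ.1, by simp, Or.inl ⟨hτ.2.1, rfl, by omega, hτ.2.2, by simp⟩⟩
    · rintro τ ⟨i, ⟨v, h1, h2, h3⟩, hp⟩
      have hp' : ¬ 0 < τ.nat rGo 0 := hp
      rcases h3 with ⟨h3, -⟩ | ⟨-, -, h3⟩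
      · omega
      · exact ⟨v, h2, h3⟩
  obtain ⟨t₂, τ, hτ, ht₂, hsol⟩ := hrun
  refine ⟨t₁ + t₂, τ, T, a, .seq _ _ _ _ _ _ _ hσ hτ, ?_, hT, hsol⟩
  rw [hF]
  have key : t₁ + t₂ ≤ 2000000 * (m * (F + 1) ^ 4) := by
    have e1 : F + 2 ≤ 2 * (F + 1) := by omega
    have e2 : F + 3 ≤ 3 * (F + 1) := by omega
    have e3 : (F + 2) ^ 2 ≤ 4 * (F + 1) ^ 2 := by
      calc (F + 2) ^ 2 ≤ (2 * (F + 1)) ^ 2 := Nat.pow_le_pow_left e1 2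
        _ = _ := by ring
    have e4 : c ≤ 400000 * (m * (F + 1) ^ 2) := by
      have e5 : m * (F + 2) ^ 2 ≤ m * (4 * (F + 1) ^ 2) := Nat.mul_le_mul_left m e3
      have e6 : m * 1 ≤ m * (F + 1) ^ 2 := Nat.mul_le_mul_left m (Nat.one_le_pow _ _ (by omega))
      have e7 : m * (4 * (F + 1) ^ 2) = 4 * (m * (F + 1) ^ 2) := by ring
      omega
    have e5 : (F + 3) * c ≤ (3 * (F + 1)) * (400000 * (m * (F + 1) ^ 2)) := Nat.mul_le_mul e2 e4
    have e6 : (3 * (F + 1)) * (400000 * (m * (F + 1) ^ 2)) = 1200000 * (m * (F + 1) ^ 3) := by ring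
    have e7 : (F + 2) * c + c = (F + 3) * c := by ring
    have e8 : m * (F + 1) ^ 3 ≤ m * (F + 1) ^ 4 :=
      Nat.mul_le_mul_left m (Nat.pow_le_pow_right (by omega) (by omega))
    have e9 : m * 1 ≤ m * (F + 1) ^ 4 := Nat.mul_le_mul_left m (Nat.one_le_pow _ _ (by omega))
    omega
  exact_mod_cast key

theorem exists_BCMFP : ∃ (P : Prog) (C : ℕ), ∀ (n m : ℕ) (G : Network n m), G.IsSeriesParallel →
    ∀ B : ℝ≥0, ∃ (T : ℕ) (τ : State), Exec P (inputBCMFP G B) T τ ∧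
      (T : ℝ) ≤ C * (m * (G.maxFlow Finset.univ + 1) ^ 4) ∧
      G.IsBCMFPSolution B (τ.outputEdges m) := by
  -- there is no last flow value: the test `0 < 0` never holds
  refine ⟨solve rootInBudget (.lt 0 0), 2000000, fun n m G hsp B => ?_⟩
  obtain ⟨t, τ, T, a, h1, h2, hT, v, hv, h3⟩ := solve_spec hsp (D := 0) (B := B)
    (accept := rootInBudget) (last := .lt 0 0) (Q := fun w => w ≤ B) (R := fun _ => False) rfl rfl
    (fun N K k v T σ hTab hk hkK hT => rootInBudget_holds hTab hk hkK hT)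
    (fun N K v σ _ => by simp [Test.Holds]) (fun w hw => ne_top_of_le_ne_top ENNReal.coe_ne_top hw)
  refine ⟨t, τ, h1, h2, ?_⟩
  rcases h3 with ⟨h3, -, h4⟩ | ⟨h3, -⟩
  swap
  · exact h3.elim
  have hv0 : 0 < v := by
    rcases Nat.eq_zero_or_pos v with rfl | h
    -- the flow value `0` is accepted, as the empty selection shows
    · refine absurd ?_ h3
      have := T.val_le_totalCost (S := ∅) (v := 0) hT (by simpa using G.maxFlow_nonneg ∅) 0 (by
        simp)
      exact this.trans (by simp [Network.totalCost])
    · exact h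
  obtain ⟨h5, h6⟩ := h4 hv0
  refine ⟨by exact_mod_cast h6.trans (hv (v - 1) (by omega)).1, fun S' hS' => ?_⟩
  -- the set `S'` does not carry the flow value `v`, and its maximum flow is an integer
  obtain ⟨w, hw⟩ := G.exists_nat_maxFlow S'
  refine le_trans ?_ h5
  rw [hw]
  have : w < v := by
    by_contra hlt
    refine h3 ((T.val_le_totalCost (S := S') (v := v) hT ?_ 0 (by simp)).trans
      (by exact_mod_cast hS'))
    rw [hw]
    exact_mod_cast not_lt.1 hlt
  exact_mod_cast (by omega : w ≤ v - 1)

theorem exists_CapNDP : ∃ (P : Prog) (C : ℕ), ∀ (n m : ℕ) (G : Network n m), G.IsSeriesParallel →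
    ∀ D : ℕ, ∃ (T : ℕ) (τ : State), Exec P (inputCapNDP G D) T τ ∧
      (T : ℝ) ≤ C * (m * (G.maxFlow Finset.univ + 1) ^ 4) ∧
      (τ.AnswersFeasible ↔ ∃ S : Finset (Fin m), G.MeetsDemand D S) ∧
      (τ.AnswersFeasible → G.IsCapNDPSolution D (τ.outputEdges m)) := by
  refine ⟨solve rootFinite (.eq (reg rV) (get aPar 4)), 2000000, fun n m G hsp D => ?_⟩
  obtain ⟨t, τ, T, a, h1, h2, hT, v, hv, h3⟩ := solve_spec hsp (D := D) (B := 0)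
    (accept := rootFinite) (last := .eq (reg rV) (get aPar 4)) (Q := fun w => w ≠ ⊤)
    (R := fun v => v = D) rfl rfl
    (fun N K k v T σ hTab hk hkK hT => rootFinite_holds hTab hk hkK hT)
    (fun N K v σ hTab => by simp [Test.Holds, hTab.ctx.v_eq, hTab.ctx.env.D_eq]) (fun w hw => hw)
  refine ⟨t, τ, h1, h2, ?_⟩
  rcases h3 with ⟨h3, h4, -⟩ | ⟨rfl, h4, h5, h6⟩
  · have hf : ¬ τ.AnswersFeasible := by simp [State.AnswersFeasible, h4]
    refine ⟨⟨fun h => absurd h hf, fun ⟨S, hS⟩ => absurd ?_ h3⟩, fun h => absurd h hf⟩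
    have hvD : v ≤ D := by
      by_contra hlt
      exact (hv D (by omega)).2 rfl
    have : (v : ℝ) ≤ G.maxFlow S := le_trans (by exact_mod_cast hvD) hS
    exact ne_top_of_le_ne_top ENNReal.coe_ne_top (T.val_le_totalCost hT this 0 (by simp))
  · refine ⟨⟨fun _ => ⟨_, h5⟩, fun _ => by simp [State.AnswersFeasible, h4]⟩,
      fun _ => ⟨h5, fun S' hS' => ?_⟩⟩
    exact_mod_cast h6.trans (T.val_le_totalCost hT hS' 0 (by simp))

end SPNet

theorem theorem1 :
    (∃ (P : SPNet.Prog) (C : ℕ), ∀ (n m : ℕ) (G : SPNet.Network n m), G.IsSeriesParallel →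
      ∀ B : NNReal, ∃ (T : ℕ) (τ : SPNet.State),
        SPNet.Exec P (SPNet.inputBCMFP G B) T τ ∧
        (T : ℝ) ≤ C * (m * (G.maxFlow Finset.univ + 1) ^ 4) ∧
        G.IsBCMFPSolution B (τ.outputEdges m)) ∧
    (∃ (P : SPNet.Prog) (C : ℕ), ∀ (n m : ℕ) (G : SPNet.Network n m), G.IsSeriesParallel →
      ∀ D : ℕ, ∃ (T : ℕ) (τ : SPNet.State),
        SPNet.Exec P (SPNet.inputCapNDP G D) T τ ∧
        (T : ℝ) ≤ C * (m * (G.maxFlow Finset.univ + 1) ^ 4) ∧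
        (τ.AnswersFeasible ↔ ∃ S : Finset (Fin m), G.MeetsDemand D S) ∧
        (τ.AnswersFeasible → G.IsCapNDPSolution D (τ.outputEdges m))) :=
  ⟨SPNet.exists_BCMFP, SPNet.exists_CapNDP⟩
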